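/- **Setting.** Let $\mathcal C$ be a complete and cocomplete additive category, and let $\mathcal P$ be a class of objects of $\mathcal C$ (the *projectives*) closed under retracts and small coproducts. A morphism $f$ is *$\mathcal P$-split* if $\mathcal C(P,f)$ is surjective for every $P\in\mathcal P$. Assume that $(\mathcal C,\mathcal P)$ has *enough functorial projectives*: there are a functor $F:\mathcal C\to\mathcal C$ and a natural transformation $u:F\to \mathrm{id}_{\mathcal C}$ such that, for every $X$, $F(X)\in\mathcal P$ and $u_X$ is $\mathcal P$-split. Let $c\mathcal C$ be the category of chain complexes in $\mathcal C$ in nonnegative degrees. For $A,B\in c\mathcal C$ let $\underline{c\mathcal C}(A,B)$ be the nonnegatively graded complex of abelian groups given by the truncation $\tau_{\ge 0}$ of the product total complex of $\mathcal C(A_p,B_q)$ (total degree $q-p$). For $P\in\mathcal P$ let $S^n(P)$ be $P$ concentrated in degree $n$, and for $n\ge1$ let $D^n(P)$ be $\mathrm{id}_P$ placed in degrees $n$ and $n-1$. Let $I$ be the class of all maps $S^{n-1}(P)\to D^n(P)$, $n\ge 1$, given by $\mathrm{id}_P$ in degree $n-1$, together with all maps $0\to S^0(P)$; let $J$ be the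 class of all maps $0\to D^n(P)$, $n\ge1$ (with $P\in\mathcal P$ throughout). In $c\mathcal C$, a map $f$ is * a *fibration* if it has the right lifting property with respect to $J$; * a *cofibration* if it has the left lifting property with respect to all maps having the right lifting property with respect to $I$; * a *weak equivalence* if $\underline{c\mathcal C}(S^0(P),f)$ is a quasi-isomorphism for every $P\in\mathcal P$. A complex $A\in c\mathcal C$ is *$\mathcal P$-exact* if $A_{n+1}\to\ker(A_n\to A_{n-1})$ is $\mathcal P$-split for every $n\ge 0$, where $A_{-1}=0$. Let $s\mathcal C$ be the category of simplicial objects in $\mathcal C$; for a simplicial set $K$ and an object $P$ write $K\cdot P$ for the simplicial object $[n]\mapsto\coprod_{K_n}P$. In $s\mathcal C$, a map $f$ is a *weak equivalence* if the map $\underline{s\mathcal C}_{sSet}(\mathrm{disc}\,P,f)$ of simplicial mapping spaces (with $\mathrm{disc}\,P$ the constant simplicial object) is a weak equivalence of simplicial sets for every $P\in\mathcal P$; a *fibration* if it has the right lifting property with respect to the maps $\Lambda^n_k\cdot P\to\Delta^n\cdot P$ ($n\ge1$, $0\le k\le n$, $P\in\mathcal P$); and a *cofibration* if it is a retract of a transfinite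 composition of pushouts of maps $\partial\Delta^n\cdot P\to\Delta^n\cdot P$ ($n\ge0$, $P\in\mathcal P$). A *model category* is a complete and cocomplete category with a model structure whose two factorisations can be chosen functorially. A *left* (*right*) *Quillen functor* is a left (right) adjoint that preserves cofibrations and trivial cofibrations (fibrations and trivial fibrations). **Theorem.** Under these assumptions: 1. A map in $c\mathcal C$ is a weak equivalence if and only if its mapping cone is $\mathcal P$-exact. 2. With the above weak equivalences, cofibrations and fibrations, $c\mathcal C$ is a model category. 3. A map $f$ in $c\mathcal C$ is a cofibration if and only if, for every $n\ge0$, $f_n$ is a split monomorphism with cokernel in $\mathcal P$. In particular, a complex $A$ is cofibrant if and only if $A_n\in\mathcal P$ for all $n\geq 0$. 4. A map $f$ in $c\mathcal C$ is a fibration if and only if $f_n$ is $\mathcal P$-split for every $n\ge1$. In particular, every object of $c\mathcal C$ is fibrant. 5. With the above weak equivalences, cofibrations and fibrations, $s\mathcal C$ is a model category, and the Dold–Kan functor $\Gamma:c\mathcal C\to s\mathcal C$ is an equivalence of categories which is both a left Quillen functor and a right Quillen functor. -/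

import Mathlib

open CategoryTheory Category Limits ZeroObject HomotopicalAlgebra

universe w v u u'

noncomputable section

namespace RelHomAlg

/-! ### Model categories and Quillen functors -/

section ModelCategories

variable {D : Type u} [Category.{v} D] {E : Type u'} [Category.{v} E]

/-- The classes `W`, `Cof`, `Fib` of weak equivalences, cofibrations and fibrations make `D` a
model category in the strong sense: `D` is complete and cocomplete, the three classes satisfy the
axioms of a (closed) model category, and both factorisations can be chosen functorially. -/
structure IsModelCategory (W Cof Fib : MorphismProperty D) : Prop where
  hasLimits : HasLimitsOfSize.{w, w} D
  hasColimits : HasColimitsOfSize.{w, w} D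
  exists_modelCategory : ∃ M : ModelCategory D,
    M.categoryWithWeakEquivalences.weakEquivalences = W ∧
    M.categoryWithCofibrations.cofibrations = Cof ∧
    M.categoryWithFibrations.fibrations = Fib
  functorialFactorization_cof_trivFib :
    MorphismProperty.HasFunctorialFactorization Cof (Fib ⊓ W)
  functorialFactorization_trivCof_fib :
    MorphismProperty.HasFunctorialFactorization (Cof ⊓ W) Fib

/-- `F` is a left Quillen functor: it is a left adjoint, and it preserves cofibrations and
trivial cofibrations. -/
structure IsLeftQuillen (F : D ⥤ E) (W Cof : MorphismProperty D)
    (W' Cof' : MorphismProperty E) : Prop where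
  isLeftAdjoint : F.IsLeftAdjoint
  map_cof : ∀ ⦃X Y : D⦄ (f : X ⟶ Y), Cof f → Cof' (F.map f)
  map_trivCof : ∀ ⦃X Y : D⦄ (f : X ⟶ Y), (Cof ⊓ W) f → (Cof' ⊓ W') (F.map f)

/-- `F` is a right Quillen functor: it is a right adjoint, and it preserves fibrations and
trivial fibrations. -/
structure IsRightQuillen (F : D ⥤ E) (W Fib : MorphismProperty D)
    (W' Fib' : MorphismProperty E) : Prop where
  isRightAdjoint : F.IsRightAdjoint
  map_fib : ∀ ⦃X Y : D⦄ (f : X ⟶ Y), Fib f → Fib' (F.map f)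
  map_trivFib : ∀ ⦃X Y : D⦄ (f : X ⟶ Y), (Fib ⊓ W) f → (Fib' ⊓ W') (F.map f)

end ModelCategories

/-! ### Classes of projectives -/

section Projectives

variable {C : Type u} [Category.{v} C] (Proj : ObjectProperty C)

/-- The `Proj`-split morphisms: those `f` such that `Hom(P, f)` is surjective for all `P` in `Proj`. -/
def projSplit : MorphismProperty C :=
  fun X _ f ↦ ∀ P : C, Proj P → Function.Surjective (fun g : P ⟶ X ↦ g ≫ f)

/-- `C` has enough functorial projectives: there is a functor `F` with values in `Proj` and a
natural transformation `F X ⟶ X` all of whose components are `Proj`-split. -/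
def HasEnoughFunctorialProjectives : Prop :=
  ∃ (F : C ⥤ C) (u : F ⟶ 𝟭 C), ∀ X : C, Proj (F.obj X) ∧ projSplit Proj (u.app X)

end Projectives

/-! ### The enrichment of chain complexes over chain complexes of abelian groups -/

section HomComplex

variable {C : Type u} [Category.{v} C] [Preadditive C]

/-- The group of families `A_p ⟶ B_q` with `p + n = q`, i.e. the degree `n` part (`n ≥ 0`) of the
product total complex of the double complex `Hom(A_p, B_q)`. -/
def HomTot (A B : ChainComplex C ℕ) (n : ℕ) : Type v :=
  ∀ i : {i : ℕ × ℕ // i.1 + n = i.2}, A.X i.1.1 ⟶ B.X i.1.2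

instance (A B : ChainComplex C ℕ) (n : ℕ) : AddCommGroup (HomTot A B n) :=
  inferInstanceAs (AddCommGroup (∀ i : {i : ℕ × ℕ // i.1 + n = i.2}, A.X i.1.1 ⟶ B.X i.1.2))

namespace HomTot

variable {A B B' : ChainComplex C ℕ}

/-- The component `A_p ⟶ B_q` of a family. -/
def app {n : ℕ} (f : HomTot A B n) (p q : ℕ) (h : p + n = q) : A.X p ⟶ B.X q :=
  f ⟨(p, q), h⟩

/-- The family with given components. -/
def mk {n : ℕ} (f : ∀ p q : ℕ, p + n = q → (A.X p ⟶ B.X q)) : HomTot A B n :=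
  fun i ↦ f i.1.1 i.1.2 i.2

@[simp]
lemma mk_app {n : ℕ} (f : ∀ p q : ℕ, p + n = q → (A.X p ⟶ B.X q)) (p q : ℕ) (h : p + n = q) :
    (mk f).app p q h = f p q h := rfl

@[ext]
lemma ext {n : ℕ} {f g : HomTot A B n} (h : ∀ p q hpq, f.app p q hpq = g.app p q hpq) : f = g :=
  funext fun i ↦ h i.1.1 i.1.2 i.2

@[simp]
lemma add_app {n : ℕ} (f g : HomTot A B n) (p q : ℕ) (h : p + n = q) :
    (f + g).app p q h = f.app p q h + g.app p q h := rfl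

@[simp]
lemma zero_app {n : ℕ} (p q : ℕ) (h : p + n = q) :
    (0 : HomTot A B n).app p q h = 0 := rfl

/-- The components of the composite of the differential of `A` (where `A_{-1} = 0`) with a family
of degree `n + 1`. -/
def dPre {n : ℕ} (f : HomTot A B (n + 1)) : ∀ p q : ℕ, p + n = q → (A.X p ⟶ B.X q)
  | 0, _, _ => 0
  | p + 1, q, h => A.d (p + 1) p ≫ f.app p q (by omega)

/-- The components of the composite of a family of degree `n + 1` with the differential of `B`. -/
def dPost {n : ℕ} (f : HomTot A B (n + 1)) (p q : ℕ) (h : p + n = q) : A.X p ⟶ B.X q :=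
  f.app p (q + 1) (by omega) ≫ B.d (q + 1) q

/-- The total differential `f ↦ d f - (-1)^(deg f) f d` on families of degree `n + 1`. -/
def δ (n : ℕ) : HomTot A B (n + 1) →+ HomTot A B n where
  toFun f := mk fun p q h ↦ dPost f p q h + (-1 : ℤ) ^ n • dPre f p q h
  map_zero' := by
    ext p q h
    cases p <;> simp [dPre, dPost]
  map_add' f g := by
    ext p q h
    cases p
    · simp [dPre, dPost]
    · simp only [mk_app, dPost, add_app, Preadditive.add_comp, dPre, Preadditive.comp_add,
        smul_add]
      abel

lemma δ_app (n : ℕ) (f : HomTot A B (n + 1)) (p q : ℕ) (h : p + n = q) :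
    (δ n f).app p q h = dPost f p q h + (-1 : ℤ) ^ n • dPre f p q h := rfl

lemma δ_δ (n : ℕ) (f : HomTot A B (n + 2)) : δ n (δ (n + 1) f) = 0 := by
  ext p q h
  rcases p with _ | _ | p
  · simp [δ_app, dPre, dPost]
  · simp [δ_app, dPre, dPost, pow_succ]
  · simp [δ_app, dPre, dPost, pow_succ]

/-- The chain map given by the differential of a family of degree `1`. -/
def δ₀ : HomTot A B 1 →+ (A ⟶ B) where
  toFun f :=
    { f p := (δ 0 f).app p p (by omega)
      comm' := by
        rintro i j hij
        obtain rfl : j + 1 = i := hij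
        cases j <;> simp [δ_app, dPre, dPost] }
  map_zero' := by ext p; simp
  map_add' f g := by ext p; simp

lemma δ₀_f (f : HomTot A B 1) (p : ℕ) : (δ₀ f).f p = (δ 0 f).app p p (by omega) := rfl

lemma δ₀_δ (f : HomTot A B 2) : δ₀ (δ 1 f) = 0 := by
  ext p
  rw [δ₀_f, δ_δ]
  rfl

/-- Postcomposition of a family with a chain map. -/
def postcomp (g : B ⟶ B') (n : ℕ) : HomTot A B n →+ HomTot A B' n where
  toFun f := mk fun p q h ↦ f.app p q h ≫ g.f q
  map_zero' := by ext; simp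
  map_add' f g := by ext; simp

lemma postcomp_app (g : B ⟶ B') (n : ℕ) (f : HomTot A B n) (p q : ℕ) (h : p + n = q) :
    (postcomp g n f).app p q h = f.app p q h ≫ g.f q := rfl

lemma δ_postcomp (g : B ⟶ B') (n : ℕ) (f : HomTot A B (n + 1)) :
    δ n (postcomp g (n + 1) f) = postcomp g n (δ n f) := by
  ext p q h
  cases p <;> simp [δ_app, postcomp_app, dPre, dPost]

lemma δ₀_postcomp (g : B ⟶ B') (f : HomTot A B 1) :
    δ₀ (postcomp g 1 f) = δ₀ f ≫ g := by
  ext p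
  rw [δ₀_f, δ_postcomp]
  rfl

end HomTot

/-- The groups of `homComplex A B`: in degree `0`, the kernel of the total differential from
degree `0` to degree `-1`, which is the group of chain maps; in degree `n > 0` the whole group
of families of degree `n`. -/
def homComplexX (A B : ChainComplex C ℕ) : ℕ → AddCommGrpCat.{v}
  | 0 => AddCommGrpCat.of (A ⟶ B)
  | n + 1 => AddCommGrpCat.of (HomTot A B (n + 1))

/-- The differentials of `homComplex A B`. -/
def homComplexD (A B : ChainComplex C ℕ) : ∀ n, homComplexX A B (n + 1) ⟶ homComplexX A B n
  | 0 => AddCommGrpCat.ofHom (HomTot.δ₀ (A := A) (B := B))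
  | n + 1 => AddCommGrpCat.ofHom (HomTot.δ (A := A) (B := B) (n + 1))

lemma homComplexD_comp (A B : ChainComplex C ℕ) (n : ℕ) :
    homComplexD A B (n + 1) ≫ homComplexD A B n = 0 := by
  cases n
  · ext f
    exact HomTot.δ₀_δ f
  · ext f
    exact HomTot.δ_δ _ f

/-- The hom object of the enrichment of `ChainComplex C ℕ` over `ChainComplex Ab ℕ`: the
truncation to nonnegative degrees (keeping the cycles in degree `0`) of the product total
complex of `Hom(A_p, B_q)`. -/
def homComplex (A B : ChainComplex C ℕ) : ChainComplex AddCommGrpCat.{v} ℕ :=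
  ChainComplex.of (homComplexX A B) (homComplexD A B) (homComplexD_comp A B)

/-- The components of `homComplexMap`. -/
def homComplexMapX (A : ChainComplex C ℕ) {B B' : ChainComplex C ℕ} (g : B ⟶ B') :
    ∀ n, homComplexX A B n ⟶ homComplexX A B' n
  | 0 => AddCommGrpCat.ofHom (Preadditive.rightComp A g)
  | n + 1 => AddCommGrpCat.ofHom (HomTot.postcomp g (n + 1))

lemma homComplexMapX_comm (A : ChainComplex C ℕ) {B B' : ChainComplex C ℕ} (g : B ⟶ B') (n : ℕ) :
    homComplexMapX A g (n + 1) ≫ homComplexD A B' n =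
      homComplexD A B n ≫ homComplexMapX A g n := by
  cases n
  · ext f
    exact HomTot.δ₀_postcomp g f
  · ext f
    exact HomTot.δ_postcomp g _ f

/-- The functoriality of `homComplex A B` in `B`. -/
def homComplexMap (A : ChainComplex C ℕ) {B B' : ChainComplex C ℕ} (g : B ⟶ B') :
    homComplex A B ⟶ homComplex A B' :=
  ChainComplex.ofHom (X := homComplex A B) (Y := homComplex A B') (homComplexMapX A g) (fun n ↦ by
    dsimp only [homComplex]
    rw [ChainComplex.of_d, ChainComplex.of_d]
    exact homComplexMapX_comm A g n)

end HomComplex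

/-! ### Nonnegative chain complexes -/

section Chain

variable {C : Type u} [Category.{v} C] [Preadditive C] [HasZeroObject C]

/-- `S^n(P)`: the complex with `P` in degree `n` and zero otherwise. -/
abbrev sphere (n : ℕ) (P : C) : ChainComplex C ℕ :=
  (HomologicalComplex.single C (ComplexShape.down ℕ) n).obj P

/-- `D^{n+1}(P)`: the complex with the identity of `P` from degree `n + 1` to degree `n`, and
zero otherwise. -/
abbrev disk (n : ℕ) (P : C) : ChainComplex C ℕ :=
  HomologicalComplex.double (c := ComplexShape.down ℕ) (𝟙 P)
    (ComplexShape.down_mk (n + 1) n rfl)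

/-- The map `S^n(P) ⟶ D^{n+1}(P)` which is the identity of `P` in degree `n`. -/
def sphereToDisk (n : ℕ) (P : C) : sphere n P ⟶ disk n P :=
  HomologicalComplex.mkHomFromSingle
    (HomologicalComplex.doubleXIso₁ (𝟙 P) (ComplexShape.down_mk (n + 1) n rfl)
      (Nat.succ_ne_self n)).inv
    (fun k hk ↦ by
      have hk' : k + 1 = n := hk
      exact (HomologicalComplex.isZero_double_X _ _ k (by omega) (by omega)).eq_of_tgt _ _)

variable (Proj : ObjectProperty C)

/-- The class `I`: the maps `S^{n-1}(P) ⟶ D^n(P)` for `P` in `Proj` and `n ≥ 0`, where for `n = 0`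
this is the map `0 ⟶ S^0(P)`. -/
inductive chainI : ∀ ⦃X Y : ChainComplex C ℕ⦄, (X ⟶ Y) → Prop
  | zero (P : C) (hP : Proj P) : chainI (0 : (0 : ChainComplex C ℕ) ⟶ sphere 0 P)
  | succ (n : ℕ) (P : C) (hP : Proj P) : chainI (sphereToDisk n P)

/-- The class `J`: the maps `0 ⟶ D^n(P)` for `P` in `Proj` and `n ≥ 1`. -/
inductive chainJ : ∀ ⦃X Y : ChainComplex C ℕ⦄, (X ⟶ Y) → Prop
  | mk (n : ℕ) (P : C) (hP : Proj P) : chainJ (0 : (0 : ChainComplex C ℕ) ⟶ disk n P)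

/-- Cofibrations of chain complexes: the left lifting property with respect to all maps that
have the right lifting property with respect to `I`. -/
def chainCof : MorphismProperty (ChainComplex C ℕ) :=
  MorphismProperty.llp (MorphismProperty.rlp (chainI Proj))

/-- Fibrations of chain complexes: the right lifting property with respect to `J`. -/
def chainFib : MorphismProperty (ChainComplex C ℕ) :=
  MorphismProperty.rlp (chainJ Proj)

/-- Weak equivalences of chain complexes: those `f` such that `Hom(S^0 P, f)` (the enriched hom)
is a weak equivalence of nonnegative complexes of abelian groups, i.e. a
quasi-isomorphism, for all `P` in `Proj`. -/
def chainW : MorphismProperty (ChainComplex C ℕ) :=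
  fun _ _ f ↦ ∀ P : C, Proj P → QuasiIso (homComplexMap (sphere 0 P) f)

/-- A nonnegative complex `A` is exact in the `Proj`-split structure if `A_{n+1} ⟶ ker(A_n ⟶ A_{n-1})`
is `Proj`-split for all `n ≥ 0`, where `A_{-1} = 0`. -/
def IsSplitExact [HasKernels C] (A : ChainComplex C ℕ) : Prop :=
  ∀ n : ℕ, projSplit Proj
    (kernel.lift (A.d n (n - 1)) (A.d (n + 1) n) (A.d_comp_d (n + 1) n (n - 1)))

end Chain

/-! ### Simplicial objects -/

section SSet

/-- The set of homotopy classes of maps of simplicial sets, i.e. the quotient of the set of maps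
by the equivalence relation generated by homotopy (if `K` is a Kan complex, then homotopy is
already an equivalence relation). -/
def HomotopyClasses (X K : SSet.{v}) : Type v :=
  Quot (fun f g : X ⟶ K ↦ Nonempty (SSet.Homotopy f g))

/-- A map `f : X ⟶ Y` of simplicial sets is a weak (homotopy) equivalence if for all Kan complexes
`K`, every map `X ⟶ K` is homotopic to a map that extends along `f`, uniquely up to homotopy:
that is, `f` induces a bijection `[Y, K] → [X, K]`. -/
def IsWeakEquivalence {X Y : SSet.{v}} (f : X ⟶ Y) : Prop :=
  ∀ (K : SSet.{v}) [SSet.KanComplex K],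
    Function.Bijective
      (Quot.lift (fun g : Y ⟶ K ↦ (Quot.mk _ (f ≫ g) : HomotopyClasses X K))
        (fun _ _ ⟨h⟩ ↦ Quot.sound ⟨h.precomp
          (SSet.RelativeMorphism.botEquiv.symm f) (by simp)⟩) :
        HomotopyClasses Y K → HomotopyClasses X K)

end SSet

section Simplicial

variable {C : Type u} [Category.{v} C] [HasCoproducts.{v} C]

/-- The functor `K ↦ K · P`, where `(K · P)_n` is the coproduct of copies of `P` indexed
by `K_n`. -/
def copower (P : C) : SSet.{v} ⥤ SimplicialObject C :=
  (SimplicialObject.whiskering (Type v) C).obj (sigmaConst.{v}.obj P)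

variable (Proj : ObjectProperty C)

/-- The class `I` of maps `∂Δ[n] · P ⟶ Δ[n] · P` for `P` in `Proj` and `n ≥ 0`. -/
inductive simplicialI : ∀ ⦃X Y : SimplicialObject C⦄, (X ⟶ Y) → Prop
  | mk (n : ℕ) (P : C) (hP : Proj P) :
      simplicialI ((copower P).map (SSet.boundary.{v} n).ι)

/-- The class `J` of maps `Λ[n, k] · P ⟶ Δ[n] · P` for `P` in `Proj`, `n ≥ 1` and `0 ≤ k ≤ n`. -/
inductive simplicialJ : ∀ ⦃X Y : SimplicialObject C⦄, (X ⟶ Y) → Prop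
  | mk (n : ℕ) (k : Fin (n + 2)) (P : C) (hP : Proj P) :
      simplicialJ ((copower P).map (SSet.horn.{v} (n + 1) k).ι)

/-- Cofibrations of simplicial objects: the retracts of relative `I`-cell complexes, i.e. of
transfinite compositions of pushouts of maps in `I`. -/
def simplicialCof : MorphismProperty (SimplicialObject C) :=
  (MorphismProperty.transfiniteCompositions.{v}
    (MorphismProperty.pushouts (simplicialI Proj))).retracts

/-- Fibrations of simplicial objects: the right lifting property with respect to `J`. -/
def simplicialFib : MorphismProperty (SimplicialObject C) :=
  MorphismProperty.rlp (simplicialJ Proj)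

/-- Weak equivalences of simplicial objects: those `f` such that the map of simplicial sets
`Hom(disc P, f)` (the simplicially enriched hom, with `disc P` the constant simplicial object)
is a weak equivalence for all `P` in `Proj`. -/
def simplicialW : MorphismProperty (SimplicialObject C) :=
  fun _ _ f ↦ ∀ P : C, Proj P →
    IsWeakEquivalence (eHomWhiskerLeft SSet.{v} ((SimplicialObject.const C).obj P) f)

end Simplicial

end RelHomAlg

end

noncomputable section

namespace RelHomAlg

/-! ### Quasi-isomorphisms of complexes of abelian groups, elementwise -/

section AbComplex

/-! Everything is tested on maps out of projectives. A map from `D^{n+1}(P)` to `X` is an element of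
`Hom(P, X_{n+1})`, and a map from `S^n(P)` is a cycle. Lifting properties and weak equivalences thus
become statements about elements (`chainFib_iff`, `rlp_chainI_iff`, `chainW_iff`), and diagram
chases show that the right lifting property against `I` characterises trivial fibrations
(`rlp_chainI_eq`) and give the mapping cone criterion (`chainW_iff_isSplitExact`).

Neither factorisation uses a small object argument, so no smallness of projectives is needed. A map
`A ⟶ B` factors through `A ⊞ ⨁ D^{n+1}(F(B_{n+1}))` as a trivial cofibration followed by a
fibration. Attaching cells of dimension 0, 1, 2, ..., once each, yields a relative cell complex
followed by a trivial fibration, because attaching `n`-cells changes only degree `n`. Both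
constructions use only `F`, limits and colimits, hence are functorial. The retract argument
identifies the trivial cofibrations (`chainCof_inf_chainW`). Cofibrations can be recognised
degreewise because evaluation in a degree has a disk functor as right adjoint, and because lifting
against all split maps of `C` means being a split monomorphism with projective cokernel
(`llp_projSplit_iff`).

The simplicial model structure is transported along the Dold–Kan equivalence; the work is to match
the three classes under the normalization `N`. Fibrations: elements of `N_{n+1}` are simplices whose
restriction to the 0-horn is zero, and conversely copowers of horn inclusions normalize to trivial
cofibrations, since horns and simplices contract to a vertex. Cofibrations: `Γ(S^n(P) ⟶ D^{n+1}(P))`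
is a pushout of the copower of a boundary inclusion (`exists_isPushout_gamma_sphereToDisk`). Weak
equivalences: the mapping spaces are Kan complexes, so a weak equivalence has a homotopy inverse `ψ`
on them. It need not be additive, but `z ↦ ψ(z) - ψ(0)` still provides an inverse on homology
(`exists_of_homotopyEquiv`). The converse reduces to trivial fibrations by Ken Brown's argument
(`simplicialW_gamma`). -/

lemma down_next (n : ℕ) : (ComplexShape.down ℕ).next n = n - 1 := by
  cases n with
  | zero => simp
  | succ n => simp

lemma down_prev (n : ℕ) : (ComplexShape.down ℕ).prev n = n + 1 := by simp

variable (K L : ChainComplex AddCommGrpCat.{v} ℕ)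

lemma exists_cycle (n : ℕ) (x : K.X n) (hx : (K.d n (n - 1)) x = 0) :
    ∃ z : K.cycles n, K.iCycles n z = x := by
  have h := ShortComplex.exact_of_f_is_kernel
    (ShortComplex.mk (K.iCycles n) (K.d n (n - 1)) (by simp))
    (K.cyclesIsKernel n (n - 1) (down_next n))
  exact (ShortComplex.ab_exact_iff _).1 h x hx

lemma iCycles_injective (n : ℕ) : Function.Injective (K.iCycles n) :=
  (AddCommGrpCat.mono_iff_injective _).1 inferInstance

lemma d_iCycles_apply (n : ℕ) (z : K.cycles n) : (K.d n (n - 1)) (K.iCycles n z) = 0 := by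
  rw [← ConcreteCategory.comp_apply, K.iCycles_d]
  rfl

lemma homologyπ_eq_zero_iff (n : ℕ) (z : K.cycles n) :
    K.homologyπ n z = 0 ↔ ∃ w : K.X (n + 1), (K.d (n + 1) n) w = K.iCycles n z := by
  have h := ShortComplex.exact_of_g_is_cokernel
    (ShortComplex.mk (K.toCycles (n + 1) n) (K.homologyπ n) (by simp))
    (K.homologyIsCokernel (n + 1) n (down_prev n))
  constructor
  · intro hz
    obtain ⟨w, hw⟩ := (ShortComplex.ab_exact_iff _).1 h z hz
    refine ⟨w, ?_⟩
    dsimp at hw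
    rw [← hw, ← ConcreteCategory.comp_apply, K.toCycles_i]
  · rintro ⟨w, hw⟩
    obtain rfl : K.toCycles (n + 1) n w = z := by
      apply iCycles_injective
      rw [← hw, ← ConcreteCategory.comp_apply, K.toCycles_i]
    rw [← ConcreteCategory.comp_apply, K.toCycles_comp_homologyπ]
    rfl

lemma homologyπ_surjective (n : ℕ) : Function.Surjective (K.homologyπ n) :=
  (AddCommGrpCat.epi_iff_surjective _).1 inferInstance

variable {K L}

/-- Only elements and differentials appear here, no homology objects, so the criterion can be
carried along additive bijections, as in `chainW_iff`. Since `0 - 1 = 0` and `d 0 0 = 0`, the cycle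
condition is empty in degree 0, as it should be. -/
lemma quasiIso_iff_elements (φ : K ⟶ L) : QuasiIso φ ↔ ∀ n : ℕ,
    (∀ y : L.X n, (L.d n (n - 1)) y = 0 → ∃ x : K.X n, (K.d n (n - 1)) x = 0 ∧
      ∃ w : L.X (n + 1), (L.d (n + 1) n) w = y - φ.f n x) ∧
    (∀ x : K.X n, (K.d n (n - 1)) x = 0 → ∀ w : L.X (n + 1), (L.d (n + 1) n) w = φ.f n x →
      ∃ v : K.X (n + 1), (K.d (n + 1) n) v = x) := by
  rw [quasiIso_iff]
  refine forall_congr' fun n ↦ ?_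
  rw [quasiIsoAt_iff_isIso_homologyMap, ConcreteCategory.isIso_iff_bijective, Function.Bijective,
    and_comm]
  have hπ (z : K.cycles n) : HomologicalComplex.homologyMap φ n (K.homologyπ n z) =
      L.homologyπ n (HomologicalComplex.cyclesMap φ n z) := by
    rw [← ConcreteCategory.comp_apply, HomologicalComplex.homologyπ_naturality]
    rfl
  have hi (z : K.cycles n) : L.iCycles n (HomologicalComplex.cyclesMap φ n z) =
      φ.f n (K.iCycles n z) := by
    rw [← ConcreteCategory.comp_apply, HomologicalComplex.cyclesMap_i]
    rfl
  refine and_congr ⟨fun h y hy ↦ ?_, fun h y ↦ ?_⟩ ⟨fun h x hx w hw ↦ ?_, fun h ↦ ?_⟩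
  · obtain ⟨z, rfl⟩ := exists_cycle L n y hy
    obtain ⟨x, hx⟩ := h (L.homologyπ n z)
    obtain ⟨x, rfl⟩ := homologyπ_surjective K n x
    refine ⟨K.iCycles n x, d_iCycles_apply _ _ _, ?_⟩
    rw [hπ] at hx
    obtain ⟨w, hw⟩ := (homologyπ_eq_zero_iff L n (z - HomologicalComplex.cyclesMap φ n x)).1 (by
      rw [map_sub, hx, sub_self])
    exact ⟨w, by rw [hw, map_sub, hi]⟩
  · obtain ⟨z, rfl⟩ := homologyπ_surjective L n y
    obtain ⟨x, hx, w, hw⟩ := h _ (d_iCycles_apply _ _ z)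
    obtain ⟨x, rfl⟩ := exists_cycle K n x hx
    refine ⟨K.homologyπ n x, ?_⟩
    rw [hπ, eq_comm, ← sub_eq_zero, ← map_sub]
    exact (homologyπ_eq_zero_iff _ _ _).2 ⟨w, by rw [hw, map_sub, hi]⟩
  · obtain ⟨z, rfl⟩ := exists_cycle K n x hx
    refine (homologyπ_eq_zero_iff _ _ _).1 (h ?_)
    rw [hπ, map_zero]
    exact (homologyπ_eq_zero_iff _ _ _).2 ⟨w, by rw [hw, hi]⟩
  · refine (injective_iff_map_eq_zero (HomologicalComplex.homologyMap φ n).hom).2 fun x hx ↦ ?_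
    obtain ⟨z, rfl⟩ := homologyπ_surjective K n x
    change HomologicalComplex.homologyMap φ n (K.homologyπ n z) = 0 at hx
    rw [hπ] at hx
    obtain ⟨w, hw⟩ := (homologyπ_eq_zero_iff _ _ _).1 hx
    exact (homologyπ_eq_zero_iff _ _ _).2
      (h _ (d_iCycles_apply _ _ z) w (by rw [hw, hi]))

end AbComplex

/-! ### Maps out of spheres and disks -/

section SphereDisk

variable {C : Type u} [Category.{v} C] [Preadditive C] [HasZeroObject C]

/-- Maps out of a disk are elements in the top degree. -/
def diskEquiv (n : ℕ) (P : C) (X : ChainComplex C ℕ) : (disk n P ⟶ X) ≃ (P ⟶ X.X (n + 1)) :=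
  (HomologicalComplex.evalCompCoyonedaCorepresentableByDoubleId
    (ComplexShape.down_mk (n + 1) n rfl) (Nat.succ_ne_self n) P).homEquiv

lemma diskEquiv_comp (n : ℕ) (P : C) {X Y : ChainComplex C ℕ} (g : disk n P ⟶ X) (f : X ⟶ Y) :
    diskEquiv n P Y (g ≫ f) = diskEquiv n P X g ≫ f.f (n + 1) :=
  (HomologicalComplex.evalCompCoyonedaCorepresentableByDoubleId
    (ComplexShape.down_mk (n + 1) n rfl) (Nat.succ_ne_self n) P).homEquiv_comp f g

/-- Maps out of a sphere are cycles. -/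
def sphereEquiv (n : ℕ) (P : C) (X : ChainComplex C ℕ) :
    (sphere n P ⟶ X) ≃ {a : P ⟶ X.X n // a ≫ X.d n (n - 1) = 0} where
  toFun g := ⟨(HomologicalComplex.singleObjXSelf (ComplexShape.down ℕ) n P).inv ≫ g.f n, by simp⟩
  invFun a := HomologicalComplex.mkHomFromSingle a.1 (fun k hk ↦ by
    obtain rfl : k + 1 = n := hk
    exact a.2)
  left_inv g := by
    apply HomologicalComplex.from_single_hom_ext
    simp
  right_inv a := by
    ext
    simp

lemma sphereEquiv_comp (n : ℕ) (P : C) {X Y : ChainComplex C ℕ} (g : sphere n P ⟶ X)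
    (f : X ⟶ Y) : (sphereEquiv n P Y (g ≫ f)).1 = (sphereEquiv n P X g).1 ≫ f.f n := by
  simp [sphereEquiv]

lemma diskEquiv_apply (n : ℕ) (P : C) (X : ChainComplex C ℕ) (g : disk n P ⟶ X) :
    diskEquiv n P X g = (HomologicalComplex.doubleXIso₀ (𝟙 P)
      (ComplexShape.down_mk (n + 1) n rfl)).inv ≫ g.f (n + 1) := rfl

lemma disk_d (n : ℕ) (P : C) : (disk n P).d (n + 1) n =
    (HomologicalComplex.doubleXIso₀ (𝟙 P) (ComplexShape.down_mk (n + 1) n rfl)).hom ≫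
      (HomologicalComplex.doubleXIso₁ (𝟙 P) (ComplexShape.down_mk (n + 1) n rfl)
        (Nat.succ_ne_self n)).inv := by
  rw [HomologicalComplex.double_d _ _ (Nat.succ_ne_self n), id_comp]

/-- Restriction from a disk to its bounding sphere becomes the differential. This turns lifting
squares against `I` into equations between elements. -/
lemma sphereEquiv_sphereToDisk (n : ℕ) (P : C) {X : ChainComplex C ℕ} (g : disk n P ⟶ X) :
    (sphereEquiv n P X (sphereToDisk n P ≫ g)).1 = diskEquiv n P X g ≫ X.d (n + 1) n := by
  rw [diskEquiv_apply, assoc, HomologicalComplex.Hom.comm, disk_d]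
  simp [sphereEquiv, sphereToDisk]

end SphereDisk

/-! ### Elementwise description of fibrations, trivial fibrations and weak equivalences -/

section Elementwise

variable {C : Type u} [Category.{v} C] [Preadditive C] [HasZeroObject C] (Proj : ObjectProperty C)

lemma hasLiftingProperty_of_isZero {D : Type*} [Category D] [HasZeroMorphisms D] {Z Q X Y : D}
    (hZ : IsZero Z) (i : Z ⟶ Q) (p : X ⟶ Y) :
    HasLiftingProperty i p ↔ Function.Surjective (fun g : Q ⟶ X ↦ g ≫ p) := by
  constructor
  · intro h b
    have sq : CommSq (0 : Z ⟶ X) i p b := ⟨hZ.eq_of_src _ _⟩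
    exact ⟨sq.lift, sq.fac_right⟩
  · intro h
    refine ⟨fun {a b} sq ↦ ?_⟩
    obtain ⟨l, hl⟩ := h b
    exact ⟨⟨l, hZ.eq_of_src _ _, hl⟩⟩

variable {A B : ChainComplex C ℕ} (f : A ⟶ B)

lemma chainFib_iff : chainFib Proj f ↔ ∀ n : ℕ, projSplit Proj (f.f (n + 1)) := by
  constructor
  · intro h n P hP b
    have := (hasLiftingProperty_of_isZero (isZero_zero _) _ _).1 (h _ (chainJ.mk n P hP))
    obtain ⟨g, hg⟩ := this ((diskEquiv n P B).symm b)
    refine ⟨diskEquiv n P A g, ?_⟩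
    dsimp at hg ⊢
    rw [← diskEquiv_comp, hg, Equiv.apply_symm_apply]
  · rintro h _ _ _ ⟨n, P, hP⟩
    refine (hasLiftingProperty_of_isZero (isZero_zero _) _ _).2 fun b ↦ ?_
    obtain ⟨g, hg⟩ := h n P hP (diskEquiv n P B b)
    refine ⟨(diskEquiv n P A).symm g, (diskEquiv n P B).injective ?_⟩
    dsimp at hg ⊢
    rw [diskEquiv_comp, Equiv.apply_symm_apply, hg]

/-- A square from `S^n(P) ⟶ D^{n+1}(P)` to `f` is a cycle `a` of `A` with an element `b` of `B`
bounding its image; a lift is an element over `b` bounding `a`. The maps `0 ⟶ S^0(P)` account for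
the condition in degree 0. -/
lemma rlp_chainI_iff : MorphismProperty.rlp (chainI Proj) f ↔ projSplit Proj (f.f 0) ∧
    ∀ (n : ℕ) (P : C), Proj P → ∀ (a : P ⟶ A.X n) (b : P ⟶ B.X (n + 1)),
      a ≫ A.d n (n - 1) = 0 → a ≫ f.f n = b ≫ B.d (n + 1) n →
      ∃ c : P ⟶ A.X (n + 1), c ≫ A.d (n + 1) n = a ∧ c ≫ f.f (n + 1) = b := by
  constructor
  · intro h
    refine ⟨fun P hP b ↦ ?_, fun n P hP a b ha hab ↦ ?_⟩
    · have := (hasLiftingProperty_of_isZero (isZero_zero _) _ _).1 (h _ (chainI.zero P hP))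
      obtain ⟨g, hg⟩ := this ((sphereEquiv 0 P B).symm ⟨b, by simp⟩)
      refine ⟨(sphereEquiv 0 P A g).1, ?_⟩
      dsimp at hg ⊢
      rw [← sphereEquiv_comp, hg, Equiv.apply_symm_apply]
    · have := h _ (chainI.succ n P hP)
      have sq : CommSq ((sphereEquiv n P A).symm ⟨a, ha⟩) (sphereToDisk n P) f
          ((diskEquiv n P B).symm b) := ⟨by
        apply (sphereEquiv n P B).injective
        ext
        rw [sphereEquiv_comp, sphereEquiv_sphereToDisk, Equiv.apply_symm_apply,
          Equiv.apply_symm_apply, hab]⟩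
      refine ⟨diskEquiv n P A sq.lift, ?_, ?_⟩
      · rw [← sphereEquiv_sphereToDisk, sq.fac_left, Equiv.apply_symm_apply]
      · rw [← diskEquiv_comp, sq.fac_right, Equiv.apply_symm_apply]
  · rintro ⟨h₀, h⟩ _ _ _ (⟨P, hP⟩ | ⟨n, P, hP⟩)
    · refine (hasLiftingProperty_of_isZero (isZero_zero _) _ _).2 fun b ↦ ?_
      obtain ⟨g, hg⟩ := h₀ P hP (sphereEquiv 0 P B b).1
      refine ⟨(sphereEquiv 0 P A).symm ⟨g, by simp⟩, (sphereEquiv 0 P B).injective ?_⟩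
      ext
      dsimp at hg ⊢
      rw [sphereEquiv_comp, Equiv.apply_symm_apply, hg]
    · refine ⟨fun {a b} sq ↦ ?_⟩
      obtain ⟨c, hc, hc'⟩ := h n P hP (sphereEquiv n P A a).1 (diskEquiv n P B b)
        (sphereEquiv n P A a).2 (by
          rw [← sphereEquiv_comp, sq.w, sphereEquiv_sphereToDisk])
      refine ⟨⟨(diskEquiv n P A).symm c, ?_, ?_⟩⟩
      · apply (sphereEquiv n P A).injective
        ext
        rw [sphereEquiv_sphereToDisk, Equiv.apply_symm_apply, hc]
      · apply (diskEquiv n P B).injective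
        rw [diskEquiv_comp, Equiv.apply_symm_apply, hc']

section

variable (P : C)

/-- Families of maps out of `S^0(P)` of degree `n` are maps out of `P`. -/
def sphereHomTotEquiv (A : ChainComplex C ℕ) (n : ℕ) : HomTot (sphere 0 P) A n ≃+ (P ⟶ A.X n) where
  toFun g := (HomologicalComplex.singleObjXSelf (ComplexShape.down ℕ) 0 P).inv ≫
    g.app 0 n (by omega)
  invFun a := HomTot.mk fun p q h ↦ if hp : p = 0 then
      (HomologicalComplex.singleObjXIsoOfEq (ComplexShape.down ℕ) 0 P p hp).hom ≫ a ≫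
        eqToHom (by rw [← h, hp, zero_add])
    else 0
  left_inv g := by
    refine HomTot.ext fun p q h ↦ ?_
    by_cases hp : p = 0
    · subst hp
      obtain rfl : q = n := by omega
      rw [HomTot.mk_app, dif_pos rfl, eqToHom_refl, comp_id]
      exact (HomologicalComplex.singleObjXSelf (ComplexShape.down ℕ) 0 P).hom_inv_id_assoc _
    · exact (HomologicalComplex.isZero_single_obj_X (ComplexShape.down ℕ) 0 P p hp).eq_of_src
        _ _
  right_inv a := by
    dsimp only
    rw [HomTot.mk_app, dif_pos rfl, eqToHom_refl, comp_id]
    exact (HomologicalComplex.singleObjXSelf (ComplexShape.down ℕ) 0 P).inv_hom_id_assoc _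
  map_add' g g' := Preadditive.comp_add _ _ _ _ _ _

lemma sphereHomTotEquiv_apply {A : ChainComplex C ℕ} {n : ℕ} (g : HomTot (sphere 0 P) A n) :
    sphereHomTotEquiv P A n g =
      (HomologicalComplex.singleObjXSelf (ComplexShape.down ℕ) 0 P).inv ≫ g.app 0 n (by omega) :=
  rfl

/-- The source is concentrated in degree 0 and `A_{-1} = 0`, so the term `dPre` vanishes and no sign
remains. -/
lemma sphereHomTotEquiv_δ {A : ChainComplex C ℕ} (n : ℕ) (g : HomTot (sphere 0 P) A (n + 1)) :
    sphereHomTotEquiv P A n (HomTot.δ n g) =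
      sphereHomTotEquiv P A (n + 1) g ≫ A.d (n + 1) n := by
  rw [sphereHomTotEquiv_apply, sphereHomTotEquiv_apply, HomTot.δ_app, HomTot.dPre, smul_zero,
    add_zero, HomTot.dPost, assoc]

lemma sphereHomTotEquiv_postcomp (n : ℕ) (g : HomTot (sphere 0 P) A n) :
    sphereHomTotEquiv P B n (HomTot.postcomp f n g) = sphereHomTotEquiv P A n g ≫ f.f n := by
  rw [sphereHomTotEquiv_apply, sphereHomTotEquiv_apply, HomTot.postcomp_app, assoc]

/-- Elements of the complex of maps from `S^0(P)` to `A` are the maps from `P` to the objects of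
`A`. -/
def homComplexEquiv (A : ChainComplex C ℕ) : ∀ n, (homComplex (sphere 0 P) A).X n ≃+ (P ⟶ A.X n)
  | 0 =>
    -- Degree 0 of the hom complex consists of chain maps only, but every element of degree 0 is a
    -- cycle, so the truncation loses nothing here.
    { toFun (g : sphere 0 P ⟶ A) := (sphereEquiv 0 P A g).1
      invFun a := (sphereEquiv 0 P A).symm ⟨a, by simp⟩
      left_inv g := (sphereEquiv 0 P A).symm_apply_apply g
      right_inv a := by
        simp
      map_add' g g' := by
        change _ ≫ HomologicalComplex.Hom.f (g + g' : sphere 0 P ⟶ A) 0 = _ ≫ _ + _ ≫ _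
        rw [← Preadditive.comp_add]
        rfl }
  | n + 1 => sphereHomTotEquiv P A (n + 1)

lemma homComplexEquiv_d (n : ℕ) (g : (homComplex (sphere 0 P) A).X (n + 1)) :
    homComplexEquiv P A n ((homComplex (sphere 0 P) A).d (n + 1) n g) =
      homComplexEquiv P A (n + 1) g ≫ A.d (n + 1) n := by
  have h : (homComplex (sphere 0 P) A).d (n + 1) n = homComplexD (sphere 0 P) A n :=
    ChainComplex.of_d _ _ _
  rw [h]
  cases n with
  | zero => exact sphereHomTotEquiv_δ P 0 g
  | succ n => exact sphereHomTotEquiv_δ P (n + 1) g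

lemma homComplexEquiv_map (n : ℕ) (g : (homComplex (sphere 0 P) A).X n) :
    homComplexEquiv P B n ((homComplexMap (sphere 0 P) f).f n g) =
      homComplexEquiv P A n g ≫ f.f n := by
  cases n with
  | zero => exact sphereEquiv_comp 0 P (show sphere 0 P ⟶ A from g) f
  | succ n => exact sphereHomTotEquiv_postcomp f P (n + 1) g

end

/-- A map of complexes is a weak equivalence iff it induces isomorphisms on the homology of the
complexes of maps from `P`, for all `P` in `Proj`. -/
lemma chainW_iff : chainW Proj f ↔ ∀ P : C, Proj P → ∀ n : ℕ,
    (∀ y : P ⟶ B.X n, y ≫ B.d n (n - 1) = 0 → ∃ x : P ⟶ A.X n, x ≫ A.d n (n - 1) = 0 ∧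
      ∃ w : P ⟶ B.X (n + 1), w ≫ B.d (n + 1) n = y - x ≫ f.f n) ∧
    (∀ x : P ⟶ A.X n, x ≫ A.d n (n - 1) = 0 → ∀ w : P ⟶ B.X (n + 1),
      w ≫ B.d (n + 1) n = x ≫ f.f n → ∃ v : P ⟶ A.X (n + 1), v ≫ A.d (n + 1) n = x) := by
  have hd (A : ChainComplex C ℕ) (P : C) (n : ℕ) (g : (homComplex (sphere 0 P) A).X n) :
      (homComplex (sphere 0 P) A).d n (n - 1) g = 0 ↔
        homComplexEquiv P A n g ≫ A.d n (n - 1) = 0 := by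
    cases n with
    | zero => simp
    | succ n =>
      change (homComplex (sphere 0 P) A).d (n + 1) n g = 0 ↔ _ ≫ A.d (n + 1) n = 0
      rw [← (homComplexEquiv P A n).map_eq_zero_iff, homComplexEquiv_d]
  refine forall_congr' fun P ↦ forall_congr' fun hP ↦ ?_
  rw [quasiIso_iff_elements]
  refine forall_congr' fun n ↦ ?_
  simp only [hd, ← (homComplexEquiv P _ _).injective.eq_iff, homComplexEquiv_d,
    map_sub, homComplexEquiv_map, (homComplexEquiv P _ _).surjective.forall,
    (homComplexEquiv P _ _).surjective.exists]

end Elementwise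

/-! ### Trivial fibrations -/

section TrivialFibrations

variable {C : Type u} [Category.{v} C] [Preadditive C] [HasZeroObject C] {Proj : ObjectProperty C}

variable {A B : ChainComplex C ℕ} {f : A ⟶ B}

/-- To lift `b`, its boundary is lifted first: it is a cycle, so in positive degree it lifts against
the zero cycle, and in degree 0 by surjectivity of `f.f 0`. The relative lifting property then
applies to `b` and this lift of its boundary. -/
lemma chainFib_of_rlp_chainI (h : MorphismProperty.rlp (chainI Proj) f) : chainFib Proj f := by
  obtain ⟨h₀, h⟩ := (rlp_chainI_iff Proj f).1 h
  refine (chainFib_iff Proj f).2 fun n P hP b ↦ ?_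
  have hb : (b ≫ B.d (n + 1) n) ≫ B.d n (n - 1) = 0 := by simp
  obtain ⟨a, ha, ha'⟩ : ∃ a : P ⟶ A.X n, a ≫ A.d n (n - 1) = 0 ∧
      a ≫ f.f n = b ≫ B.d (n + 1) n := by
    cases n with
    | zero =>
      obtain ⟨a, ha⟩ := h₀ P hP (b ≫ B.d 1 0)
      exact ⟨a, by simp, ha⟩
    | succ n => exact h n P hP 0 _ (by simp) (by simpa using hb.symm)
  obtain ⟨c, -, hc⟩ := h n P hP a b ha ha'
  exact ⟨c, hc⟩

lemma chainW_of_rlp_chainI (h : MorphismProperty.rlp (chainI Proj) f) : chainW Proj f := by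
  obtain ⟨h₀, h⟩ := (rlp_chainI_iff Proj f).1 h
  refine (chainW_iff Proj f).2 fun P hP n ↦ ⟨fun y hy ↦ ?_, fun x hx w hw ↦ ?_⟩
  · cases n with
    | zero =>
      obtain ⟨a, ha⟩ := h₀ P hP y
      exact ⟨a, by simp, 0, by simp [← ha]⟩
    | succ n =>
      obtain ⟨c, hc, hc'⟩ := h n P hP 0 y (by simp) (by simpa using hy.symm)
      exact ⟨c, by simpa using hc, 0, by simp [hc']⟩
  · obtain ⟨c, hc, -⟩ := h n P hP x w hx hw.symm
    exact ⟨c, hc⟩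

/-- The weak equivalence provides solutions up to a boundary `d w`. The fibration condition lifts
`w` to some `y`, and adding `d y` makes the solution exact. -/
lemma rlp_chainI_of_chainFib_of_chainW (hf : chainFib Proj f) (hw : chainW Proj f) :
    MorphismProperty.rlp (chainI Proj) f := by
  rw [chainFib_iff] at hf
  rw [chainW_iff] at hw
  refine (rlp_chainI_iff Proj f).2 ⟨fun P hP b ↦ ?_, fun n P hP a b ha hab ↦ ?_⟩
  · obtain ⟨x, -, w, hx⟩ := (hw P hP 0).1 b (by simp)
    obtain ⟨y, rfl⟩ := hf 0 P hP w
    exact ⟨x + y ≫ A.d 1 0, by simp at hx; simp [hx]⟩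
  · obtain ⟨v, hv⟩ := (hw P hP n).2 a ha b hab.symm
    -- Injectivity on homology gave `v` bounding `a`, but `v` need not lie over `b`; the discrepancy
    -- is a cycle, to be corrected by a cycle `x` and a boundary.
    obtain ⟨x, hx, w, hw'⟩ := (hw P hP (n + 1)).1 (b - v ≫ f.f (n + 1)) (by
      simp [← hab, ← hv])
    obtain ⟨y, rfl⟩ := hf (n + 1) P hP w
    replace hx : x ≫ A.d (n + 1) n = 0 := hx
    refine ⟨v + x + y ≫ A.d (n + 2) (n + 1), by simp [hv, hx], ?_⟩
    simp at hw'
    simp [hw']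

lemma rlp_chainI_eq : MorphismProperty.rlp (chainI Proj) = chainFib Proj ⊓ chainW Proj := by
  ext A B f
  exact ⟨fun h ↦ ⟨chainFib_of_rlp_chainI h, chainW_of_rlp_chainI h⟩,
    fun h ↦ rlp_chainI_of_chainFib_of_chainW h.1 h.2⟩

end TrivialFibrations

/-! ### Projective split monomorphisms -/

section ProjSplitMono

variable {C : Type u} [Category.{v} C] [Preadditive C] [HasBinaryBiproducts C]
  [HasCokernels C] {Proj : ObjectProperty C} [Proj.IsStableUnderRetracts]

/-- Since `X ⊞ F(Y) ⟶ Y` is split, lifting against it exhibits `f` as a retract of `X ⟶ X ⊞ F(Y)`,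
whose cokernel is projective. Conversely `Y` is the sum of `X` and the cokernel, and a lift can be
chosen on each summand. -/
lemma llp_projSplit_iff (hproj : HasEnoughFunctorialProjectives Proj) {X Y : C} (f : X ⟶ Y) :
    (projSplit Proj).llp f ↔ IsSplitMono f ∧ Proj (cokernel f) := by
  constructor
  · intro hf
    obtain ⟨F, u, hu⟩ := hproj
    have hsplit : projSplit Proj (biprod.desc f (u.app Y)) := fun P hP b ↦ by
      obtain ⟨g, hg⟩ := (hu Y).2 P hP b
      exact ⟨g ≫ biprod.inr, by simpa using hg⟩
    have := hf _ hsplit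
    have sq : CommSq (biprod.inl : X ⟶ X ⊞ F.obj Y) f (biprod.desc f (u.app Y)) (𝟙 Y) := ⟨by simp⟩
    have h₁ : f ≫ sq.lift = biprod.inl := sq.fac_left
    have h₂ : sq.lift ≫ biprod.desc f (u.app Y) = 𝟙 Y := sq.fac_right
    refine ⟨⟨⟨sq.lift ≫ biprod.fst, by rw [reassoc_of% h₁, biprod.inl_fst]⟩⟩, ?_⟩
    let r : Retract (cokernel f) (F.obj Y) :=
      { i := cokernel.desc f (sq.lift ≫ biprod.snd) (by rw [reassoc_of% h₁, biprod.inl_snd])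
        r := u.app Y ≫ cokernel.π f
        retract := by
          rw [← cancel_epi (cokernel.π f)]
          have h : biprod.snd ≫ u.app Y ≫ cokernel.π f =
              biprod.desc f (u.app Y) ≫ cokernel.π f := by
            ext <;> simp
          simp only [cokernel.π_desc_assoc, assoc, h, comp_id]
          rw [reassoc_of% h₂] }
    exact Proj.prop_of_retract r (hu Y).1
  · rintro ⟨⟨⟨r⟩⟩, hQ⟩ A B p hp
    refine ⟨fun {a b} sq ↦ ?_⟩
    let s : cokernel f ⟶ Y := cokernel.desc f (𝟙 Y - r.retraction ≫ f) (by simp)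
    have hs : cokernel.π f ≫ s = 𝟙 Y - r.retraction ≫ f := by simp [s]
    obtain ⟨l, hl⟩ := hp _ hQ (s ≫ b)
    refine ⟨⟨r.retraction ≫ a + cokernel.π f ≫ l, by simp, ?_⟩⟩
    dsimp at hl
    simp [hl, sq.w, reassoc_of% hs]

end ProjSplitMono

/-! ### Cofibrations -/

section Cofibrations

variable {C : Type u} [Category.{v} C] [Preadditive C] [HasZeroObject C]

/-- Maps to a disk are maps to the object in the lower degree. -/
def toDiskEquiv (n : ℕ) (P : C) (X : ChainComplex C ℕ) : (X ⟶ disk n P) ≃ (X.X n ⟶ P) where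
  toFun g := g.f n ≫ (HomologicalComplex.doubleXIso₁ (𝟙 P) (ComplexShape.down_mk (n + 1) n rfl)
    (Nat.succ_ne_self n)).hom
  invFun a := 
    { f i := if h₀ : i = n + 1 then (X.XIsoOfEq h₀).hom ≫ X.d (n + 1) n ≫ a ≫ 
          (HomologicalComplex.doubleXIso₀ (𝟙 P) (ComplexShape.down_mk (n + 1) n rfl)).inv ≫
          ((disk n P).XIsoOfEq h₀).inv
        else if h₁ : i = n then (X.XIsoOfEq h₁).hom ≫ a ≫ 
          (HomologicalComplex.doubleXIso₁ (𝟙 P) (ComplexShape.down_mk (n + 1) n rfl)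
            (Nat.succ_ne_self n)).inv ≫ ((disk n P).XIsoOfEq h₁).inv
        else 0
      comm' := by
        rintro i j hij
        obtain rfl : j + 1 = i := hij
        by_cases h₁ : j = n
        · subst h₁
          simp [disk_d]
        · by_cases h₀ : j = n + 1
          · subst h₀
            rw [dif_neg (by omega), dif_neg (by omega), zero_comp]
            simp
          · exact (HomologicalComplex.isZero_double_X _ _ _ h₀ h₁).eq_of_tgt _ _ }
  left_inv g := by
    ext
    · have := g.comm (n + 1) n
      rw [disk_d] at this
      simp [← reassoc_of% this]
    · simp
  right_inv a := by simp

lemma toDiskEquiv_comp (n : ℕ) (P : C) {X Y : ChainComplex C ℕ} (h : X ⟶ Y) (g : Y ⟶ disk n P) :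
    toDiskEquiv n P X (h ≫ g) = h.f n ≫ toDiskEquiv n P Y g := by
  simp [toDiskEquiv]

/-- The functoriality of the disk. -/
def diskMap (n : ℕ) {P Q : C} (g : P ⟶ Q) : disk n P ⟶ disk n Q :=
  (toDiskEquiv n Q (disk n P)).symm (toDiskEquiv n P _ (𝟙 _) ≫ g)

lemma toDiskEquiv_comp_diskMap (n : ℕ) {P Q : C} {X : ChainComplex C ℕ} (h : X ⟶ disk n P)
    (g : P ⟶ Q) : toDiskEquiv n Q X (h ≫ diskMap n g) = toDiskEquiv n P X h ≫ g := by
  rw [toDiskEquiv_comp, diskMap, Equiv.apply_symm_apply, ← assoc, ← toDiskEquiv_comp, comp_id]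

/-- By `toDiskEquiv`, the disk functor `D^{n+1}` is right adjoint to evaluation in degree `n`, in
addition to being left adjoint to evaluation in degree `n + 1`. Lifting problems therefore pass
across this adjunction. -/
lemma hasLiftingProperty_diskMap_iff (n : ℕ) {P Q : C} (g : P ⟶ Q) {X Y : ChainComplex C ℕ}
    (i : X ⟶ Y) : HasLiftingProperty i (diskMap n g) ↔ HasLiftingProperty (i.f n) g := by
  constructor
  · intro h
    refine ⟨fun {a b} sq ↦ ?_⟩
    have sq' : CommSq ((toDiskEquiv n P X).symm a) i (diskMap n g)
        ((toDiskEquiv n Q Y).symm b) := ⟨by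
      apply (toDiskEquiv n Q X).injective
      rw [toDiskEquiv_comp_diskMap, toDiskEquiv_comp, Equiv.apply_symm_apply,
        Equiv.apply_symm_apply, sq.w]⟩
    refine ⟨⟨toDiskEquiv n P Y sq'.lift, ?_, ?_⟩⟩
    · rw [← toDiskEquiv_comp, sq'.fac_left, Equiv.apply_symm_apply]
    · rw [← toDiskEquiv_comp_diskMap, sq'.fac_right, Equiv.apply_symm_apply]
  · intro h
    refine ⟨fun {a b} sq ↦ ?_⟩
    have sq' : CommSq (toDiskEquiv n P X a) (i.f n) g (toDiskEquiv n Q Y b) := ⟨by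
      rw [← toDiskEquiv_comp, ← toDiskEquiv_comp_diskMap, sq.w]⟩
    refine ⟨⟨(toDiskEquiv n P Y).symm sq'.lift, ?_, ?_⟩⟩
    · apply (toDiskEquiv n P X).injective
      rw [toDiskEquiv_comp, Equiv.apply_symm_apply, sq'.fac_left]
    · apply (toDiskEquiv n Q Y).injective
      rw [toDiskEquiv_comp_diskMap, Equiv.apply_symm_apply, sq'.fac_right]

instance isIso_sphereToDisk_f (n : ℕ) (P : C) : IsIso ((sphereToDisk n P).f n) := by
  simp only [sphereToDisk, HomologicalComplex.mkHomFromSingle_f]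
  infer_instance

variable (Proj : ObjectProperty C)

lemma llp_projSplit_of_isZero {Z Q P : C} (hZ : IsZero Z) (e : Q ≅ P) (hP : Proj P) (i : Z ⟶ Q) :
    (projSplit Proj).llp i := fun X Y p hp ↦ by
  rw [hasLiftingProperty_of_isZero hZ]
  intro b
  obtain ⟨g, hg⟩ := hp P hP (e.inv ≫ b)
  exact ⟨e.hom ≫ g, by dsimp at hg ⊢; rw [assoc, hg, e.hom_inv_id_assoc]⟩

lemma isIso_of_isZero {Z Q : C} (hZ : IsZero Z) (hQ : IsZero Q) (i : Z ⟶ Q) : IsIso i :=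
  ⟨0, hZ.eq_of_src _ _, hQ.eq_of_src _ _⟩

lemma isIso_sphereToDisk_f_of_ne (n k : ℕ) (P : C) (hk : k ≠ n + 1) :
    IsIso ((sphereToDisk n P).f k) := by
  by_cases h : k = n
  · subst h
    infer_instance
  · exact isIso_of_isZero (HomologicalComplex.isZero_single_obj_X _ _ _ _ h)
      (HomologicalComplex.isZero_double_X _ _ _ hk h) _

/-- In each degree a generating cofibration is either an isomorphism or a map from zero to a
projective. -/
lemma llp_projSplit_of_chainI {X Y : ChainComplex C ℕ} {i : X ⟶ Y} (hi : chainI Proj i) (n : ℕ) :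
    (projSplit Proj).llp (i.f n) := by
  obtain ⟨P, hP⟩ | ⟨k, P, hP⟩ := hi
  · have h₀ : IsZero ((0 : ChainComplex C ℕ).X n) :=
      (HomologicalComplex.eval C _ n).map_isZero (isZero_zero _)
    by_cases h : n = 0
    · subst h
      exact llp_projSplit_of_isZero Proj h₀ (HomologicalComplex.singleObjXSelf _ 0 P) hP _
    · have := isIso_of_isZero h₀ (HomologicalComplex.isZero_single_obj_X (.down ℕ) 0 P n h) 
        ((0 : (0 : ChainComplex C ℕ) ⟶ sphere 0 P).f n)
      exact MorphismProperty.llp_of_isIso _ _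
  · by_cases h : n = k + 1
    · subst h
      exact llp_projSplit_of_isZero Proj (HomologicalComplex.isZero_single_obj_X _ _ _ _ (by simp))
        (HomologicalComplex.doubleXIso₀ _ _) hP _
    · have := isIso_sphereToDisk_f_of_ne k n P h
      exact MorphismProperty.llp_of_isIso _ _

/-- The disk adjunction is used twice: it reduces the claim to `diskMap n g` lifting against `I`,
and this in turn to the degree `n` components of the maps in `I`. -/
lemma llp_projSplit_of_chainCof {X Y : ChainComplex C ℕ} {f : X ⟶ Y} (hf : chainCof Proj f)
    (n : ℕ) : (projSplit Proj).llp (f.f n) := fun A B g hg ↦ by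
  rw [← hasLiftingProperty_diskMap_iff]
  refine hf _ fun _ _ i hi ↦ ?_
  rw [hasLiftingProperty_diskMap_iff]
  exact llp_projSplit_of_chainI Proj hi n _ hg

end Cofibrations

/-! ### Cofibrations are the degreewise split monomorphisms with projective cokernel -/

section CofibrationsIff

variable {C : Type u} [Category.{v} C] [Preadditive C] [HasZeroObject C] [HasBinaryBiproducts C]
  [HasCokernels C] {Proj : ObjectProperty C}

/-- The lift is built by induction on the degree. On the summand `A_n` of `B_n` it is forced; on the
projective complement it comes from the elementwise form of the right lifting property. -/
lemma chainCof_of_degreewise {A B : ChainComplex C ℕ} {f : A ⟶ B}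
    (hf : ∀ n : ℕ, IsSplitMono (f.f n) ∧ Proj (cokernel (f.f n))) : chainCof Proj f := by
  intro X Y p hp
  obtain ⟨hp₀, hp⟩ := (rlp_chainI_iff Proj p).1 hp
  refine ⟨fun {a b} sq ↦ ?_⟩
  have hw (n : ℕ) : a.f n ≫ p.f n = f.f n ≫ b.f n := by
    rw [← HomologicalComplex.comp_f, sq.w, HomologicalComplex.comp_f]
  let r (n : ℕ) : B.X n ⟶ A.X n := (hf n).1.exists_splitMono.some.retraction
  have hr (n : ℕ) : f.f n ≫ r n = 𝟙 _ := (hf n).1.exists_splitMono.some.id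
  let s (n : ℕ) : cokernel (f.f n) ⟶ B.X n :=
    cokernel.desc (f.f n) (𝟙 _ - r n ≫ f.f n) (by simp [reassoc_of% hr])
  have hs (n : ℕ) : cokernel.π (f.f n) ≫ s n = 𝟙 _ - r n ≫ f.f n := by simp [s]
  -- The last condition says that `h` sends boundaries to cycles, which is what allows the partial
  -- lift to be extended by one more degree.
  let S (n : ℕ) : Type _ := {h : B.X n ⟶ X.X n // f.f n ≫ h = a.f n ∧ h ≫ p.f n = b.f n ∧
    B.d (n + 1) n ≫ h ≫ X.d n (n - 1) = 0}
  have h₀ : Nonempty (S 0) := by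
    obtain ⟨l, hl⟩ := hp₀ _ (hf 0).2 (s 0 ≫ b.f 0)
    refine ⟨r 0 ≫ a.f 0 + cokernel.π _ ≫ l, ?_, ?_, by simp⟩
    · simp [reassoc_of% hr]
    · dsimp at hl
      simp [hl, hw, reassoc_of% hs]
  have hstep (n : ℕ) (h : S n) : ∃ h' : S (n + 1),
      h'.1 ≫ X.d (n + 1) n = B.d (n + 1) n ≫ h.1 := by
    obtain ⟨h, hfh, hhp, hd⟩ := h
    -- On the complement, the prescribed boundary is the previous stage of the lift applied to the
    -- differential, and the prescribed image is given by `b`.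
    obtain ⟨l, hl, hl'⟩ := hp n _ (hf (n + 1)).2 (s (n + 1) ≫ B.d (n + 1) n ≫ h)
      (s (n + 1) ≫ b.f (n + 1)) (by simp [hd]) (by simp [hhp])
    have hh : (r (n + 1) ≫ a.f (n + 1) + cokernel.π _ ≫ l) ≫ X.d (n + 1) n =
        B.d (n + 1) n ≫ h := by
      simp [hl, reassoc_of% hs, ← hfh]
    refine ⟨⟨r (n + 1) ≫ a.f (n + 1) + cokernel.π _ ≫ l, ?_, ?_, ?_⟩, hh⟩
    · simp [reassoc_of% hr]
    · simp [hl', hw, reassoc_of% hs]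
    · change _ ≫ _ ≫ X.d (n + 1) n = 0
      rw [hh]
      simp
  choose step hstep using hstep
  let h (n : ℕ) : S n := Nat.rec h₀.some step n
  refine ⟨⟨{ f n := (h n).1, comm' := ?_ }, ?_, ?_⟩⟩
  · rintro i j hij
    obtain rfl : j + 1 = i := hij
    exact hstep j (h j)
  · ext n
    exact (h n).2.1
  · ext n
    exact (h n).2.2.1

variable [Proj.IsStableUnderRetracts]

lemma chainCof_iff (hproj : HasEnoughFunctorialProjectives Proj) {A B : ChainComplex C ℕ}
    (f : A ⟶ B) :
    chainCof Proj f ↔ ∀ n : ℕ, IsSplitMono (f.f n) ∧ Proj (cokernel (f.f n)) :=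
  ⟨fun hf n ↦ (llp_projSplit_iff hproj _).1 (llp_projSplit_of_chainCof Proj hf n),
    chainCof_of_degreewise⟩

lemma chainCof_iff_llp (hproj : HasEnoughFunctorialProjectives Proj) {A B : ChainComplex C ℕ}
    (f : A ⟶ B) : chainCof Proj f ↔ ∀ n : ℕ, (projSplit Proj).llp (f.f n) := by
  simp only [chainCof_iff hproj, llp_projSplit_iff hproj]

lemma chainCof_initial_iff (hproj : HasEnoughFunctorialProjectives Proj)
    [HasInitial (ChainComplex C ℕ)] (A : ChainComplex C ℕ) :
    chainCof Proj (initial.to A) ↔ ∀ n : ℕ, Proj (A.X n) := by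
  rw [chainCof_iff hproj]
  refine forall_congr' fun n ↦ ?_
  have h₀ : IsZero ((⊥_ ChainComplex C ℕ).X n) :=
    (HomologicalComplex.eval C _ n).map_isZero
      ((isZero_zero (ChainComplex C ℕ)).of_iso (initialIsInitial.uniqueUpToIso
        (isZero_zero _).isInitial))
  have e : cokernel ((initial.to A).f n) ≅ A.X n :=
    cokernelIsoOfEq (h₀.eq_of_src _ (0 : _ ⟶ A.X n)) ≪≫ cokernelZeroIsoTarget
  have : IsSplitMono ((initial.to A).f n) := ⟨⟨⟨0, h₀.eq_of_src _ _⟩⟩⟩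
  rw [and_iff_right this]
  exact Proj.prop_iff_of_iso e

end CofibrationsIff

/-! ### Weak equivalences and mapping cones -/

section Cone

variable {C : Type u} [Category.{v} C] [Preadditive C] {Proj : ObjectProperty C}

lemma down_rel (n : ℕ) : (ComplexShape.down ℕ).Rel (n + 1) n := rfl

lemma isSplitExact_iff [HasKernels C] (A : ChainComplex C ℕ) : IsSplitExact Proj A ↔
    ∀ P : C, Proj P → ∀ (n : ℕ) (y : P ⟶ A.X n), y ≫ A.d n (n - 1) = 0 →
      ∃ x : P ⟶ A.X (n + 1), x ≫ A.d (n + 1) n = y := by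
  constructor
  · intro h P hP n y hy
    obtain ⟨x, hx⟩ := h n P hP (kernel.lift _ y hy)
    refine ⟨x, ?_⟩
    simpa using hx =≫ kernel.ι _
  · intro h n P hP y
    obtain ⟨x, hx⟩ := h P hP n (y ≫ kernel.ι _) (by simp)
    refine ⟨x, ?_⟩
    dsimp
    ext
    simpa using hx

variable [HasBinaryBiproducts C] {A B : ChainComplex C ℕ} (f : A ⟶ B)

open HomologicalComplex homotopyCofiber

lemma cone_d_fst (n : ℕ) {P : C} (x : P ⟶ (homotopyCofiber f).X (n + 2)) :
    (x ≫ (homotopyCofiber f).d (n + 2) (n + 1)) ≫ fstX f (n + 1) n (down_rel n) =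
      -(x ≫ fstX f (n + 2) (n + 1) (down_rel (n + 1))) ≫ A.d (n + 1) n := by
  have := d_fstX f (n + 2) (n + 1) n (down_rel _) (down_rel _)
  simp only [homotopyCofiber_d, homotopyCofiber_X] at x ⊢
  simp [this]

lemma cone_d_snd (n : ℕ) {P : C} (x : P ⟶ (homotopyCofiber f).X (n + 1)) :
    (x ≫ (homotopyCofiber f).d (n + 1) n) ≫ sndX f n =
      (x ≫ fstX f (n + 1) n (down_rel n)) ≫ f.f n + (x ≫ sndX f (n + 1)) ≫ B.d (n + 1) n := by
  have := d_sndX f (n + 1) n (down_rel n)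
  simp only [homotopyCofiber_d, homotopyCofiber_X] at x ⊢
  simp [this]

lemma cone_cycle_iff (n : ℕ) {P : C} (x : P ⟶ (homotopyCofiber f).X (n + 1)) :
    x ≫ (homotopyCofiber f).d (n + 1) n = 0 ↔
      (x ≫ fstX f (n + 1) n (down_rel n)) ≫ A.d n (n - 1) = 0 ∧
      (x ≫ fstX f (n + 1) n (down_rel n)) ≫ f.f n + (x ≫ sndX f (n + 1)) ≫ B.d (n + 1) n = 0 := by
  rw [← cone_d_snd]
  cases n with
  | zero =>
    have : (x ≫ fstX f (0 + 1) 0 (down_rel 0)) ≫ A.d 0 (0 - 1) = 0 := by simp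
    rw [and_iff_right this]
    refine ⟨fun h ↦ by rw [h, zero_comp], fun h ↦ ?_⟩
    exact ext_to_X' f 0 (by simp) (by simpa using h)
  | succ n =>
    change _ ↔ (x ≫ fstX f (n + 2) (n + 1) (down_rel (n + 1))) ≫ A.d (n + 1) n = 0 ∧ _
    rw [← neg_eq_zero (a := (x ≫ fstX f (n + 2) (n + 1) (down_rel (n + 1))) ≫ A.d (n + 1) n),
      ← cone_d_fst]
    refine ⟨fun h ↦ by rw [h, zero_comp, zero_comp]; simp, fun h ↦ ?_⟩
    refine ext_to_X f (n + 1) n (down_rel n) ?_ ?_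
    · rw [zero_comp]; exact h.1
    · rw [zero_comp]; exact h.2

lemma cone_exists (n : ℕ) {P : C} (y₁ : P ⟶ A.X n) (y₂ : P ⟶ B.X (n + 1)) :
    ∃ x : P ⟶ (homotopyCofiber f).X (n + 1),
      x ≫ fstX f (n + 1) n (down_rel n) = y₁ ∧ x ≫ sndX f (n + 1) = y₂ :=
  ⟨y₁ ≫ inlX f n (n + 1) (down_rel n) + y₂ ≫ inrX f (n + 1), by simp, by simp⟩

/-- A cycle of the cone in degree `n + 1` is a cycle of `A` in degree `n` whose image is bounded, up
to sign, by an element of `B`. Bounding it combines injectivity on homology in degree `n` with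
surjectivity in degree `n + 1`; this is the long exact sequence, unwound. -/
lemma chainW_iff_isSplitExact [HasZeroObject C] [HasKernels C] :
    chainW Proj f ↔ IsSplitExact Proj (homotopyCofiber f) := by
  rw [chainW_iff, isSplitExact_iff]
  refine forall_congr' fun P ↦ forall_congr' fun hP ↦ ⟨fun h n y hy ↦ ?_, fun h n ↦ ⟨?_, ?_⟩⟩
  · cases n with
    | zero =>
      obtain ⟨x, -, w, hw⟩ := (h 0).1 (y ≫ sndX f 0) (by simp)
      obtain ⟨z, hz, hz'⟩ := cone_exists f 0 x w
      refine ⟨z, ext_to_X' f 0 (by simp) ?_⟩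
      rw [cone_d_snd, hz, hz', hw, add_sub_cancel]
    | succ n =>
      obtain ⟨hy₁, hy₂⟩ := (cone_cycle_iff f n y).1 hy
      set y₁ := y ≫ fstX f (n + 1) n (down_rel n) with hy₁'
      set y₂ := y ≫ sndX f (n + 1) with hy₂'
      obtain ⟨v, hv⟩ := (h n).2 y₁ hy₁ (-y₂) (by
        rw [Preadditive.neg_comp, neg_eq_iff_add_eq_zero, add_comm, hy₂])
      obtain ⟨x, hx, w, hw⟩ := (h (n + 1)).1 (y₂ + v ≫ f.f (n + 1)) (by
        change _ ≫ B.d (n + 1) n = 0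
        rw [Preadditive.add_comp, assoc v, f.comm, reassoc_of% hv, add_comm, hy₂])
      replace hx : x ≫ A.d (n + 1) n = 0 := hx
      -- The differential of the cone has components `-d(x - v) = d v = y₁` and `f(x - v) + d w =
      -- y₂`.
      obtain ⟨z, hz, hz'⟩ := cone_exists f (n + 1) (x - v) w
      refine ⟨z, ext_to_X f (n + 1) n (down_rel n) ?_ ?_⟩
      · rw [cone_d_fst, hz, ← hy₁', ← hv]
        simp [hx]
      · rw [cone_d_snd, hz, hz', hw, ← hy₂']
        simp
  · intro y hy
    cases n with
    | zero =>
      obtain ⟨z, hz⟩ := h 0 (y ≫ inrX f 0) (by simp)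
      have := cone_d_snd f 0 z
      rw [hz, assoc, inrX_sndX, comp_id] at this
      exact ⟨z ≫ fstX f 1 0 (down_rel 0), by simp, z ≫ sndX f 1, by rw [this]; simp⟩
    | succ n =>
      obtain ⟨x, hx, hx'⟩ := cone_exists f n (0 : P ⟶ _) y
      obtain ⟨z, rfl⟩ := h (n + 1) x ((cone_cycle_iff f n x).2 (by
        rw [hx, hx']
        replace hy : y ≫ B.d (n + 1) n = 0 := hy
        simp [hy]))
      rw [cone_d_fst] at hx
      rw [cone_d_snd] at hx'
      refine ⟨z ≫ fstX f (n + 2) (n + 1) (down_rel (n + 1)), ?_, z ≫ sndX f (n + 2), ?_⟩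
      · exact neg_eq_zero.1 hx
      · rw [← hx', add_sub_cancel_left]
  · intro x hx w hw
    obtain ⟨y, hy, hy'⟩ := cone_exists f n x (-w)
    obtain ⟨z, rfl⟩ := h (n + 1) y ((cone_cycle_iff f n y).2 (by
      rw [hy, hy', hx]
      simp [hw]))
    rw [cone_d_fst] at hy
    exact ⟨_, by rw [Preadditive.neg_comp]; exact hy⟩

end Cone

/-! ### Coproducts of disks -/

section Disks

variable {C : Type u} [Category.{v} C] [Preadditive C]

/-- The complex with given objects and zero differentials. -/
abbrev zeroComplex (Q : ℕ → C) : ChainComplex C ℕ where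
  X := Q
  d _ _ := 0

variable [HasBinaryBiproducts C]

open HomologicalComplex homotopyCofiber

/-- The sum of the disks `D^{n+1}(Q_n)`. -/
def disks (Q : ℕ → C) : ChainComplex C ℕ := homotopyCofiber (𝟙 (zeroComplex Q))

/-- The inclusion of `Q_n` in degree `n + 1`. -/
def disksι (Q : ℕ → C) (n : ℕ) : Q n ⟶ (disks Q).X (n + 1) :=
  inlX (𝟙 (zeroComplex Q)) n (n + 1) (down_rel n)

variable {Q : ℕ → C} {X : ChainComplex C ℕ}

lemma disksι_d (n : ℕ) :
    disksι Q n ≫ (disks Q).d (n + 1) n = inrX (𝟙 (zeroComplex Q)) n := by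
  cases n with
  | zero => exact (inlX_d' (𝟙 (zeroComplex Q)) 1 0 (down_rel 0) (by simp)).trans (id_comp _)
  | succ n =>
    refine (inlX_d (𝟙 (zeroComplex Q)) (n + 2) (n + 1) n (down_rel _) (down_rel n)).trans ?_
    rw [zero_comp, neg_zero, zero_add, HomologicalComplex.id_f, id_comp]

/-- Both copies of `Q_n` in the cone are governed by the one in degree `n + 1`, because the other is
its boundary (`disksι_d`). -/
lemma disks_hom_ext {φ ψ : disks Q ⟶ X}
    (h : ∀ n, disksι Q n ≫ φ.f (n + 1) = disksι Q n ≫ ψ.f (n + 1)) : φ = ψ := by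
  have h' (n : ℕ) : inrX (𝟙 (zeroComplex Q)) n ≫ φ.f n = inrX (𝟙 (zeroComplex Q)) n ≫ ψ.f n := by
    have := h n =≫ X.d (n + 1) n
    rw [assoc, assoc, φ.comm, ψ.comm, ← assoc, ← assoc, disksι_d] at this
    exact this
  ext n
  cases n with
  | zero => exact ext_from_X' (𝟙 (zeroComplex Q)) 0 (by simp) (h' 0)
  | succ n => exact ext_from_X (𝟙 (zeroComplex Q)) n (n + 1) (down_rel n) (h n) (h' (n + 1))

/-- Auxiliary definition for `disksDesc`. -/
def disksDescHom (q : ∀ n, Q n ⟶ X.X (n + 1)) : zeroComplex Q ⟶ X where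
  f n := q n ≫ X.d (n + 1) n
  comm' i j _ := by
    rw [zero_comp]
    obtain rfl | h := eq_or_ne i (j + 1)
    · rw [assoc, X.d_comp_d, comp_zero]
    · rw [X.shape i j (fun h' ↦ h h'.symm), comp_zero]

/-- Auxiliary definition for `disksDesc`. -/
def disksDescHomotopy (q : ∀ n, Q n ⟶ X.X (n + 1)) :
    Homotopy (𝟙 (zeroComplex Q) ≫ disksDescHom q) 0 where
  hom i j := if h : j = i + 1 then q i ≫ eqToHom (by rw [h]) else 0
  zero i j h := dif_neg (fun h' ↦ h h'.symm)
  comm n := by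
    have : dNext n (fun i j ↦ if h : j = i + 1 then q i ≫ eqToHom (by rw [h]) else 0) =
        (0 : (zeroComplex Q).X n ⟶ X.X n) := zero_comp
    rw [this, prevD_eq _ (down_rel n), dif_pos rfl, eqToHom_refl, id_comp, zero_add]
    erw [comp_id]
    simp [disksDescHom]

/-- The map from the sum of the disks with given components. -/
def disksDesc (q : ∀ n, Q n ⟶ X.X (n + 1)) : disks Q ⟶ X :=
  homotopyCofiber.desc (𝟙 (zeroComplex Q)) (disksDescHom q) (disksDescHomotopy q)

@[simp]
lemma disksι_disksDesc (q : ∀ n, Q n ⟶ X.X (n + 1)) (n : ℕ) :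
    disksι Q n ≫ (disksDesc q).f (n + 1) = q n := by
  refine (inlX_desc_f (𝟙 (zeroComplex Q)) (disksDescHom q) (disksDescHomotopy q) n (n + 1)
    (down_rel n)).trans ?_
  dsimp only [disksDescHomotopy]
  rw [dif_pos rfl]
  exact comp_id _

@[simp]
lemma disksι_disksDesc_assoc (q : ∀ n, Q n ⟶ X.X (n + 1)) (n : ℕ) {Y : C} (g : X.X (n + 1) ⟶ Y) :
    disksι Q n ≫ (disksDesc q).f (n + 1) ≫ g = q n ≫ g := by
  rw [← assoc, disksι_disksDesc]

variable [HasZeroObject C] [HasKernels C]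

lemma disks_exact {P : C} (n : ℕ) (x : P ⟶ (disks Q).X n) (hx : x ≫ (disks Q).d n (n - 1) = 0) :
    ∃ w : P ⟶ (disks Q).X (n + 1), w ≫ (disks Q).d (n + 1) n = x := by
  -- A cone on an identity is exact for every class of test objects. Taking all objects as
  -- projectives covers an arbitrary `P`.
  refine (isSplitExact_iff (Proj := ⊤) _).1 ((chainW_iff_isSplitExact _).1 ?_) P (by trivial) n x hx
  refine (chainW_iff _ _).2 fun P hP n ↦ ⟨fun y hy ↦ ⟨y, hy, 0, ?_⟩, fun x hx w hw ↦ ⟨w, ?_⟩⟩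
  · simp
  · simpa using hw

end Disks

/-! ### The factorization into trivial cofibrations followed by fibrations -/

section TrivCofFib

variable {C : Type u} [Category.{v} C] [Preadditive C] [HasZeroObject C] [HasBinaryBiproducts C]
  (Proj : ObjectProperty C)

/-- The sum of the disks `D^{n+1}(F(X_{n+1}))`, as a functor in `X`. -/
def disksFunctor (F : C ⥤ C) : ChainComplex C ℕ ⥤ ChainComplex C ℕ where
  obj X := disks fun n ↦ F.obj (X.X (n + 1))
  map {X Y} f := disksDesc fun n ↦
    F.map (f.f (n + 1)) ≫ disksι (fun n ↦ F.obj (Y.X (n + 1))) n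
  map_id X := disks_hom_ext fun n ↦ by
    rw [disksι_disksDesc]
    simp
  map_comp f g := disks_hom_ext fun n ↦ by
    rw [disksι_disksDesc, HomologicalComplex.comp_f, HomologicalComplex.comp_f,
      disksι_disksDesc_assoc, assoc, disksι_disksDesc, F.map_comp, assoc]

/-- The natural map `⨁ D^{n+1}(F(X_{n+1})) ⟶ X`. -/
def disksFunctorπ {F : C ⥤ C} (ν : F ⟶ 𝟭 C) : disksFunctor F ⟶ 𝟭 (ChainComplex C ℕ) where
  app X := disksDesc (Q := fun n ↦ F.obj (X.X (n + 1))) fun n ↦ ν.app (X.X (n + 1))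
  naturality X Y f := by
    refine disks_hom_ext fun n ↦ ?_
    dsimp only [disksFunctor, Functor.id_map]
    rw [HomologicalComplex.comp_f, HomologicalComplex.comp_f, disksι_disksDesc_assoc,
      disksι_disksDesc_assoc, assoc, disksι_disksDesc]
    exact ν.naturality _

/-- A map out of a sum of disks is a free choice of elements in positive degrees, exactly where
fibrations are split. -/
lemma llp_chainFib_inl (A : ChainComplex C ℕ) (Q : ℕ → C) (hQ : ∀ n, Proj (Q n)) :
    (chainFib Proj).llp (biprod.inl : A ⟶ A ⊞ disks Q) := fun X Y p hp ↦ by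
  refine ⟨fun {a b} sq ↦ ?_⟩
  rw [chainFib_iff] at hp
  choose l hl using fun n ↦ hp n _ (hQ n) (disksι Q n ≫ (biprod.inr ≫ b).f (n + 1))
  refine ⟨⟨biprod.desc a (disksDesc l), by simp, ?_⟩⟩
  refine biprod.hom_ext' _ _ (by simpa using sq.w) ?_
  rw [biprod.inr_desc_assoc]
  refine disks_hom_ext fun n ↦ ?_
  have := hl n
  dsimp only at this
  rw [← this]
  simp

lemma chainW_inl [HasKernels C] (A : ChainComplex C ℕ) (Q : ℕ → C) :
    chainW Proj (biprod.inl : A ⟶ A ⊞ disks Q) := by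
  refine (chainW_iff _ _).2 fun P hP n ↦ ⟨fun y hy ↦ ?_, fun x hx w hw ↦ ?_⟩
  · obtain ⟨w, hw⟩ := disks_exact n (y ≫ (biprod.snd : A ⊞ disks Q ⟶ disks Q).f n) (by
      rw [assoc, HomologicalComplex.Hom.comm, reassoc_of% hy, zero_comp])
    refine ⟨y ≫ (biprod.fst : A ⊞ disks Q ⟶ A).f n, ?_,
      w ≫ (biprod.inr : disks Q ⟶ A ⊞ disks Q).f (n + 1), ?_⟩
    · rw [assoc, HomologicalComplex.Hom.comm, reassoc_of% hy, zero_comp]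
    · rw [assoc, HomologicalComplex.Hom.comm, reassoc_of% hw, eq_sub_iff_add_eq, assoc,
        ← Preadditive.comp_add, ← HomologicalComplex.comp_f, ← HomologicalComplex.comp_f,
        ← HomologicalComplex.add_f_apply, add_comm, biprod.total, HomologicalComplex.id_f, comp_id]
  · refine ⟨w ≫ (biprod.fst : A ⊞ disks Q ⟶ A).f (n + 1), ?_⟩
    rw [assoc, HomologicalComplex.Hom.comm, reassoc_of% hw, ← HomologicalComplex.comp_f,
      biprod.inl_fst, HomologicalComplex.id_f, comp_id]

lemma chainFib_desc {F : C ⥤ C} {ν : F ⟶ 𝟭 C} (h : ∀ X, Proj (F.obj X) ∧ projSplit Proj (ν.app X))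
    {A B : ChainComplex C ℕ} (f : A ⟶ B) :
    chainFib Proj (biprod.desc f ((disksFunctorπ ν).app B) : A ⊞ (disksFunctor F).obj B ⟶ B) := by
  refine (chainFib_iff _ _).2 fun n P hP y ↦ ?_
  obtain ⟨x, hx⟩ := (h (B.X (n + 1))).2 P hP y
  refine ⟨(x ≫ disksι (fun n ↦ F.obj (B.X (n + 1))) n) ≫
    (biprod.inr : disks (fun n ↦ F.obj (B.X (n + 1))) ⟶ A ⊞ disks _).f (n + 1), ?_⟩
  have e : (biprod.inr : disks (fun n ↦ F.obj (B.X (n + 1))) ⟶ A ⊞ disks _) ≫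
    biprod.desc f ((disksFunctorπ ν).app B) = (disksFunctorπ ν).app B := biprod.inr_desc _ _
  have e' : disksι (fun n ↦ F.obj (B.X (n + 1))) n ≫ ((disksFunctorπ ν).app B).f (n + 1) =
    ν.app (B.X (n + 1)) := disksι_disksDesc _ _
  refine (assoc _ _ _).trans ?_
  refine (congrArg (fun φ ↦ (x ≫ disksι (fun n ↦ F.obj (B.X (n + 1))) n) ≫
    HomologicalComplex.Hom.f φ (n + 1)) e).trans ?_
  exact (assoc _ _ _).trans ((congrArg (x ≫ ·) e').trans hx)

lemma biprod_map_desc_disksFunctorπ {F : C ⥤ C} (ν : F ⟶ 𝟭 C) {A B A' B' : ChainComplex C ℕ}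
    (f : A ⟶ B) (f' : A' ⟶ B') (a : A ⟶ A') (b : B ⟶ B') (w : a ≫ f' = f ≫ b) :
    biprod.map a ((disksFunctor F).map b) ≫ biprod.desc f' ((disksFunctorπ ν).app B') =
      biprod.desc f ((disksFunctorπ ν).app B) ≫ b := by
  refine biprod.hom_ext' _ _ ?_ ?_
  · rw [biprod.inl_map_assoc, biprod.inl_desc, biprod.inl_desc_assoc, w]
  · rw [biprod.inr_map_assoc, biprod.inr_desc, biprod.inr_desc_assoc]
    exact (disksFunctorπ ν).naturality b

variable {Proj}

/-- The functorial factorization of maps of complexes into trivial cofibrations followed by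
fibrations. -/
def trivCofFibData [HasKernels C] {F : C ⥤ C} {ν : F ⟶ 𝟭 C}
    (h : ∀ X, Proj (F.obj X) ∧ projSplit Proj (ν.app X)) :
    MorphismProperty.FunctorialFactorizationData ((chainFib Proj).llp ⊓ chainW Proj)
      (chainFib Proj) where
  Z :=
    { obj f := f.left ⊞ (disksFunctor F).obj f.right
      map φ := biprod.map φ.left ((disksFunctor F).map φ.right)
      map_id f := by
        refine biprod.hom_ext' _ _ ?_ ?_ <;> simp
      map_comp φ ψ := by
        refine biprod.hom_ext' _ _ ?_ ?_ <;> simp }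
  i :=
    { app f := biprod.inl
      naturality f g φ := (biprod.inl_map φ.left ((disksFunctor F).map φ.right)).symm }
  p :=
    { app f := biprod.desc f.hom ((disksFunctorπ ν).app f.right)
      naturality f g φ := biprod_map_desc_disksFunctorπ ν f.hom g.hom φ.left φ.right φ.w }
  fac := by
    ext f : 2
    exact biprod.inl_desc _ _
  hi f := ⟨llp_chainFib_inl Proj _ _ fun n ↦ (h _).1, chainW_inl Proj _ _⟩
  hp f := chainFib_desc Proj h f.hom

end TrivCofFib

/-! ### Natural families of maps out of spheres and disks -/

section NaturalSpheres

variable {C : Type u} [Category.{v} C] [Preadditive C] [HasZeroObject C]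

lemma sphereEquiv_map (n : ℕ) {P Q : C} {X : ChainComplex C ℕ} (f : P ⟶ Q) (g : sphere n Q ⟶ X) :
    (sphereEquiv n P X ((HomologicalComplex.single C (ComplexShape.down ℕ) n).map f ≫ g)).1 =
      f ≫ (sphereEquiv n Q X g).1 := by
  simp [sphereEquiv, HomologicalComplex.single_map_f_self]

/-- The disk `D^{n+1}(P)`, as a functor in `P`. -/
def diskFunctor (n : ℕ) : C ⥤ ChainComplex C ℕ where
  obj P := disk n P
  map {P Q} f := (diskEquiv n P _).symm (f ≫ diskEquiv n Q _ (𝟙 _))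
  map_id P := (diskEquiv n P _).injective (by simp)
  map_comp f g := (diskEquiv n _ _).injective (by
    rw [Equiv.apply_symm_apply, diskEquiv_comp, Equiv.apply_symm_apply, assoc, assoc,
      ← diskEquiv_comp, id_comp, Equiv.apply_symm_apply])

lemma diskEquiv_map (n : ℕ) {P Q : C} {X : ChainComplex C ℕ} (f : P ⟶ Q) (g : disk n Q ⟶ X) :
    diskEquiv n P X ((diskFunctor n).map f ≫ g) = f ≫ diskEquiv n Q X g := by
  refine (diskEquiv_comp _ _ _ _).trans ?_
  refine (congrArg (· ≫ g.f (n + 1)) (Equiv.apply_symm_apply (diskEquiv n P _) _)).trans ?_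
  rw [assoc, ← diskEquiv_comp, id_comp]

/-- The natural map from spheres to disks. -/
def sphereToDiskNat (n : ℕ) :
    HomologicalComplex.single C (ComplexShape.down ℕ) n ⟶ diskFunctor n where
  app P := sphereToDisk n P
  naturality P Q f := by
    refine (sphereEquiv n P _).injective (Subtype.ext ?_)
    refine (sphereEquiv_map n f (sphereToDisk n Q)).trans ?_
    refine Eq.trans ?_ (sphereEquiv_sphereToDisk n P ((diskFunctor n).map f)).symm
    have h := Equiv.apply_symm_apply (diskEquiv n P _) (f ≫ diskEquiv n Q _ (𝟙 _))
    have h' := sphereEquiv_sphereToDisk n Q (𝟙 _)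
    rw [comp_id] at h'
    refine Eq.trans ?_ (congrArg (· ≫ (disk n Q).d (n + 1) n) h).symm
    rw [h', assoc]

variable {K : Type u'} [Category.{w} K] {G : K ⥤ C} {X : K ⥤ ChainComplex C ℕ}

/-- A natural family of cycles as a natural family of maps out of spheres. -/
def sphereNat (n : ℕ) (a : G ⟶ X ⋙ HomologicalComplex.eval C _ n)
    (ha : ∀ k, a.app k ≫ (X.obj k).d n (n - 1) = 0) :
    G ⋙ HomologicalComplex.single C (ComplexShape.down ℕ) n ⟶ X where
  app k := (sphereEquiv n (G.obj k) (X.obj k)).symm ⟨a.app k, ha k⟩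
  naturality k l f := (sphereEquiv n _ _).injective (Subtype.ext (by
    refine (sphereEquiv_map _ _ _).trans (Eq.trans ?_ (sphereEquiv_comp _ _ _ _).symm)
    rw [Equiv.apply_symm_apply, Equiv.apply_symm_apply]
    exact a.naturality f))

/-- A natural family of elements as a natural family of maps out of disks. -/
def diskNat (n : ℕ) (b : G ⟶ X ⋙ HomologicalComplex.eval C _ (n + 1)) :
    G ⋙ diskFunctor n ⟶ X where
  app k := (diskEquiv n (G.obj k) (X.obj k)).symm (b.app k)
  naturality k l f := (diskEquiv n _ _).injective (by
    refine (diskEquiv_map _ _ _).trans (Eq.trans ?_ (diskEquiv_comp _ _ _ _).symm)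
    refine (congrArg (G.map f ≫ ·) (Equiv.apply_symm_apply (diskEquiv n _ _) _)).trans ?_
    refine Eq.trans (b.naturality f) ?_
    exact congrArg (· ≫ (X.map f).f (n + 1)) (Equiv.apply_symm_apply (diskEquiv n _ _) _).symm)

end NaturalSpheres

/-! ### Attaching cells functorially -/

section Attach

variable {C : Type u} [Category.{v} C] [Preadditive C] [HasZeroObject C] [HasLimits C]
  [HasColimits C] {K : Type u'} [Category.{w} K] {Z B : K ⥤ ChainComplex C ℕ}

/-- The differential as a natural transformation. -/
@[simps]
def dNat (i j : ℕ) : HomologicalComplex.eval C (ComplexShape.down ℕ) i ⟶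
    HomologicalComplex.eval C (ComplexShape.down ℕ) j where
  app X := X.d i j
  naturality _ _ f := f.comm i j

/-- The pairs `(a, b)` in `Z_n × B_{n+1}` with `p a = d b`. -/
abbrev relPairs (p : Z ⟶ B) (n : ℕ) : K ⥤ C :=
  pullback (Functor.whiskerRight p (HomologicalComplex.eval C (ComplexShape.down ℕ) n))
    (Functor.whiskerLeft B (dNat (n + 1) n))

/-- The pairs `(a, b)` in `Z_n × B_{n+1}` with `d a = 0` and `p a = d b`. -/
abbrev relCycles (p : Z ⟶ B) (n : ℕ) : K ⥤ C :=
  pullback (pullback.fst _ _ ≫ Functor.whiskerLeft Z (dNat n (n - 1)) : relPairs p n ⟶ _)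
    (0 : (Functor.const K).obj (0 : C) ⟶ _)

/-- The first projection. -/
def relCyclesFst (p : Z ⟶ B) (n : ℕ) :
    relCycles p n ⟶ Z ⋙ HomologicalComplex.eval C (ComplexShape.down ℕ) n :=
  pullback.fst _ _ ≫ pullback.fst _ _

/-- The second projection. -/
def relCyclesSnd (p : Z ⟶ B) (n : ℕ) :
    relCycles p n ⟶ B ⋙ HomologicalComplex.eval C (ComplexShape.down ℕ) (n + 1) :=
  pullback.fst _ _ ≫ pullback.snd _ _

lemma relCyclesFst_d (p : Z ⟶ B) (n : ℕ) (k : K) :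
    (relCyclesFst p n).app k ≫ (Z.obj k).d n (n - 1) = 0 := by
  have h : relCyclesFst p n ≫ Functor.whiskerLeft Z (dNat n (n - 1)) = 0 := by
    rw [relCyclesFst, assoc, pullback.condition, comp_zero]
  exact NatTrans.congr_app h k

lemma relCycles_condition (p : Z ⟶ B) (n : ℕ) (k : K) :
    (relCyclesFst p n).app k ≫ (p.app k).f n =
      (relCyclesSnd p n).app k ≫ (B.obj k).d (n + 1) n := by
  have h : relCyclesFst p n ≫ Functor.whiskerRight p (HomologicalComplex.eval C _ n) =
      relCyclesSnd p n ≫ Functor.whiskerLeft B (dNat (n + 1) n) := by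
    rw [relCyclesFst, relCyclesSnd, assoc, assoc, pullback.condition]
  exact NatTrans.congr_app h k

/-- Pullbacks of functors are computed pointwise. Forming them in `K ⥤ C` makes the attaching data
natural from the start, so that the factorisation is functorial. -/
lemma exists_relCycles_lift (p : Z ⟶ B) (n : ℕ) (k : K) {P : C} (a : P ⟶ (Z.obj k).X n)
    (b : P ⟶ (B.obj k).X (n + 1)) (ha : a ≫ (Z.obj k).d n (n - 1) = 0)
    (hab : a ≫ (p.app k).f n = b ≫ (B.obj k).d (n + 1) n) :
    ∃ e : P ⟶ (relCycles p n).obj k, e ≫ (relCyclesFst p n).app k = a ∧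
      e ≫ (relCyclesSnd p n).app k = b := by
  have h₁ := (IsPullback.of_hasPullback
    (Functor.whiskerRight p (HomologicalComplex.eval C (ComplexShape.down ℕ) n))
    (Functor.whiskerLeft B (dNat (n + 1) n))).map ((evaluation K C).obj k)
  have h₂ := (IsPullback.of_hasPullback
    (pullback.fst _ _ ≫ Functor.whiskerLeft Z (dNat n (n - 1)) : relPairs p n ⟶ _)
    (0 : (Functor.const K).obj (0 : C) ⟶ _)).map ((evaluation K C).obj k)
  obtain ⟨e₁, h₁a, h₁b⟩ := h₁.exists_lift a b hab
  obtain ⟨e₂, h₂a, -⟩ := h₂.exists_lift e₁ 0 (by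
    refine (assoc _ _ _).symm.trans ?_
    refine (congrArg (· ≫ (Z.obj k).d n (n - 1)) h₁a).trans (ha.trans ?_)
    exact zero_comp.symm)
  refine ⟨e₂, ?_, ?_⟩
  · exact (assoc _ _ _).symm.trans ((congrArg (· ≫ _) h₂a).trans h₁a)
  · exact (assoc _ _ _).symm.trans ((congrArg (· ≫ _) h₂a).trans h₁b)

variable {F : C ⥤ C} (ν : F ⟶ 𝟭 C)

/-- The attaching map of the `(n + 1)`-cells. -/
def attachingMap (p : Z ⟶ B) (n : ℕ) :
    (relCycles p n ⋙ F) ⋙ HomologicalComplex.single C (ComplexShape.down ℕ) n ⟶ Z :=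
  sphereNat n (Functor.whiskerLeft (relCycles p n) ν ≫ relCyclesFst p n) fun k ↦ by
    refine (assoc _ _ _).trans ?_
    rw [relCyclesFst_d, comp_zero]

/-- The map to `B` on the attached `(n + 1)`-cells. -/
def cellMap (p : Z ⟶ B) (n : ℕ) : (relCycles p n ⋙ F) ⋙ diskFunctor n ⟶ B :=
  diskNat n (Functor.whiskerLeft (relCycles p n) ν ≫ relCyclesSnd p n)

lemma attachingMap_comp (p : Z ⟶ B) (n : ℕ) : attachingMap ν p n ≫ p =
    Functor.whiskerLeft (relCycles p n ⋙ F) (sphereToDiskNat n) ≫ cellMap ν p n := by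
  ext k : 2
  refine (sphereEquiv n _ _).injective (Subtype.ext ?_)
  refine (sphereEquiv_comp _ _ _ _).trans ?_
  refine Eq.trans ?_ (sphereEquiv_sphereToDisk n _ ((cellMap ν p n).app k)).symm
  refine (congrArg (· ≫ (p.app k).f n) (congrArg Subtype.val
    (Equiv.apply_symm_apply (sphereEquiv n _ _) _))).trans ?_
  refine Eq.trans ?_ (congrArg (· ≫ (B.obj k).d (n + 1) n)
    (Equiv.apply_symm_apply (diskEquiv n _ _) _)).symm
  refine (assoc _ _ _).trans (Eq.trans ?_ (assoc _ _ _).symm)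
  exact congrArg (_ ≫ ·) (relCycles_condition p n k)

variable (B) in
/-- The map to `B` on the attached `0`-cells. -/
def zeroCellMap : ((B ⋙ HomologicalComplex.eval C (ComplexShape.down ℕ) 0) ⋙ F) ⋙
    HomologicalComplex.single C (ComplexShape.down ℕ) 0 ⟶ B :=
  sphereNat 0 (Functor.whiskerLeft (B ⋙ HomologicalComplex.eval C _ 0) ν)
    (fun k ↦ (congrArg _ ((B.obj k).shape 0 (0 - 1) (by simp))).trans comp_zero)

/-- Attaching the cells of a given dimension to an object over `B`. -/
def attach (p : Over B) : ℕ → Over B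
  | 0 => Over.mk (pushout.desc (f := (0 : (Functor.const K).obj (0 : ChainComplex C ℕ) ⟶ p.left))
      (g := 0) p.hom (zeroCellMap B ν) (by rw [zero_comp, zero_comp]))
  | n + 1 => Over.mk (pushout.desc p.hom (cellMap ν p.hom n) (attachingMap_comp ν p.hom n))

/-- The inclusion into the object with attached cells. -/
def toAttach (p : Over B) : ∀ n : ℕ, p ⟶ attach ν p n
  | 0 => Over.homMk (pushout.inl _ _) (pushout.inl_desc _ _ _)
  | _ + 1 => Over.homMk (pushout.inl _ _) (pushout.inl_desc _ _ _)

variable {Proj : ObjectProperty C}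

lemma toAttach_mem (hF : ∀ X, Proj (F.obj X)) (p : Over B) (n : ℕ) (k : K) :
    MorphismProperty.pushouts (chainI Proj) ((toAttach ν p n).left.app k) := by
  cases n with
  | zero =>
    have h := (IsPushout.of_hasPushout
      (0 : (Functor.const K).obj (0 : ChainComplex C ℕ) ⟶ p.left)
      (0 : _ ⟶ ((B ⋙ HomologicalComplex.eval C _ 0) ⋙ F) ⋙
        HomologicalComplex.single C (ComplexShape.down ℕ) 0)).map
      ((evaluation K (ChainComplex C ℕ)).obj k)
    exact ⟨_, _, _, _, _, chainI.zero _ (hF ((B.obj k).X 0)), h⟩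
  | succ n =>
    have h := (IsPushout.of_hasPushout (attachingMap ν p.hom n)
      (Functor.whiskerLeft (relCycles p.hom n ⋙ F) (sphereToDiskNat n))).map
      ((evaluation K (ChainComplex C ℕ)).obj k)
    exact ⟨_, _, _, _, _, chainI.succ n _ (hF _), h⟩

/-- The inclusion of the bounding sphere in a disk of dimension `n` is an isomorphism outside degree
`n`, and this persists under pushout. -/
lemma isIso_toAttach (p : Over B) (n : ℕ) (k : K) (m : ℕ) (hm : m ≠ n) :
    IsIso (((toAttach ν p n).left.app k).f m) := by
  cases n with
  | zero =>
    have h := ((IsPushout.of_hasPushout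
      (0 : (Functor.const K).obj (0 : ChainComplex C ℕ) ⟶ p.left)
      (0 : _ ⟶ ((B ⋙ HomologicalComplex.eval C _ 0) ⋙ F) ⋙
        HomologicalComplex.single C (ComplexShape.down ℕ) 0)).map
      ((evaluation K (ChainComplex C ℕ)).obj k)).map
      (HomologicalComplex.eval C (ComplexShape.down ℕ) m)
    exact h.isIso_inl_of_isIso (isIso_of_isZero
      ((HomologicalComplex.eval C (ComplexShape.down ℕ) m).map_isZero (isZero_zero _))
      (HomologicalComplex.isZero_single_obj_X (ComplexShape.down ℕ) 0 _ m hm) _)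
  | succ n =>
    have h := ((IsPushout.of_hasPushout (attachingMap ν p.hom n)
      (Functor.whiskerLeft (relCycles p.hom n ⋙ F) (sphereToDiskNat n))).map
      ((evaluation K (ChainComplex C ℕ)).obj k)).map
      (HomologicalComplex.eval C (ComplexShape.down ℕ) m)
    exact h.isIso_inl_of_isIso (isIso_sphereToDisk_f_of_ne _ _ _ hm)

lemma projSplit_attach_zero (hν : ∀ X, projSplit Proj (ν.app X)) (p : Over B) (k : K) :
    projSplit Proj (((attach ν p 0).hom.app k).f 0) := fun P hP b ↦ by
  obtain ⟨x, hx⟩ := hν _ P hP b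
  let j := (pushout.inr (0 : (Functor.const K).obj (0 : ChainComplex C ℕ) ⟶ p.left)
    (0 : _ ⟶ ((B ⋙ HomologicalComplex.eval C _ 0) ⋙ F) ⋙
      HomologicalComplex.single C (ComplexShape.down ℕ) 0)).app k
  have hj : j ≫ (attach ν p 0).hom.app k = (zeroCellMap B ν).app k :=
    NatTrans.congr_app (pushout.inr_desc _ _ _) k
  let c := (sphereEquiv 0 (F.obj ((B.obj k).X 0)) ((attach ν p 0).left.obj k) j).1
  have hc : c ≫ ((attach ν p 0).hom.app k).f 0 = ν.app ((B.obj k).X 0) :=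
    (sphereEquiv_comp _ _ _ _).symm.trans ((congrArg (fun φ ↦ (sphereEquiv 0 _ _ φ).1) hj).trans
      (congrArg Subtype.val (Equiv.apply_symm_apply (sphereEquiv 0 _ _) _)))
  exact ⟨x ≫ c, (assoc _ _ _).trans ((congrArg (x ≫ ·) hc).trans hx)⟩

/-- The pair `(a, b)` is classified by a map to the object of relative cycles. This map lifts
through `F`, which indexes the attached cells; the corresponding cell then bounds `a` and lies over
`b`. -/
lemma exists_attach_succ (hν : ∀ X, projSplit Proj (ν.app X)) (p : Over B) (n : ℕ) (k : K)
    {P : C} (hP : Proj P) (a : P ⟶ (p.left.obj k).X n)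
    (b : P ⟶ (B.obj k).X (n + 1)) (ha : a ≫ (p.left.obj k).d n (n - 1) = 0)
    (hab : a ≫ (p.hom.app k).f n = b ≫ (B.obj k).d (n + 1) n) :
    ∃ c : P ⟶ ((attach ν p (n + 1)).left.obj k).X (n + 1),
      c ≫ ((attach ν p (n + 1)).left.obj k).d (n + 1) n =
        a ≫ ((toAttach ν p (n + 1)).left.app k).f n ∧
      c ≫ ((attach ν p (n + 1)).hom.app k).f (n + 1) = b := by
  obtain ⟨e, hea, heb⟩ := exists_relCycles_lift p.hom n k a b ha hab
  obtain ⟨x, hx⟩ := hν _ P hP e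
  let j := (pushout.inr (attachingMap ν p.hom n)
    (Functor.whiskerLeft (relCycles p.hom n ⋙ F) (sphereToDiskNat n))).app k
  have hj : j ≫ (attach ν p (n + 1)).hom.app k = (cellMap ν p.hom n).app k :=
    NatTrans.congr_app (pushout.inr_desc _ _ _) k
  have hj' : sphereToDisk n _ ≫ j =
      (attachingMap ν p.hom n).app k ≫ (toAttach ν p (n + 1)).left.app k :=
    (NatTrans.congr_app (pushout.condition (f := attachingMap ν p.hom n)
      (g := Functor.whiskerLeft (relCycles p.hom n ⋙ F) (sphereToDiskNat n))) k).symm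
  let c := diskEquiv n (F.obj ((relCycles p.hom n).obj k)) ((attach ν p (n + 1)).left.obj k) j
  have hc : c ≫ ((attach ν p (n + 1)).hom.app k).f (n + 1) =
      ν.app _ ≫ (relCyclesSnd p.hom n).app k :=
    (diskEquiv_comp _ _ _ _).symm.trans ((congrArg (fun φ ↦ diskEquiv n _ _ φ) hj).trans
      (Equiv.apply_symm_apply (diskEquiv n _ _) _))
  have hd : c ≫ ((attach ν p (n + 1)).left.obj k).d (n + 1) n =
      (ν.app _ ≫ (relCyclesFst p.hom n).app k) ≫ ((toAttach ν p (n + 1)).left.app k).f n :=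
    (sphereEquiv_sphereToDisk n _ _).symm.trans
      ((congrArg (fun φ ↦ (sphereEquiv n _ _ φ).1) hj').trans
      ((sphereEquiv_comp _ _ _ _).trans (congrArg
        (· ≫ ((toAttach ν p (n + 1)).left.app k).f n) (congrArg Subtype.val
          (Equiv.apply_symm_apply (sphereEquiv n _ _) _)))))
  refine ⟨x ≫ c, ?_, ?_⟩
  · refine (assoc _ _ _).trans ((congrArg (x ≫ ·) hd).trans ?_)
    refine (assoc _ _ _).symm.trans (congrArg (· ≫ _) ?_)
    exact (assoc _ _ _).symm.trans ((congrArg (· ≫ _) hx).trans hea)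
  · refine (assoc _ _ _).trans ((congrArg (x ≫ ·) hc).trans ?_)
    exact (assoc _ _ _).symm.trans ((congrArg (· ≫ _) hx).trans heb)


/-- The sequence of objects over `B` obtained from `p` by attaching cells of increasing
dimensions. -/
def attachSeq (p : Over B) : ℕ → Over B
  | 0 => p
  | n + 1 => attach ν (attachSeq p n) n

/-- The diagram of the complexes obtained by attaching cells of increasing dimensions. -/
def attachDiagram (p : Over B) : ℕ ⥤ K ⥤ ChainComplex C ℕ :=
  Functor.ofSequence (fun n ↦ toAttach ν (attachSeq ν p n) n) ⋙ Over.forget B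

lemma attachDiagram_map (p : Over B) (n : ℕ) : (attachDiagram ν p).map (homOfLE n.le_succ) =
    (toAttach ν (attachSeq ν p n) n).left :=
  congrArg (Over.forget B).map
    (Functor.ofSequence_map_homOfLE_succ (fun n ↦ toAttach ν (attachSeq ν p n) n) n)

/-- The complex obtained by attaching cells in all dimensions. -/
def attachColimit (p : Over B) : K ⥤ ChainComplex C ℕ := colimit (attachDiagram ν p)

/-- The inclusion of a stage. -/
def attachColimitι (p : Over B) (n : ℕ) : (attachSeq ν p n).left ⟶ attachColimit ν p :=
  colimit.ι (attachDiagram ν p) n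

/-- The cocone of the maps to `B`. -/
def attachCocone (p : Over B) : Cocone (attachDiagram ν p) where
  pt := B
  ι :=
    { app n := (attachSeq ν p n).hom
      naturality m n f := by
        refine Eq.trans ?_ (comp_id _).symm
        exact Over.w ((Functor.ofSequence
          (fun n ↦ toAttach ν (attachSeq ν p n) n)).map f) }

/-- The map from the colimit to `B`. -/
def attachColimitπ (p : Over B) : attachColimit ν p ⟶ B :=
  colimit.desc (attachDiagram ν p) (attachCocone ν p)

lemma attachColimitι_π (p : Over B) (n : ℕ) :
    attachColimitι ν p n ≫ attachColimitπ ν p = (attachSeq ν p n).hom :=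
  colimit.ι_desc (attachCocone ν p) n

lemma toAttach_attachColimitι (p : Over B) (n : ℕ) :
    (toAttach ν (attachSeq ν p n) n).left ≫ attachColimitι ν p (n + 1) =
      attachColimitι ν p n := by
  rw [← attachDiagram_map]
  exact colimit.w (attachDiagram ν p) (homOfLE n.le_succ)

/-- The passage from stage `j` to stage `j + 1` changes degree `j` only, so degree `m` is constant
from stage `m + 1` on. -/
lemma isIso_attachColimitι (p : Over B) (k : K) (m n : ℕ) (h : m < n) :
    IsIso (((attachColimitι ν p n).app k).f m) := by
  let E := (evaluation K (ChainComplex C ℕ)).obj k ⋙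
    HomologicalComplex.eval C (ComplexShape.down ℕ) m
  have hE : (attachDiagram ν p ⋙ E).IsEventuallyConstantFrom n := by
    intro j f
    obtain ⟨d, rfl⟩ := Nat.exists_eq_add_of_le (leOfHom f)
    induction d with
    | zero =>
      rw [Subsingleton.elim f (𝟙 _)]
      infer_instance
    | succ d hd =>
      rw [Subsingleton.elim f (homOfLE (n.le_add_right d) ≫ homOfLE (n + d).le_succ),
        Functor.map_comp]
      have h₁ := hd (homOfLE (n.le_add_right d))
      have h₂ : IsIso ((attachDiagram ν p ⋙ E).map (homOfLE (n + d).le_succ)) := by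
        dsimp only [Functor.comp_map]
        rw [attachDiagram_map]
        exact isIso_toAttach ν _ (n + d) k m (by omega)
      infer_instance
  exact hE.isIso_ι_of_isColimit (isColimitOfPreserves E (colimit.isColimit (attachDiagram ν p)))

/-- A cycle of degree `n` in the colimit already lives in stage `n + 1`, and the very next step
attaches a cell for each of its lifting problems. Hence one pass through the dimensions suffices. -/
lemma rlp_chainI_attachColimitπ (hν : ∀ X, projSplit Proj (ν.app X)) (p : Over B) (k : K) :
    MorphismProperty.rlp (chainI Proj) ((attachColimitπ ν p).app k) := by
  have hπ (n m : ℕ) : ((attachColimitι ν p n).app k).f m ≫ ((attachColimitπ ν p).app k).f m =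
      ((attachSeq ν p n).hom.app k).f m :=
    congrArg (fun φ : (attachSeq ν p n).left ⟶ B ↦ (φ.app k).f m) (attachColimitι_π ν p n)
  rw [rlp_chainI_iff]
  refine ⟨fun P hP b ↦ ?_, fun n P hP a b ha hab ↦ ?_⟩
  · obtain ⟨(c : P ⟶ ((attachSeq ν p 1).left.obj k).X 0), hc⟩ :=
      projSplit_attach_zero ν hν p k P hP b
    refine ⟨c ≫ ((attachColimitι ν p 1).app k).f 0, ?_⟩
    dsimp only at hc ⊢
    rw [assoc, hπ]
    exact hc
  · have h₁ := isIso_attachColimitι ν p k n (n + 1) n.lt_succ_self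
    -- Degree `n - 1` is compared too, so that the element found in stage `n + 1` is a cycle there
    -- and not only in the colimit.
    have h₂ := isIso_attachColimitι ν p k (n - 1) (n + 1) (by omega)
    let ι := (attachColimitι ν p (n + 1)).app k
    obtain ⟨a, rfl⟩ : ∃ a', a' ≫ ι.f n = a := ⟨a ≫ inv (ι.f n), by simp [ι]⟩
    obtain ⟨(c : P ⟶ ((attachSeq ν p (n + 2)).left.obj k).X (n + 1)), hc, hc'⟩ :=
      exists_attach_succ ν hν (attachSeq ν p (n + 1)) n k hP a b (by
      rw [← cancel_mono (((attachColimitι ν p (n + 1)).app k).f (n - 1)), assoc, ← ι.comm, ← assoc,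
        ha, zero_comp]) (by
      rw [← hab, assoc]
      exact congrArg (a ≫ ·) (hπ (n + 1) n).symm)
    let ι' := (attachColimitι ν p (n + 2)).app k
    refine ⟨c ≫ ι'.f (n + 1), ?_, ?_⟩
    · rw [assoc, ι'.comm]
      refine (assoc _ _ _).symm.trans ((congrArg (· ≫ ι'.f n) hc).trans ((assoc _ _ _).trans ?_))
      exact congrArg (fun φ : _ ⟶ attachColimit ν p ↦ a ≫ (φ.app k).f n)
        (toAttach_attachColimitι ν p (n + 1))
    · rw [assoc]
      exact (congrArg (c ≫ ·) (hπ (n + 2) (n + 1))).trans hc'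

/-- The inclusion of the given complex is a relative cell complex. -/
def attachColimitιTransfiniteComposition (hF : ∀ X, Proj (F.obj X)) (p : Over B) (k : K) :
    (MorphismProperty.pushouts (chainI Proj)).TransfiniteCompositionOfShape ℕ
      ((attachColimitι ν p 0).app k) where
  F := attachDiagram ν p ⋙ (evaluation K (ChainComplex C ℕ)).obj k
  isoBot := Iso.refl _
  incl := Functor.whiskerRight (colimit.cocone (attachDiagram ν p)).ι
    ((evaluation K (ChainComplex C ℕ)).obj k)
  isColimit := isColimitOfPreserves ((evaluation K (ChainComplex C ℕ)).obj k)
    (colimit.isColimit (attachDiagram ν p))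
  fac := id_comp _
  map_mem n _ := by
    have := toAttach_mem ν hF (attachSeq ν p n) n k
    rw [← attachDiagram_map] at this
    exact this

end Attach

/-! ### The factorization into relative cell complexes followed by trivial fibrations -/

section CofTrivFib

variable {C : Type u} [Category.{v} C] [Preadditive C] [HasZeroObject C] [HasLimits C]
  [HasColimits C] (Proj : ObjectProperty C)

/-- The relative cell complexes built from the generating cofibrations. -/
def chainCell : MorphismProperty (ChainComplex C ℕ) :=
  MorphismProperty.transfiniteCompositions.{v} (MorphismProperty.pushouts (chainI Proj))

lemma chainCell_le_chainCof : chainCell Proj ≤ chainCof Proj := by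
  refine (MorphismProperty.transfiniteCompositions_monotone
    (MorphismProperty.pushouts_le_llp_rlp _)).trans ?_
  exact MorphismProperty.transfiniteCompositions_le _

variable {Proj}

/-- The functorial factorization of maps of complexes into relative cell complexes followed by
trivial fibrations. -/
def cellTrivFibData {F : C ⥤ C} {ν : F ⟶ 𝟭 C}
    (h : ∀ X, Proj (F.obj X) ∧ projSplit Proj (ν.app X)) :
    MorphismProperty.FunctorialFactorizationData (chainCell Proj)
      (MorphismProperty.rlp (chainI Proj)) where
  Z := attachColimit ν (Over.mk Arrow.leftToRight)
  i := attachColimitι ν (Over.mk Arrow.leftToRight) 0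
  p := attachColimitπ ν (Over.mk Arrow.leftToRight)
  fac := attachColimitι_π ν (Over.mk Arrow.leftToRight) 0
  hi f := by
    have := attachColimitιTransfiniteComposition ν (fun X ↦ (h X).1) (Over.mk Arrow.leftToRight) f
    -- Transfinite compositions are indexed by well-orders in `Type v`, so `ℕ` is replaced by its
    -- lift.
    let _ : SuccOrder (ULift.{v} ℕ) := SuccOrder.ofOrderIso ULift.orderIso.symm
    exact MorphismProperty.transfiniteCompositionsOfShape_le_transfiniteCompositions _ (ULift.{v} ℕ) _
      ⟨MorphismProperty.TransfiniteCompositionOfShape.ofOrderIso this ULift.orderIso⟩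
  hp f := rlp_chainI_attachColimitπ ν (fun X ↦ (h X).2) _ f

end CofTrivFib

/-! ### The model structure on complexes -/

section

variable {C : Type u} [Category.{v} C] [Preadditive C]

/-- The enriched hom from `A` as a functor. -/
def homComplexFunctor (A : ChainComplex C ℕ) :
    ChainComplex C ℕ ⥤ ChainComplex AddCommGrpCat.{v} ℕ where
  obj B := homComplex A B
  map f := homComplexMap A f
  map_id B := by
    ext n φ
    cases n with
    | zero => exact comp_id (X := A) φ
    | succ n => exact HomTot.ext fun p q h ↦ comp_id _
  map_comp f g := by
    ext n φ
    cases n with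
    | zero => exact (assoc (W := A) φ f g).symm
    | succ n => exact HomTot.ext fun p q h ↦ (assoc _ _ _).symm

end

section

variable {C : Type u} [Category.{v} C] [Preadditive C] [HasZeroObject C] (Proj : ObjectProperty C)

instance : (chainW Proj).HasTwoOutOfThreeProperty where
  comp_mem f g hf hg P hP := MorphismProperty.comp_mem
    ((HomologicalComplex.quasiIso AddCommGrpCat.{v} (ComplexShape.down ℕ)).inverseImage
      (homComplexFunctor (sphere 0 P))) f g (hf P hP) (hg P hP)
  of_postcomp f g hg hfg P hP := MorphismProperty.of_postcomp
    (W := (HomologicalComplex.quasiIso AddCommGrpCat.{v} (ComplexShape.down ℕ)).inverseImage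
      (homComplexFunctor (sphere 0 P)))
    (W' := (HomologicalComplex.quasiIso AddCommGrpCat.{v} (ComplexShape.down ℕ)).inverseImage
      (homComplexFunctor (sphere 0 P))) f g (hg P hP) (hfg P hP)
  of_precomp f g hf hfg P hP := MorphismProperty.of_precomp
    (W := (HomologicalComplex.quasiIso AddCommGrpCat.{v} (ComplexShape.down ℕ)).inverseImage
      (homComplexFunctor (sphere 0 P)))
    (W' := (HomologicalComplex.quasiIso AddCommGrpCat.{v} (ComplexShape.down ℕ)).inverseImage
      (homComplexFunctor (sphere 0 P))) f g (hf P hP) (hfg P hP)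

instance : (chainW Proj).IsStableUnderRetracts where
  of_retract h hg P hP := MorphismProperty.of_retract (P :=
    ((HomologicalComplex.quasiIso AddCommGrpCat.{v} (ComplexShape.down ℕ)).inverseImage
      (homComplexFunctor (sphere 0 P)))) h (hg P hP)

lemma chainFib_terminal [HasTerminal (ChainComplex C ℕ)] (A : ChainComplex C ℕ) :
    chainFib Proj (terminal.from A) := by
  refine (chainFib_iff _ _).2 fun n P _ b ↦ ⟨0, ?_⟩
  have h : IsZero (⊤_ (ChainComplex C ℕ)) :=
    (isZero_zero (ChainComplex C ℕ)).of_iso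
      (terminalIsTerminal.uniqueUpToIso (isZero_zero (ChainComplex C ℕ)).isTerminal)
  exact ((HomologicalComplex.eval C _ (n + 1)).map_isZero h).eq_of_tgt _ _

variable [HasLimits C] [HasColimits C] [HasBinaryBiproducts C]

-- Retract argument: a trivial cofibration lifts against the second factor `d.p`, which is a trivial
-- fibration by two-out-of-three, and is thus a retract of `d.i`. The same retract, with `d.p` just
-- a fibration, gives the reverse inclusion.
variable {Proj} in
lemma chainCof_inf_chainW (hproj : HasEnoughFunctorialProjectives Proj) :
    chainCof Proj ⊓ chainW Proj = (chainFib Proj).llp := by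
  obtain ⟨F, ν, h⟩ := hproj
  have hle : (chainFib Proj).llp ≤ chainCof Proj :=
    MorphismProperty.antitone_llp (by rw [rlp_chainI_eq]; exact inf_le_left)
  ext A B f
  let d := (trivCofFibData h).factorizationData f
  constructor
  · rintro ⟨hf, hw⟩
    have hp : chainW Proj d.p :=
      MorphismProperty.of_precomp _ d.i d.p d.hi.2 (by rwa [d.fac])
    have : HasLiftingProperty f d.p := hf _ (by rw [rlp_chainI_eq]; exact ⟨d.hp, hp⟩)
    exact MorphismProperty.of_retract (RetractArrow.ofLeftLiftingProperty d.fac) d.hi.1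
  · intro hf
    have : HasLiftingProperty f d.p := hf _ d.hp
    exact ⟨hle _ hf, MorphismProperty.of_retract (RetractArrow.ofLeftLiftingProperty d.fac) d.hi.2⟩

variable {Proj} in
theorem isModelCategory_chain (hproj : HasEnoughFunctorialProjectives Proj) :
    IsModelCategory.{v} (chainW Proj) (chainCof Proj) (chainFib Proj) := by
  have h := chainCof_inf_chainW hproj
  have h₁ : MorphismProperty.HasFunctorialFactorization (chainCof Proj)
      (chainFib Proj ⊓ chainW Proj) := by
    obtain ⟨F, ν, h⟩ := hproj
    exact ⟨⟨(cellTrivFibData h).ofLE (chainCell_le_chainCof Proj) (rlp_chainI_eq).le⟩⟩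
  have h₂ : MorphismProperty.HasFunctorialFactorization (chainCof Proj ⊓ chainW Proj)
      (chainFib Proj) := by
    rw [h]
    obtain ⟨F, ν, h⟩ := hproj
    exact ⟨⟨(trivCofFibData h).ofLE inf_le_left le_rfl⟩⟩
  refine ⟨⟨fun J _ ↦ inferInstance⟩, ⟨fun J _ ↦ inferInstance⟩, ?_, h₁, h₂⟩
  let _ : CategoryWithFibrations (ChainComplex C ℕ) := ⟨chainFib Proj⟩
  let _ : CategoryWithCofibrations (ChainComplex C ℕ) := ⟨chainCof Proj⟩
  let _ : CategoryWithWeakEquivalences (ChainComplex C ℕ) := ⟨chainW Proj⟩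
  have i₁ : (weakEquivalences (ChainComplex C ℕ)).HasTwoOutOfThreeProperty :=
    inferInstanceAs (chainW Proj).HasTwoOutOfThreeProperty
  have i₂ : MorphismProperty.IsWeakFactorizationSystem (cofibrations (ChainComplex C ℕ))
      (trivialFibrations (ChainComplex C ℕ)) :=
    { rlp := (MorphismProperty.rlp_llp_rlp _).trans (rlp_chainI_eq)
      llp := congrArg MorphismProperty.llp (rlp_chainI_eq).symm
      hasFactorization := inferInstanceAs
        (MorphismProperty.HasFactorization (chainCof Proj) (chainFib Proj ⊓ chainW Proj)) }
  have i₃ : MorphismProperty.IsWeakFactorizationSystem (trivialCofibrations (ChainComplex C ℕ))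
      (fibrations (ChainComplex C ℕ)) :=
    { rlp := (congrArg MorphismProperty.rlp h).trans (MorphismProperty.rlp_llp_rlp _)
      llp := h.symm
      hasFactorization := inferInstanceAs
        (MorphismProperty.HasFactorization (chainCof Proj ⊓ chainW Proj) (chainFib Proj)) }
  exact ⟨ModelCategory.mk' _, rfl, rfl, rfl⟩

end

/-! ### Transport along an equivalence of categories -/

section Transport

variable {D : Type u} [Category.{v} D] {E : Type u'} [Category.{v} E]

lemma unit_map_map_unitInv (e : E ≌ D) {X Y : E} {Z : D} (i : e.functor.obj X ⟶ Z)
    (p : Z ⟶ e.functor.obj Y) (f : X ⟶ Y) (h : i ≫ p = e.functor.map f) :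
    (e.unit.app X ≫ e.inverse.map i) ≫ e.inverse.map p ≫ e.unitInv.app Y = f := by
  rw [assoc, ← e.inverse.map_comp_assoc, h]
  exact (e.unit.naturality_assoc f _).symm.trans (by simp)

lemma functor_map_unit_map (e : E ≌ D) {X : E} {Z : D} (i : e.functor.obj X ⟶ Z) :
    e.functor.map (e.unit.app X ≫ e.inverse.map i) = i ≫ e.counitInv.app Z := by
  simp

lemma functor_map_map_unitInv (e : E ≌ D) {Y : E} {Z : D} (p : Z ⟶ e.functor.obj Y) :
    e.functor.map (e.inverse.map p ≫ e.unitInv.app Y) = e.counit.app Z ≫ p := by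
  simp

/-- The transport of a functorial factorization along an equivalence of categories. -/
def functorialFactorizationDataOfEquivalence (e : E ≌ D) {W₁ W₂ : MorphismProperty D}
    [W₁.RespectsIso] [W₂.RespectsIso] (d : MorphismProperty.FunctorialFactorizationData W₁ W₂) :
    MorphismProperty.FunctorialFactorizationData (W₁.inverseImage e.functor)
      (W₂.inverseImage e.functor) where
  Z := e.functor.mapArrow ⋙ d.Z ⋙ e.inverse
  i := Functor.whiskerLeft Arrow.leftFunc e.unit ≫
    (Functor.whiskerLeft e.functor.mapArrow (Functor.whiskerRight d.i e.inverse) :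
      Arrow.leftFunc ⋙ e.functor ⋙ e.inverse ⟶ _)
  p := (Functor.whiskerLeft e.functor.mapArrow (Functor.whiskerRight d.p e.inverse) :
      _ ⟶ Arrow.rightFunc ⋙ e.functor ⋙ e.inverse) ≫
    Functor.whiskerLeft Arrow.rightFunc e.unitInv
  fac := by
    ext f : 2
    exact unit_map_map_unitInv e _ _ f.hom (d.fac_app (f := e.functor.mapArrow.obj f))
  hi f := by
    have := (W₁.cancel_right_of_respectsIso _ (e.counitInv.app _)).2
      (d.hi (e.functor.mapArrow.obj f))
    exact (congrArg _ (functor_map_unit_map e (d.i.app (e.functor.mapArrow.obj f)))).mpr this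
  hp f := by
    have := (W₂.cancel_left_of_respectsIso (e.counit.app _) _).2
      (d.hp (e.functor.mapArrow.obj f))
    exact (congrArg _ (functor_map_map_unitInv e (d.p.app (e.functor.mapArrow.obj f)))).mpr this

theorem IsModelCategory.of_equivalence {W Cof Fib : MorphismProperty D}
    (h : IsModelCategory.{w} W Cof Fib) (e : E ≌ D) {W' Cof' Fib' : MorphismProperty E}
    (hW : W' = W.inverseImage e.functor) (hCof : Cof' = Cof.inverseImage e.functor)
    (hFib : Fib' = Fib.inverseImage e.functor) : IsModelCategory.{w} W' Cof' Fib' := by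
  obtain ⟨h₁, h₂, ⟨M, rfl, rfl, rfl⟩, ⟨⟨h₃⟩⟩, ⟨⟨h₄⟩⟩⟩ := h
  refine ⟨⟨fun J _ ↦ Adjunction.hasLimitsOfShape_of_equivalence e.functor⟩,
    ⟨fun J _ ↦ Adjunction.hasColimitsOfShape_of_equivalence e.functor⟩, ?_, ?_, ?_⟩
  · let _ : CategoryWithFibrations E := ⟨Fib'⟩
    let _ : CategoryWithCofibrations E := ⟨Cof'⟩
    let _ : CategoryWithWeakEquivalences E := ⟨W'⟩
    exact ⟨ModelCategory.transport e hCof hFib hW, rfl, rfl, rfl⟩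
  · subst hW hCof hFib
    exact ⟨⟨functorialFactorizationDataOfEquivalence (W₁ := cofibrations D)
      (W₂ := trivialFibrations D) e h₃⟩⟩
  · subst hW hCof hFib
    exact ⟨⟨functorialFactorizationDataOfEquivalence (W₁ := trivialCofibrations D)
      (W₂ := fibrations D) e h₄⟩⟩

end Transport

/-! ### Elements of the normalized complex -/

section Normalized

open AlgebraicTopology AlgebraicTopology.DoldKan Idempotents Simplicial Opposite

variable {C : Type u} [Category.{v} C] [Preadditive C] [IsIdempotentComplete C]
  [HasFiniteCoproducts C]

/-- The normalized complex, as a direct factor of the alternating face map complex. -/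
def normalizedIso : Idempotents.DoldKan.N ⋙ toKaroubi (ChainComplex C ℕ) ≅ N₁ :=
  Functor.isoWhiskerLeft N₁ (toKaroubiEquivalence (ChainComplex C ℕ)).counitIso ≪≫
    N₁.rightUnitor

variable (X : SimplicialObject C) {Y : SimplicialObject C}

/-- The inclusion of the normalized complex in the alternating face map complex. -/
def normInc : Idempotents.DoldKan.N.obj X ⟶ (alternatingFaceMapComplex C).obj X :=
  (normalizedIso.hom.app X).f

/-- The projection of the alternating face map complex to the normalized complex. -/
def normProj : (alternatingFaceMapComplex C).obj X ⟶ Idempotents.DoldKan.N.obj X :=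
  (normalizedIso.inv.app X).f

lemma normInc_normProj : normInc X ≫ normProj X = 𝟙 _ :=
  congrArg Karoubi.Hom.f (normalizedIso.hom_inv_id_app X)

lemma normProj_normInc : normProj X ≫ normInc X = PInfty :=
  congrArg Karoubi.Hom.f (normalizedIso.inv_hom_id_app X)

lemma normInc_PInfty : normInc X ≫ PInfty = normInc X :=
  Karoubi.comp_p (normalizedIso.hom.app X)

lemma PInfty_normProj : PInfty ≫ normProj X = normProj X :=
  Karoubi.p_comp (normalizedIso.inv.app X)

lemma normInc_naturality {X} (f : X ⟶ Y) :
    normInc X ≫ (alternatingFaceMapComplex C).map f =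
      Idempotents.DoldKan.N.map f ≫ normInc Y := by
  have h : Idempotents.DoldKan.N.map f ≫ normInc Y =
      normInc X ≫ PInfty ≫ (alternatingFaceMapComplex C).map f :=
    congrArg Karoubi.Hom.f (normalizedIso.hom.naturality f)
  rw [h, ← assoc, normInc_PInfty]

lemma normProj_naturality {X} (f : X ⟶ Y) :
    normProj X ≫ Idempotents.DoldKan.N.map f =
      (alternatingFaceMapComplex C).map f ≫ normProj Y := by
  have h : (normProj X ≫ Idempotents.DoldKan.N.map f) =
      (PInfty ≫ (alternatingFaceMapComplex C).map f) ≫ normProj Y :=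
    congrArg Karoubi.Hom.f (normalizedIso.inv.naturality f).symm
  rw [h]
  ext n
  simp only [HomologicalComplex.comp_f]
  refine (congrArg (· ≫ (normProj Y).f n) (PInfty_f_naturality n f).symm).trans ?_
  rw [assoc, ← HomologicalComplex.comp_f, PInfty_normProj]
  rfl

variable {X} {P : C}

/-- The projector `PInfty` has image in the kernel of all faces of positive index. The zeroth face
survives and gives the differential (`normInc_d`). -/
lemma normInc_δ (n : ℕ) (i : Fin (n + 1)) :
    (normInc X).f (n + 1) ≫ X.δ i.succ = 0 := by
  rw [← normInc_PInfty, HomologicalComplex.comp_f, assoc, PInfty_f]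
  exact (congrArg _ (HigherFacesVanish.of_P (n + 1) n i (by omega))).trans comp_zero

/-- Simplices with vanishing higher faces are fixed by `PInfty`. Together with `normInc_δ` this
identifies `Hom(P, N_{n+1})` with such simplices, as in the Moore complex. -/
lemma comp_normProj_normInc {n : ℕ} (x : P ⟶ X _⦋n + 1⦌)
    (hx : ∀ i : Fin (n + 1), x ≫ X.δ i.succ = 0) :
    (x ≫ (normProj X).f (n + 1)) ≫ (normInc X).f (n + 1) = x := by
  rw [assoc, ← HomologicalComplex.comp_f, normProj_normInc, PInfty_f]
  exact HigherFacesVanish.comp_P_eq_self (fun j _ ↦ hx j)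

lemma comp_normProj_normInc_zero (x : P ⟶ X _⦋0⦌) :
    (x ≫ (normProj X).f 0) ≫ (normInc X).f 0 = x := by
  rw [assoc, ← HomologicalComplex.comp_f, normProj_normInc, PInfty_f_0]
  exact comp_id _

lemma comp_normInc_injective {n : ℕ} {x y : P ⟶ (Idempotents.DoldKan.N.obj X).X n}
    (h : x ≫ (normInc X).f n = y ≫ (normInc X).f n) : x = y := by
  have := h =≫ (normProj X).f n
  rwa [assoc, assoc, ← HomologicalComplex.comp_f, normInc_normProj, HomologicalComplex.id_f,
    comp_id, comp_id] at this

lemma normInc_d (n : ℕ) : (Idempotents.DoldKan.N.obj X).d (n + 1) n ≫ (normInc X).f n =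
    (normInc X).f (n + 1) ≫ X.δ 0 := by
  rw [← HomologicalComplex.Hom.comm]
  rw [alternatingFaceMapComplex_obj_d, AlternatingFaceMapComplex.objD, Preadditive.comp_sum,
    Fin.sum_univ_succ, Finset.sum_eq_zero]
  · simp
  · intro i _
    rw [Preadditive.comp_zsmul, normInc_δ, smul_zero]

end Normalized

/-! ### Simplicial sets of maps from an object, adjoint to copowers -/

section HomSSet

open Simplicial Opposite AlgebraicTopology

variable {C : Type u} [Category.{v} C]

/-- The simplicial set of maps from an object `P` to a simplicial object. -/
abbrev homSSet (P : C) : SimplicialObject C ⥤ SSet.{v} :=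
  (SimplicialObject.whiskering C (Type v)).obj (coyoneda.obj (op P))

/-- The copower functor is left adjoint to the functor `homSSet`. -/
def copowerAdj [HasCoproducts.{v} C] (P : C) : copower P ⊣ homSSet P :=
  (sigmaConstAdj P).whiskerRight _

/-- Simplices of `homSSet P X`. -/
def simplexEquiv (P : C) (X : SimplicialObject C) (n : ℕ) :
    (Δ[n] ⟶ (homSSet P).obj X) ≃ (P ⟶ X _⦋n⦌) :=
  SSet.yonedaEquiv

lemma simplexEquiv_comp (P : C) {X Y : SimplicialObject C} (n : ℕ) (x : Δ[n] ⟶ (homSSet P).obj X)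
    (f : X ⟶ Y) : simplexEquiv P Y n (x ≫ (homSSet P).map f) =
      simplexEquiv P X n x ≫ f.app (op ⦋n⦌) := rfl

lemma simplexEquiv_δ (P : C) {X : SimplicialObject C} (n : ℕ)
    (x : Δ[n + 1] ⟶ (homSSet P).obj X) (i : Fin (n + 2)) :
    simplexEquiv P X n (SSet.stdSimplex.δ i ≫ x) = simplexEquiv P X (n + 1) x ≫ X.δ i :=
  SSet.stdSimplex.yonedaEquiv_δ_comp x i

/-- The zero map to a simplicial set of maps. -/
def zeroSimplex [HasZeroMorphisms C] (K : SSet.{v}) (P : C) (X : SimplicialObject C) :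
    K ⟶ (homSSet P).obj X where
  app n := ↾fun _ ↦ (0 : P ⟶ X.obj n)
  naturality _ _ f := by
    ext x
    exact zero_comp.symm

lemma comp_zeroSimplex [HasZeroMorphisms C] {K L : SSet.{v}} (i : K ⟶ L) (P : C)
    (X : SimplicialObject C) : i ≫ zeroSimplex L P X = zeroSimplex K P X := rfl

lemma simplexEquiv_zeroSimplex [HasZeroMorphisms C] (P : C) (X : SimplicialObject C) (n : ℕ) :
    simplexEquiv P X n (zeroSimplex _ P X) = 0 := rfl

lemma zeroSimplex_comp [HasZeroMorphisms C] (K : SSet.{v}) (P : C) {X Y : SimplicialObject C}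
    (f : X ⟶ Y) : zeroSimplex K P X ≫ (homSSet P).map f = zeroSimplex K P Y := by
  ext n x
  exact zero_comp

lemma horn_hom_ext {n : ℕ} {k : Fin (n + 2)} {K : SSet.{v}} {f g : (SSet.horn (n + 1) k : SSet) ⟶ K}
    (h : ∀ (j : Fin (n + 2)) (hj : j ≠ k), SSet.horn.ι k j hj ≫ f = SSet.horn.ι k j hj ≫ g) :
    f = g := by
  refine SSet.horn.hom_ext _ _ fun j hj ↦ ?_
  have := congrArg SSet.yonedaEquiv (h j hj)
  rwa [SSet.yonedaEquiv_comp, SSet.yonedaEquiv_comp, SSet.horn.yonedaEquiv_ι] at this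

/-- The hypothesis on `y` says that it restricts to zero on the horn `Λ[n + 1, 0]`. A lift extending
the zero horn of `X` is the required simplex. -/
lemma simplicialFib_exists_lift [HasZeroMorphisms C] [HasCoproducts.{v} C]
    {Proj : ObjectProperty C} {X Y : SimplicialObject C} {f : X ⟶ Y} (hf : simplicialFib Proj f)
    {P : C} (hP : Proj P) {n : ℕ} (y : P ⟶ Y _⦋n + 1⦌)
    (hy : ∀ i : Fin (n + 1), y ≫ Y.δ i.succ = 0) :
    ∃ x : P ⟶ X _⦋n + 1⦌, (∀ i : Fin (n + 1), x ≫ X.δ i.succ = 0) ∧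
      x ≫ f.app (op ⦋n + 1⦌) = y := by
  have h := hf _ (simplicialJ.mk n 0 P hP)
  rw [(copowerAdj P).hasLiftingProperty_iff] at h
  have sq : CommSq (zeroSimplex _ P X) (SSet.horn.{v} (n + 1) 0).ι ((homSSet P).map f)
      ((simplexEquiv P Y (n + 1)).symm y) := ⟨horn_hom_ext fun j hj ↦ by
    obtain ⟨i, rfl⟩ := Fin.exists_succ_eq.2 hj
    apply (simplexEquiv P Y n).injective
    rw [SSet.horn.ι_ι_assoc, simplexEquiv_δ, Equiv.apply_symm_apply, hy,
      zeroSimplex_comp, comp_zeroSimplex, simplexEquiv_zeroSimplex]⟩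
  refine ⟨simplexEquiv P X (n + 1) sq.lift, fun i ↦ ?_, ?_⟩
  · rw [← simplexEquiv_δ, ← SSet.horn.ι_ι 0 i.succ (Fin.succ_ne_zero i), assoc, sq.fac_left,
      comp_zeroSimplex, simplexEquiv_zeroSimplex]
  · rw [← simplexEquiv_comp, sq.fac_right, Equiv.apply_symm_apply]

end HomSSet

/-! ### Normalization preserves fibrations -/

section FibDetect

open Simplicial Opposite AlgebraicTopology Idempotents

variable {C : Type u} [Category.{v} C] [Preadditive C] [IsIdempotentComplete C]
  [HasCoproducts.{v} C] [HasFiniteCoproducts C] [HasZeroObject C] {Proj : ObjectProperty C}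

lemma chainFib_N_of_simplicialFib {X Y : SimplicialObject C} {f : X ⟶ Y}
    (hf : simplicialFib Proj f) : chainFib Proj (Idempotents.DoldKan.N.map f) := by
  refine (chainFib_iff _ _).2 fun n P hP y ↦ ?_
  obtain ⟨x, hx, hxy⟩ := simplicialFib_exists_lift hf hP (y ≫ (normInc Y).f (n + 1)) (fun i ↦ by
    rw [assoc, normInc_δ, comp_zero])
  refine ⟨x ≫ (normProj X).f (n + 1), comp_normInc_injective ?_⟩
  dsimp only
  rw [assoc, ← HomologicalComplex.comp_f, ← normInc_naturality, HomologicalComplex.comp_f, ← assoc,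
    comp_normProj_normInc x hx]
  exact hxy

end FibDetect

/-! ### Copowers by inclusions of simplicial sets -/

section CopowerCof

open Simplicial Opposite AlgebraicTopology Idempotents

variable {C : Type u} [Category.{v} C] [HasCoproducts.{v} C] (Proj : ObjectProperty C)

/-- By adjunction a lift is a function on `T`: on the image of `i` it is determined, by injectivity,
and elsewhere any preimage under the split map will do. -/
lemma llp_projSplit_sigmaConst_map {P : C} (hP : Proj P) {S T : Type v} (i : S ⟶ T)
    (hi : Function.Injective i) : (projSplit Proj).llp ((sigmaConst.{v}.obj P).map i) := by
  intro A B g hg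
  rw [(sigmaConstAdj P).hasLiftingProperty_iff]
  refine ⟨fun {f b} sq ↦ ?_⟩
  choose l hl using fun t ↦ hg P hP (b t)
  have hw (s : S) : f s ≫ g = b (i s) := ConcreteCategory.congr_hom sq.w s
  classical
  refine ⟨⟨⟨↾fun t ↦ if h : ∃ s, i s = t then f h.choose else l t, ?_, ?_⟩⟩⟩
  · ext s
    have h : ∃ s', i s' = i s := ⟨s, rfl⟩
    refine (dif_pos h).trans (congrArg f (hi h.choose_spec))
  · ext t
    by_cases h : ∃ s, i s = t
    · refine (congrArg (· ≫ g) (dif_pos h)).trans ((hw _).trans (congrArg b h.choose_spec))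
    · exact (congrArg (· ≫ g) (dif_neg h)).trans (hl t)

lemma llp_projSplit_copower_map {P : C} (hP : Proj P) {K L : SSet.{v}} (i : K ⟶ L) [Mono i]
    (n : SimplexCategoryᵒᵖ) : (projSplit Proj).llp (((copower P).map i).app n) :=
  llp_projSplit_sigmaConst_map Proj hP _
    ((mono_iff_injective _).1 ((NatTrans.mono_iff_mono_app i).1 inferInstance n))

variable [Preadditive C] [IsIdempotentComplete C] [HasFiniteCoproducts C]

/-- The map on normalized complexes is a retract of the map on alternating face map complexes. -/
def normalizedRetract {X Y : SimplicialObject C} (f : X ⟶ Y) :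
    RetractArrow (Idempotents.DoldKan.N.map f) ((alternatingFaceMapComplex C).map f) where
  i := Arrow.homMk (normInc X) (normInc Y) (normInc_naturality f)
  r := Arrow.homMk (normProj X) (normProj Y) (normProj_naturality f)
  retract := by ext : 1 <;> exact normInc_normProj _

lemma llp_projSplit_N_copower_map {P : C} (hP : Proj P) {K L : SSet.{v}} (i : K ⟶ L) [Mono i]
    (n : ℕ) :
    (projSplit Proj).llp ((Idempotents.DoldKan.N.map ((copower P).map i)).f n) :=
  MorphismProperty.of_retract
    ((normalizedRetract ((copower P).map i)).map (HomologicalComplex.eval C _ n))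
    (llp_projSplit_copower_map Proj hP i (op ⦋n⦌))

end CopowerCof

/-! ### Homotopies of simplicial sets and chain homotopies -/

section Homotopies

open Simplicial Opposite AlgebraicTopology MonoidalCategory

/-- The map `Δ[n] ⊗ Δ[1] ⟶ Δ[n]` given by an order preserving map. -/
def stdSimplexHomotopy {n : ℕ} (θ : Fin (n + 1) × Fin 2 →o Fin (n + 1)) :
    (Δ[n] ⊗ Δ[1] : SSet.{v}) ⟶ Δ[n] where
  app _ := ↾fun x ↦ SSet.stdSimplex.objMk
    (θ.comp ((SSet.stdSimplex.asOrderHom x.1).prod (SSet.stdSimplex.asOrderHom x.2)))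
  naturality _ _ _ := rfl

/-- A map with values in `{x, k}` from the identity to the maximum with `k`. -/
def maxFromId {n : ℕ} (k : Fin (n + 1)) : Fin (n + 1) × Fin 2 →o Fin (n + 1) where
  toFun x := if x.2 = 0 then x.1 else max x.1 k
  monotone' := by
    rintro ⟨x, s⟩ ⟨y, t⟩ ⟨h, h'⟩
    dsimp at h h' ⊢
    fin_cases s <;> fin_cases t <;> simp at h' ⊢ <;> grind

/-- A map with values in `{x, k}` from the constant map `k` to the maximum with `k`. -/
def maxFromConst {n : ℕ} (k : Fin (n + 1)) : Fin (n + 1) × Fin 2 →o Fin (n + 1) where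
  toFun x := if x.2 = 0 then k else max x.1 k
  monotone' := by
    rintro ⟨x, s⟩ ⟨y, t⟩ ⟨h, h'⟩
    dsimp at h h' ⊢
    fin_cases s <;> fin_cases t <;> simp at h' ⊢ <;> grind

/-- The restriction of a map `Δ[n] ⊗ Δ[1] ⟶ Δ[n]` to the horn. -/
def hornHomotopy {n : ℕ} (k : Fin (n + 1)) (θ : Fin (n + 1) × Fin 2 →o Fin (n + 1))
    (hθ : ∀ x, θ x = x.1 ∨ θ x = k) :
    ((SSet.horn.{v} n k : SSet) ⊗ Δ[1] : SSet.{v}) ⟶ (SSet.horn.{v} n k : SSet) :=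
  Subfunctor.lift ((SSet.horn.{v} n k).ι ▷ Δ[1] ≫ stdSimplexHomotopy θ) (by
    rintro m _ ⟨⟨⟨x, hx⟩, t⟩, rfl⟩
    intro h
    -- A simplex lies in the horn when its vertices together with `k` are not everything, and `θ`
    -- adds no vertex other than `k`.
    refine hx (Set.eq_univ_of_univ_subset (h.symm.subset.trans ?_))
    rintro _ (⟨i, rfl⟩ | rfl)
    · obtain h | h := hθ ((SSet.stdSimplex.asOrderHom x i, SSet.stdSimplex.asOrderHom t i))
      · exact Or.inl ⟨i, h.symm⟩
      · exact Or.inr h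
    · exact Or.inr rfl)

/-- Constructor for homotopies. -/
def homotopyMk {X Y : SSet.{v}} {f g : X ⟶ Y} (h : X ⊗ Δ[1] ⟶ Y) (h₀ : SSet.ι₀ ≫ h = f)
    (h₁ : SSet.ι₁ ≫ h = g) : SSet.Homotopy f g where
  h := h
  h₀ := h₀
  h₁ := h₁
  rel := by
    ext m ⟨x, _⟩
    exact (Set.notMem_empty _ x.2).elim


/-- The contraction of the simplex to the vertex `k`, with values in the horn. -/
def toHorn {n : ℕ} (k : Fin (n + 2)) : (Δ[n + 1] : SSet.{v}) ⟶ (SSet.horn.{v} (n + 1) k : SSet) :=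
  Subfunctor.lift (SSet.const (SSet.stdSimplex.obj₀Equiv.symm k)) (by
    rintro m _ ⟨x, rfl⟩ h
    obtain ⟨j, hj⟩ := exists_ne k
    obtain ⟨_, h⟩ | h := h.symm.subset (Set.mem_univ j)
    · exact hj h.symm
    · exact hj h)

variable {C : Type u} [Category.{v} C] [HasCoproducts.{v} C] [Preadditive C]

/-- The functor sending a simplicial set to the alternating face map complex of a copower. -/
abbrev copowerChains (P : C) : SSet.{v} ⥤ ChainComplex C ℕ :=
  copower P ⋙ alternatingFaceMapComplex C

/-- Homotopies of simplicial sets induce chain homotopies. -/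
def copowerHomotopy (P : C) {K L : SSet.{v}} {f g : K ⟶ L} (h : SSet.Homotopy f g) :
    Homotopy ((copowerChains P).map f) ((copowerChains P).map g) :=
  (h.toSimplicialObjectHomotopy.whiskerRight (sigmaConst.{v}.obj P)).toChainHomotopy

lemma mem_maxFromId {n : ℕ} (k : Fin (n + 1)) (x) : maxFromId k x = x.1 ∨ maxFromId k x = k := by
  change (if x.2 = 0 then x.1 else max x.1 k) = x.1 ∨ (if x.2 = 0 then x.1 else max x.1 k) = k
  split_ifs
  exacts [Or.inl rfl, max_choice _ _]

lemma mem_maxFromConst {n : ℕ} (k : Fin (n + 1)) (x) :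
    maxFromConst k x = x.1 ∨ maxFromConst k x = k := by
  change (if x.2 = 0 then k else max x.1 k) = x.1 ∨ (if x.2 = 0 then k else max x.1 k) = k
  split_ifs
  exacts [Or.inr rfl, max_choice _ _]

/-- The identity and the constant map `k` are in general not comparable, but both lie below `max(-,
k)`. The contraction is therefore a zigzag through this common end, with one leg reversed after
passing to chain homotopies. -/
lemma ι₁_maxFromConst {n : ℕ} (k : Fin (n + 1)) :
    SSet.ι₁ ≫ stdSimplexHomotopy.{v} (maxFromConst k) =
      SSet.ι₁ ≫ stdSimplexHomotopy (maxFromId k) := by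
  ext m x
  rfl

lemma ι₀_maxFromId {n : ℕ} (k : Fin (n + 1)) :
    SSet.ι₀ ≫ stdSimplexHomotopy.{v} (maxFromId k) = 𝟙 _ := by
  ext m x
  induction m using Opposite.rec with | op m
  induction m using SimplexCategory.rec with | mk m
  exact SSet.stdSimplex.ext _ _ fun i ↦ rfl

lemma ι₀_maxFromConst {n : ℕ} (k : Fin (n + 2)) :
    SSet.ι₀ ≫ stdSimplexHomotopy.{v} (maxFromConst k) =
      toHorn k ≫ (SSet.horn.{v} (n + 1) k).ι := by
  ext m x
  rfl

lemma ι₀_hornHomotopy_ι {n : ℕ} (k : Fin (n + 1)) (θ : Fin (n + 1) × Fin 2 →o Fin (n + 1))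
    (hθ : ∀ x, θ x = x.1 ∨ θ x = k) :
    (SSet.ι₀ ≫ hornHomotopy.{v} k θ hθ) ≫ (SSet.horn.{v} n k).ι =
      (SSet.horn.{v} n k).ι ≫ SSet.ι₀ ≫ stdSimplexHomotopy θ := rfl

lemma ι₁_hornHomotopy_ι {n : ℕ} (k : Fin (n + 1)) (θ : Fin (n + 1) × Fin 2 →o Fin (n + 1))
    (hθ : ∀ x, θ x = x.1 ∨ θ x = k) :
    (SSet.ι₁ ≫ hornHomotopy.{v} k θ hθ) ≫ (SSet.horn.{v} n k).ι =
      (SSet.horn.{v} n k).ι ≫ SSet.ι₁ ≫ stdSimplexHomotopy θ := rfl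

/-- The contraction of a simplex to its vertex `k` is homotopic to the identity. -/
def stdSimplexContraction (P : C) {n : ℕ} (k : Fin (n + 2)) :
    Homotopy ((copowerChains P).map (toHorn k ≫ (SSet.horn.{v} (n + 1) k).ι))
      ((copowerChains P).map (𝟙 _)) :=
  (copowerHomotopy P (homotopyMk (stdSimplexHomotopy (maxFromConst k)) (ι₀_maxFromConst k)
    (ι₁_maxFromConst k))).trans
  (copowerHomotopy P (homotopyMk (stdSimplexHomotopy (maxFromId k)) (ι₀_maxFromId k) rfl)).symm

/-- The contraction of a horn to its vertex `k` is homotopic to the identity. -/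
def hornContraction (P : C) {n : ℕ} (k : Fin (n + 2)) :
    Homotopy ((copowerChains P).map ((SSet.horn.{v} (n + 1) k).ι ≫ toHorn k))
      ((copowerChains P).map (𝟙 _)) :=
  (copowerHomotopy P (homotopyMk (hornHomotopy k (maxFromConst k) (mem_maxFromConst k))
    (by rw [← cancel_mono (SSet.horn.{v} (n + 1) k).ι, ι₀_hornHomotopy_ι, ι₀_maxFromConst, assoc])
    (by rw [← cancel_mono (SSet.horn.{v} (n + 1) k).ι, ι₁_hornHomotopy_ι, ι₁_maxFromConst,
      ι₁_hornHomotopy_ι k _ (mem_maxFromId k)]))).trans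
  (copowerHomotopy P (homotopyMk (hornHomotopy k (maxFromId k) (mem_maxFromId k))
    (by rw [← cancel_mono (SSet.horn.{v} (n + 1) k).ι, ι₀_hornHomotopy_ι, ι₀_maxFromId, comp_id,
      id_comp]) rfl)).symm

/-- The alternating face map complexes of the copowers of a horn and of a simplex are
homotopy equivalent. -/
def hornHomotopyEquiv (P : C) {n : ℕ} (k : Fin (n + 2)) :
    HomotopyEquiv ((copowerChains P).obj (SSet.horn.{v} (n + 1) k : SSet))
      ((copowerChains P).obj Δ[n + 1]) where
  hom := (copowerChains P).map (SSet.horn.{v} (n + 1) k).ι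
  inv := (copowerChains P).map (toHorn k)
  homotopyHomInvId := (Homotopy.ofEq ((copowerChains P).map_comp _ _).symm).trans
    ((hornContraction P k).trans (Homotopy.ofEq ((copowerChains P).map_id _)))
  homotopyInvHomId := (Homotopy.ofEq ((copowerChains P).map_comp _ _).symm).trans
    ((stdSimplexContraction P k).trans (Homotopy.ofEq ((copowerChains P).map_id _)))

lemma exists_comp_d_eq_sub {A B : ChainComplex C ℕ} {f g : A ⟶ B} (h : Homotopy f g) {P : C}
    {n : ℕ} (y : P ⟶ A.X n) (hy : y ≫ A.d n (n - 1) = 0) :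
    ∃ w : P ⟶ B.X (n + 1), w ≫ B.d (n + 1) n = y ≫ f.f n - y ≫ g.f n := by
  refine ⟨y ≫ h.hom n (n + 1), ?_⟩
  rw [h.comm n, dNext_nat, prevD_eq h.hom (show (ComplexShape.down ℕ).Rel (n + 1) n from rfl),
    Preadditive.comp_add, Preadditive.comp_add, ← assoc y, hy, zero_comp, zero_add,
    add_sub_cancel_right, assoc]

lemma chainW_of_homotopyEquiv [HasZeroObject C] (Proj : ObjectProperty C) {A B : ChainComplex C ℕ}
    (e : HomotopyEquiv A B) : chainW Proj e.hom := by
  refine (chainW_iff Proj _).2 fun P hP n ↦ ⟨fun y hy ↦ ⟨y ≫ e.inv.f n, ?_, ?_⟩, fun x hx w hw ↦ ?_⟩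
  · rw [assoc, e.inv.comm, ← assoc, hy, zero_comp]
  · obtain ⟨w, hw⟩ := exists_comp_d_eq_sub e.homotopyInvHomId.symm y hy
    refine ⟨w, hw.trans ?_⟩
    simp
  · obtain ⟨v, hv⟩ := exists_comp_d_eq_sub e.homotopyHomInvId.symm x hx
    refine ⟨v + w ≫ e.inv.f (n + 1), ?_⟩
    rw [Preadditive.add_comp, hv, assoc, e.inv.comm, ← assoc, hw]
    simp

end Homotopies

/-! ### Normalized horn inclusions are trivial cofibrations; recognition of simplicial fibrations -/

section HornEquivalences

open Simplicial Opposite AlgebraicTopology Idempotents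

variable {C : Type u} [Category.{v} C] [HasCoproducts.{v} C] [Preadditive C] [HasZeroObject C]
  [HasFiniteCoproducts C] [HasBinaryBiproducts C] [HasLimits C] [HasColimits C]
  [IsIdempotentComplete C]
  {Proj : ObjectProperty C}

lemma chainW_N_of_simplicialJ {X Y : SimplicialObject C} {f : X ⟶ Y} (hf : simplicialJ Proj f) :
    chainW Proj (Idempotents.DoldKan.N.map f) := by
  obtain ⟨n, k, P, hP⟩ := hf
  exact MorphismProperty.of_retract (normalizedRetract _)
    (chainW_of_homotopyEquiv Proj (hornHomotopyEquiv P k))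

lemma chainCof_N_copower_map [Proj.IsStableUnderRetracts]
    (hproj : HasEnoughFunctorialProjectives Proj) {P : C} (hP : Proj P) {K L : SSet.{v}}
    (i : K ⟶ L) [Mono i] : chainCof Proj (Idempotents.DoldKan.N.map ((copower P).map i)) :=
  (chainCof_iff_llp hproj _).2 (llp_projSplit_N_copower_map Proj hP i)

lemma hasLiftingProperty_of_N {X Y A B : SimplicialObject C} (f : X ⟶ Y) (g : A ⟶ B)
    [HasLiftingProperty (Idempotents.DoldKan.N.map f) (Idempotents.DoldKan.N.map g)] :
    HasLiftingProperty f g where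
  sq_hasLift {a b} sq := by
    let N : SimplicialObject C ⥤ ChainComplex C ℕ := Idempotents.DoldKan.N
    have : N.IsEquivalence := inferInstanceAs
      (Idempotents.DoldKan.equivalence : SimplicialObject C ≌ _).functor.IsEquivalence
    have sq' : CommSq (N.map a) (N.map f) (N.map g) (N.map b) := sq.map N
    exact ⟨⟨⟨N.preimage sq'.lift, N.map_injective (by simp), N.map_injective (by simp)⟩⟩⟩

variable [Proj.IsStableUnderRetracts]

/-- For the converse, `N` sends horn inclusions to trivial cofibrations of complexes, which lift
against `N(f)`; the lift descends since `N` is fully faithful. -/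
lemma simplicialFib_iff_N (hproj : HasEnoughFunctorialProjectives Proj) {X Y : SimplicialObject C}
    {f : X ⟶ Y} : simplicialFib Proj f ↔ chainFib Proj (Idempotents.DoldKan.N.map f) := by
  refine ⟨chainFib_N_of_simplicialFib, fun hf A B i hi ↦ ?_⟩
  have hi' : (chainFib Proj).llp (Idempotents.DoldKan.N.map i) := by
    rw [← chainCof_inf_chainW hproj]
    refine ⟨?_, chainW_N_of_simplicialJ hi⟩
    obtain ⟨n, k, P, hP⟩ := hi
    exact chainCof_N_copower_map hproj hP _
  have := hi' _ hf
  exact hasLiftingProperty_of_N _ _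

lemma rlp_simplicialI_of_N (hproj : HasEnoughFunctorialProjectives Proj) {X Y : SimplicialObject C}
    {f : X ⟶ Y} (hf : (chainFib Proj ⊓ chainW Proj) (Idempotents.DoldKan.N.map f))
    {P : C} (hP : Proj P) {K L : SSet.{v}} (i : K ⟶ L) [Mono i] :
    HasLiftingProperty ((copower P).map i) f := by
  have := chainCof_N_copower_map hproj hP i _ (by rwa [rlp_chainI_eq])
  exact hasLiftingProperty_of_N _ _

end HornEquivalences

/-! ### Attaching disks as attaching simplices -/

section BoundaryLift

open Simplicial Opposite

lemma exists_boundary_ι {n : ℕ} {m : SimplexCategoryᵒᵖ} (x : (SSet.boundary.{v} (n + 1) : SSet).obj m) :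
    ∃ (i : Fin (n + 2)) (y : (Δ[n] : SSet.{v}).obj m), (SSet.boundary.ι i).app m y = x := by
  obtain ⟨x, hx⟩ := x
  simp only [SSet.boundary_eq_iSup, SSet.stdSimplex.face_singleton_compl, Subfunctor.iSup_obj,
    Set.mem_iUnion] at hx
  obtain ⟨i, ⟨y, rfl⟩⟩ := hx
  exact ⟨i, SSet.stdSimplex.objEquiv.symm y.unop, rfl⟩

/-- Because `M` is a monomorphism, lifts of single simplices are unique, hence automatically
compatible; it is enough to factor each face. -/
lemma exists_boundary_lift {K L : SSet.{v}} (M : K ⟶ L) [Mono M] {n : ℕ} (t : Δ[n + 1] ⟶ L)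
    (h : ∀ i, ∃ b : Δ[n] ⟶ K, b ≫ M = SSet.stdSimplex.δ i ≫ t) :
    ∃ b : (SSet.boundary.{v} (n + 1) : SSet) ⟶ K, b ≫ M = (SSet.boundary.{v} (n + 1)).ι ≫ t := by
  have hM (m) : Function.Injective (M.app m) :=
    (mono_iff_injective _).1 ((NatTrans.mono_iff_mono_app M).1 inferInstance m)
  have h' (m) (x : (SSet.boundary.{v} (n + 1) : SSet).obj m) :
      ∃ k : K.obj m, M.app m k = ((SSet.boundary.{v} (n + 1)).ι ≫ t).app m x := by
    obtain ⟨i, y, rfl⟩ := exists_boundary_ι x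
    obtain ⟨b, hb⟩ := h i
    exact ⟨b.app m y, ConcreteCategory.congr_hom (NatTrans.congr_app hb m) y⟩
  choose b hb using h'
  refine ⟨{ app m := ↾(b m), naturality m m' f := ?_ }, ?_⟩
  · ext x
    apply hM
    refine (hb _ _).trans (Eq.trans ?_ (NatTrans.naturality_apply M f _).symm)
    refine Eq.trans ?_ (congrArg (L.map f) (hb _ _)).symm
    exact NatTrans.naturality_apply ((SSet.boundary.{v} (n + 1)).ι ≫ t) f x
  · ext m x
    exact hb m x

end BoundaryLift

/-! ### `Γ` of spheres and disks, and recognition of simplicial cofibrations -/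

section GammaDisk

open Simplicial Opposite AlgebraicTopology Idempotents

variable {C : Type u} [Category.{v} C] [Preadditive C] [HasZeroObject C]
  [HasFiniteCoproducts C] [IsIdempotentComplete C]

/-- The functor `Γ` is left adjoint to the normalized complex functor. -/
def gammaAdj : (Idempotents.DoldKan.Γ : ChainComplex C ℕ ⥤ SimplicialObject C) ⊣
    Idempotents.DoldKan.N :=
  (Idempotents.DoldKan.equivalence (C := C)).symm.toAdjunction

/-- Maps from the simplicial object corresponding to a disk. -/
def gammaDiskEquiv (n : ℕ) (P : C) (X : SimplicialObject C) :
    (Idempotents.DoldKan.Γ.obj (disk n P) ⟶ X) ≃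
      {y : P ⟶ X _⦋n + 1⦌ // ∀ i : Fin (n + 1), y ≫ X.δ i.succ = 0} :=
  ((gammaAdj.homEquiv _ _).trans (diskEquiv n P _)).trans
    { toFun x := ⟨x ≫ (normInc X).f (n + 1), fun i ↦ by rw [assoc, normInc_δ, comp_zero]⟩
      invFun y := y.1 ≫ (normProj X).f (n + 1)
      left_inv x := comp_normInc_injective (comp_normProj_normInc _ fun i ↦ by
        rw [assoc, normInc_δ, comp_zero])
      right_inv y := Subtype.ext (comp_normProj_normInc _ y.2) }

lemma gammaDiskEquiv_comp (n : ℕ) (P : C) {X Y : SimplicialObject C}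
    (φ : Idempotents.DoldKan.Γ.obj (disk n P) ⟶ X) (f : X ⟶ Y) :
    (gammaDiskEquiv n P Y (φ ≫ f)).1 = (gammaDiskEquiv n P X φ).1 ≫ f.app (op ⦋n + 1⦌) := by
  change diskEquiv n P _ (gammaAdj.homEquiv _ _ (φ ≫ f)) ≫ (normInc Y).f (n + 1) =
    (diskEquiv n P _ (gammaAdj.homEquiv _ _ φ) ≫ (normInc X).f (n + 1)) ≫
      ((alternatingFaceMapComplex C).map f).f (n + 1)
  rw [Adjunction.homEquiv_naturality_right, diskEquiv_comp, assoc, assoc,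
    ← HomologicalComplex.comp_f, ← HomologicalComplex.comp_f, normInc_naturality]

/-- The simplex corresponding to a map from the simplicial object corresponding to a sphere. -/
def gammaSphere (n : ℕ) (P : C) (X : SimplicialObject C)
    (φ : Idempotents.DoldKan.Γ.obj (sphere n P) ⟶ X) : P ⟶ X _⦋n⦌ :=
  (sphereEquiv n P _ (gammaAdj.homEquiv _ _ φ)).1 ≫ (normInc X).f n

lemma gammaSphere_injective (n : ℕ) (P : C) (X : SimplicialObject C) :
    Function.Injective (gammaSphere n P X) := fun _ _ h ↦
  (gammaAdj.homEquiv _ _).injective ((sphereEquiv n P _).injective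
    (Subtype.ext (comp_normInc_injective h)))

lemma gammaSphere_comp (n : ℕ) (P : C) {X Y : SimplicialObject C}
    (φ : Idempotents.DoldKan.Γ.obj (sphere n P) ⟶ X) (f : X ⟶ Y) :
    gammaSphere n P Y (φ ≫ f) = gammaSphere n P X φ ≫ f.app (op ⦋n⦌) := by
  change (sphereEquiv n P _ (gammaAdj.homEquiv _ _ (φ ≫ f))).1 ≫ (normInc Y).f n =
    ((sphereEquiv n P _ (gammaAdj.homEquiv _ _ φ)).1 ≫ (normInc X).f n) ≫
      ((alternatingFaceMapComplex C).map f).f n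
  rw [Adjunction.homEquiv_naturality_right, sphereEquiv_comp, assoc, assoc,
    ← HomologicalComplex.comp_f, ← HomologicalComplex.comp_f, normInc_naturality]

lemma gammaSphere_sphereToDisk (n : ℕ) (P : C) (X : SimplicialObject C)
    (φ : Idempotents.DoldKan.Γ.obj (disk n P) ⟶ X) :
    gammaSphere n P X (Idempotents.DoldKan.Γ.map (sphereToDisk n P) ≫ φ) =
      (gammaDiskEquiv n P X φ).1 ≫ X.δ 0 := by
  change (sphereEquiv n P _ (gammaAdj.homEquiv _ _ _)).1 ≫ (normInc X).f n =
    (diskEquiv n P _ (gammaAdj.homEquiv _ _ φ) ≫ (normInc X).f (n + 1)) ≫ X.δ 0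
  rw [Adjunction.homEquiv_naturality_left, sphereEquiv_sphereToDisk, assoc, normInc_d, assoc]

lemma gammaSphere_zero_surjective (P : C) (X : SimplicialObject C) :
    Function.Surjective (gammaSphere 0 P X) := fun y ↦
  ⟨(gammaAdj.homEquiv _ _).symm ((sphereEquiv 0 P _).symm ⟨y ≫ (normProj X).f 0, by
    simp⟩), by
    change (sphereEquiv 0 P _ (gammaAdj.homEquiv _ _ _)).1 ≫ (normInc X).f 0 = y
    rw [Equiv.apply_symm_apply, Equiv.apply_symm_apply]
    exact comp_normProj_normInc_zero y⟩

instance : (Idempotents.DoldKan.Γ : ChainComplex C ℕ ⥤ SimplicialObject C).IsEquivalence :=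
  inferInstanceAs
    (Idempotents.DoldKan.equivalence : SimplicialObject C ≌ _).inverse.IsEquivalence

instance : (Idempotents.DoldKan.N : SimplicialObject C ⥤ ChainComplex C ℕ).IsEquivalence :=
  inferInstanceAs
    (Idempotents.DoldKan.equivalence : SimplicialObject C ≌ _).functor.IsEquivalence

instance (n : ℕ) (P : C) : Mono (sphereToDisk n P) := by
  have (k : ℕ) : Mono ((sphereToDisk n P).f k) := by
    by_cases hk : k = n + 1
    · have h : IsZero ((sphere n P).X k) :=
        HomologicalComplex.isZero_single_obj_X _ _ _ _ (by omega)
      exact ⟨fun _ _ _ ↦ h.eq_of_tgt _ _⟩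
    · have := isIso_sphereToDisk_f_of_ne n k P hk
      infer_instance
  exact HomologicalComplex.mono_of_mono_f _ this

variable [HasCoproducts.{v} C]

/-- The object `Γ(D^{n+1}(P))` corepresents `(n + 1)`-simplices whose faces other than the zeroth
vanish. Its universal simplex `u` has boundary `(s, 0, ..., 0)` with `s` from `Γ(S^n(P))`, which
gives the square. A simplex of `X` whose boundary factors through `Γ(S^n(P))` has vanishing higher
faces, hence is a map from the disk; this is the universal property. -/
lemma exists_isPushout_gamma_sphereToDisk (n : ℕ) (P : C) : ∃ (a : _) (t : _),
    IsPushout a ((copower P).map (SSet.boundary.{v} (n + 1)).ι)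
      (Idempotents.DoldKan.Γ.map (sphereToDisk n P)) t := by
  set Γi := Idempotents.DoldKan.Γ.map (sphereToDisk n P) with hΓi
  let u := (gammaDiskEquiv n P _ (𝟙 _)).1
  have hu : ∀ i : Fin (n + 1), u ≫ _ = 0 := (gammaDiskEquiv n P _ (𝟙 _)).2
  let s := gammaSphere n P _ (𝟙 _)
  have hus : u ≫ SimplicialObject.δ _ 0 = s ≫ Γi.app (op ⦋n⦌) := by
    rw [← gammaSphere_comp, id_comp, ← gammaSphere_sphereToDisk, comp_id]
  let t := (simplexEquiv P _ (n + 1)).symm u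
  -- Being monic lets the boundary of `u` be factored face by face.
  have : Mono ((homSSet P).map Γi) := by
    have : (homSSet P).IsRightAdjoint := (copowerAdj P).isRightAdjoint
    infer_instance
  obtain ⟨b, hb⟩ := exists_boundary_lift ((homSSet P).map Γi) t (fun i ↦ by
    obtain rfl | ⟨i, rfl⟩ := Fin.eq_zero_or_eq_succ i
    · refine ⟨(simplexEquiv P _ n).symm s, (simplexEquiv P _ n).injective ?_⟩
      rw [simplexEquiv_comp, Equiv.apply_symm_apply, simplexEquiv_δ, Equiv.apply_symm_apply, hus]
    · refine ⟨zeroSimplex _ P _, (simplexEquiv P _ n).injective ?_⟩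
      rw [zeroSimplex_comp, simplexEquiv_zeroSimplex, simplexEquiv_δ, Equiv.apply_symm_apply, hu])
  have hφ (X : SimplicialObject C) (φ : Idempotents.DoldKan.Γ.obj (disk n P) ⟶ X) :
      simplexEquiv P X (n + 1) (t ≫ (homSSet P).map φ) = (gammaDiskEquiv n P X φ).1 := by
    rw [simplexEquiv_comp, Equiv.apply_symm_apply, ← gammaDiskEquiv_comp, id_comp]
  have hb₀ : simplexEquiv P _ n (SSet.boundary.ι 0 ≫ b) = s := by
    rw [← Equiv.eq_symm_apply, ← cancel_mono ((homSSet P).map Γi), assoc, hb,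
      SSet.boundary.ι_ι_assoc]
    apply (simplexEquiv P _ n).injective
    rw [simplexEquiv_comp, Equiv.apply_symm_apply, simplexEquiv_δ, Equiv.apply_symm_apply, hus]
  have hb₁ (i : Fin (n + 1)) : SSet.boundary.ι i.succ ≫ b = zeroSimplex _ P _ := by
    rw [← cancel_mono ((homSSet P).map Γi), assoc, hb, SSet.boundary.ι_ι_assoc]
    apply (simplexEquiv P _ n).injective
    rw [zeroSimplex_comp, simplexEquiv_zeroSimplex, simplexEquiv_δ, Equiv.apply_symm_apply, hu]
  have w : ((copowerAdj P).homEquiv _ _).symm b ≫ Γi =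
      (copower P).map (SSet.boundary.{v} (n + 1)).ι ≫ ((copowerAdj P).homEquiv _ _).symm t := by
    rw [← Adjunction.homEquiv_naturality_left_symm, ← Adjunction.homEquiv_naturality_right_symm, hb]
  have key (X : SimplicialObject C) (f : Idempotents.DoldKan.Γ.obj (sphere n P) ⟶ X)
      (g : (copower P).obj Δ[n + 1] ⟶ X)
      (h : ((copowerAdj P).homEquiv _ _).symm b ≫ f =
        (copower P).map (SSet.boundary.{v} (n + 1)).ι ≫ g) :
      ∃ φ, Γi ≫ φ = f ∧ ((copowerAdj P).homEquiv _ _).symm t ≫ φ = g := by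
    let g' := (copowerAdj P).homEquiv _ _ g
    have hg : b ≫ (homSSet P).map f = (SSet.boundary.{v} (n + 1)).ι ≫ g' := by
      rw [← Adjunction.homEquiv_naturality_left, ← h, Adjunction.homEquiv_naturality_right,
        Equiv.apply_symm_apply]
    have hδ (i : Fin (n + 2)) : simplexEquiv P X (n + 1) g' ≫ X.δ i =
        simplexEquiv P X n ((SSet.boundary.ι i ≫ b) ≫ (homSSet P).map f) := by
      rw [assoc, hg, SSet.boundary.ι_ι_assoc, simplexEquiv_δ]
    have hy (i : Fin (n + 1)) : simplexEquiv P X (n + 1) g' ≫ X.δ i.succ = 0 := by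
      rw [hδ, hb₁, zeroSimplex_comp, simplexEquiv_zeroSimplex]
    refine ⟨(gammaDiskEquiv n P X).symm ⟨_, hy⟩, gammaSphere_injective _ _ _ ?_, ?_⟩
    · rw [gammaSphere_sphereToDisk, Equiv.apply_symm_apply, hδ, simplexEquiv_comp, hb₀,
        ← gammaSphere_comp, id_comp]
    · rw [← Adjunction.homEquiv_naturality_right_symm, Equiv.symm_apply_eq]
      apply (simplexEquiv P X (n + 1)).injective
      rw [hφ, Equiv.apply_symm_apply]
  choose d hd₁ hd₂ using key
  refine ⟨((copowerAdj P).homEquiv _ _).symm b, ((copowerAdj P).homEquiv _ _).symm t, ⟨⟨w⟩,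
    ⟨PushoutCocone.IsColimit.mk _ (fun c ↦ d _ c.inl c.inr c.condition)
      (fun c ↦ hd₁ _ _ _ c.condition) (fun c ↦ hd₂ _ _ _ c.condition) fun c m _ hm ↦ ?_⟩⟩⟩
  apply (gammaDiskEquiv n P _).injective
  apply Subtype.ext
  have h := hm.trans (hd₂ _ _ _ c.condition).symm
  rw [← Adjunction.homEquiv_naturality_right_symm, ← Adjunction.homEquiv_naturality_right_symm,
    EmbeddingLike.apply_eq_iff_eq] at h
  rw [← hφ, h, hφ]

lemma pushouts_simplicialI_gamma_sphereToDisk (Proj : ObjectProperty C) (n : ℕ) {P : C}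
    (hP : Proj P) :
    MorphismProperty.pushouts (simplicialI Proj) (Idempotents.DoldKan.Γ.map (sphereToDisk n P)) := by
  obtain ⟨a, t, h⟩ := exists_isPushout_gamma_sphereToDisk n P
  exact ⟨_, _, _, _, _, simplicialI.mk (n + 1) P hP, h⟩

/-- Both objects corepresent `X ↦ Hom(P, X_0)`. -/
lemma isIso_copower_simplex_zero (P : C) :
    IsIso (((copowerAdj P).homEquiv Δ[0] (Idempotents.DoldKan.Γ.obj (sphere 0 P))).symm
      ((simplexEquiv P _ 0).symm (gammaSphere 0 P _ (𝟙 _)))) := by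
  set t := ((copowerAdj P).homEquiv Δ[0] (Idempotents.DoldKan.Γ.obj (sphere 0 P))).symm
      ((simplexEquiv P _ 0).symm (gammaSphere 0 P _ (𝟙 _))) with ht
  have h (X : SimplicialObject C) (φ : Idempotents.DoldKan.Γ.obj (sphere 0 P) ⟶ X) :
      simplexEquiv P X 0 ((copowerAdj P).homEquiv _ _ (t ≫ φ)) = gammaSphere 0 P X φ := by
    rw [ht, Adjunction.homEquiv_naturality_right, Equiv.apply_symm_apply, simplexEquiv_comp,
      Equiv.apply_symm_apply, ← gammaSphere_comp, id_comp]
  refine isIso_of_coyoneda_map_bijective _ fun X ↦ ⟨fun φ ψ hφ ↦ ?_, fun g ↦ ?_⟩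
  · apply gammaSphere_injective
    rw [← h, ← h]
    exact congrArg (fun a ↦ simplexEquiv P X 0 ((copowerAdj P).homEquiv _ _ a)) hφ
  · obtain ⟨φ, hφ⟩ := gammaSphere_zero_surjective P X
      (simplexEquiv P X 0 ((copowerAdj P).homEquiv _ _ g))
    rw [← h] at hφ
    exact ⟨φ, ((copowerAdj P).homEquiv _ _).injective ((simplexEquiv P X 0).injective hφ)⟩

lemma pushouts_simplicialI_gamma_zero (Proj : ObjectProperty C) {P : C} (hP : Proj P) :
    MorphismProperty.pushouts (simplicialI Proj)
      (Idempotents.DoldKan.Γ.map (0 : (0 : ChainComplex C ℕ) ⟶ sphere 0 P)) := by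
  have := isIso_copower_simplex_zero P
  have h₀ : IsInitial (Idempotents.DoldKan.Γ.obj (0 : ChainComplex C ℕ)) :=
    (isZero_zero (ChainComplex C ℕ)).isInitial.isInitialObj Idempotents.DoldKan.Γ _
  have h₁ : IsInitial ((copower P).obj (SSet.boundary.{v} 0 : SSet)) :=
    IsInitial.ofUniqueHom (fun X ↦ ((copowerAdj P).homEquiv _ _).symm (zeroSimplex _ P X))
      fun X m ↦ ((copowerAdj P).homEquiv _ _).injective SSet.boundary.hom_ext₀
  have : IsIso (h₁.to (Idempotents.DoldKan.Γ.obj (0 : ChainComplex C ℕ))) :=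
    ⟨h₀.to _, h₁.hom_ext _ _, h₀.hom_ext _ _⟩
  exact ⟨_, _, (copower P).map (SSet.boundary.{v} 0).ι, h₁.to _, _, simplicialI.mk 0 P hP,
    IsPushout.of_horiz_isIso (f := h₁.to _) (inr := ((copowerAdj P).homEquiv Δ[0] _).symm
      ((simplexEquiv P _ 0).symm (gammaSphere 0 P _ (𝟙 _)))) ⟨h₁.hom_ext _ _⟩⟩

/-- A cofibration of complexes is a retract of the relative cell complex in its factorisation. As an
equivalence, `Γ` preserves retracts, pushouts and transfinite compositions, so only the maps in `I`
matter. -/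
lemma simplicialCof_gamma_map [HasLimits C] [HasColimits C] [HasBinaryBiproducts C] {Proj : ObjectProperty C}
    (hproj : HasEnoughFunctorialProjectives Proj) {A B : ChainComplex C ℕ} {f : A ⟶ B}
    (hf : chainCof Proj f) : simplicialCof Proj (Idempotents.DoldKan.Γ.map f) := by
  obtain ⟨F, ν, h⟩ := hproj
  let d := (cellTrivFibData h).factorizationData f
  have hd : chainCell Proj d.i := d.hi
  have : HasLiftingProperty f d.p := hf _ d.hp
  refine ⟨_, _, _, (RetractArrow.ofLeftLiftingProperty d.fac).map Idempotents.DoldKan.Γ, ?_⟩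
  obtain ⟨J, _, _, _, _, hJ⟩ := (MorphismProperty.transfiniteCompositions_iff _ _).1 hd
  have : PreservesWellOrderContinuousOfShape J
      (Idempotents.DoldKan.Γ : ChainComplex C ℕ ⥤ SimplicialObject C) := ⟨fun _ _ ↦ inferInstance⟩
  refine MorphismProperty.transfiniteCompositionsOfShape_le_transfiniteCompositions _ J _
    (MorphismProperty.transfiniteCompositionsOfShape_map_of_preserves _ _ _
      (MorphismProperty.transfiniteCompositionsOfShape_monotone J ?_ _ hJ))
  rintro X Y i ⟨_, _, a, _, _, hi, sq⟩
  have sq' := sq.map Idempotents.DoldKan.Γ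
  have h : MorphismProperty.pushouts (simplicialI Proj) (Idempotents.DoldKan.Γ.map a) := by
    obtain ⟨P, hP⟩ | ⟨n, P, hP⟩ := hi
    · exact pushouts_simplicialI_gamma_zero Proj hP
    · exact pushouts_simplicialI_gamma_sphereToDisk Proj n hP
  obtain ⟨_, _, _, _, _, hj, sq''⟩ := h
  exact ⟨_, _, _, _, _, hj, sq''.paste_horiz sq'⟩

/-- A map of simplicial objects is isomorphic to the map given by its normalization. -/
def gammaNArrowIso {X Y : SimplicialObject C} (f : X ⟶ Y) :
    Arrow.mk (Idempotents.DoldKan.Γ.map (Idempotents.DoldKan.N.map f)) ≅ Arrow.mk f :=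
  (Arrow.isoMk (Idempotents.DoldKan.equivalence.unitIso.app X)
    (Idempotents.DoldKan.equivalence.unitIso.app Y)
    (Idempotents.DoldKan.equivalence.unitIso.hom.naturality f).symm).symm

/-- A map of complexes is isomorphic to the normalization of the map of simplicial objects. -/
def nGammaArrowIso {A B : ChainComplex C ℕ} (f : A ⟶ B) :
    Arrow.mk (Idempotents.DoldKan.N.map (Idempotents.DoldKan.Γ.map f)) ≅ Arrow.mk f :=
  Arrow.isoMk (Idempotents.DoldKan.equivalence.counitIso.app A)
    (Idempotents.DoldKan.equivalence.counitIso.app B)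
    (Idempotents.DoldKan.equivalence.counitIso.hom.naturality f).symm

lemma hasLiftingProperty_N {X Y A B : SimplicialObject C} (f : X ⟶ Y) (g : A ⟶ B)
    [HasLiftingProperty f g] :
    HasLiftingProperty (Idempotents.DoldKan.N.map f) (Idempotents.DoldKan.N.map g) :=
  (Idempotents.DoldKan.equivalence.toAdjunction.hasLiftingProperty_iff f _).2
    ((HasLiftingProperty.iff_of_arrow_iso_right f (gammaNArrowIso g)).2 inferInstance)

variable [HasLimits C] [HasColimits C] [HasBinaryBiproducts C]
  {Proj : ObjectProperty C} [Proj.IsStableUnderRetracts]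

lemma simplicialCof_iff_N (hproj : HasEnoughFunctorialProjectives Proj) {X Y : SimplicialObject C}
    {f : X ⟶ Y} : simplicialCof Proj f ↔ chainCof Proj (Idempotents.DoldKan.N.map f) := by
  constructor
  · intro hf A B g hg
    let I : MorphismProperty (ChainComplex C ℕ) := chainI Proj
    have hg₁ : I.rlp (Idempotents.DoldKan.N.map (Idempotents.DoldKan.Γ.map g)) :=
      (MorphismProperty.arrow_mk_iso_iff I.rlp (nGammaArrowIso g)).2 hg
    have hg' : MorphismProperty.rlp (simplicialI Proj) (Idempotents.DoldKan.Γ.map g) := by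
      intro _ _ i hi
      obtain ⟨n, P, hP⟩ := hi
      exact rlp_simplicialI_of_N hproj
        (by rwa [← rlp_chainI_eq]) hP _
    have hle : simplicialCof Proj ≤ (MorphismProperty.rlp (simplicialI Proj)).llp :=
      (MorphismProperty.retracts_monotone ((MorphismProperty.transfiniteCompositions_monotone
        (MorphismProperty.pushouts_le_llp_rlp _)).trans
        (MorphismProperty.transfiniteCompositions_le _))).trans (MorphismProperty.retracts_le _)
    have := hle _ hf _ hg'
    have := hasLiftingProperty_N f (Idempotents.DoldKan.Γ.map g)
    exact (HasLiftingProperty.iff_of_arrow_iso_right _ (nGammaArrowIso g)).1 this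
  · intro hf
    obtain ⟨_, _, g, r, hg⟩ := simplicialCof_gamma_map hproj hf
    exact ⟨_, _, g, (Retract.ofIso (gammaNArrowIso f).symm).trans r, hg⟩

end GammaDisk

/-! ### Weak equivalences of simplicial sets -/

section WeakEquivalences

open MonoidalCategory Simplicial Opposite

variable {X Y Z : SSet.{v}}

/-- The map on homotopy classes given by precomposition. -/
def HomotopyClasses.precomp (f : X ⟶ Y) (K : SSet.{v}) : HomotopyClasses Y K → HomotopyClasses X K :=
  Quot.lift (fun g ↦ Quot.mk _ (f ≫ g)) (fun _ _ ⟨h⟩ ↦ Quot.sound ⟨h.precomp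
    (SSet.RelativeMorphism.botEquiv.symm f) (by simp)⟩)

/-- The map on homotopy classes given by postcomposition. -/
def HomotopyClasses.postcomp (f : Y ⟶ Z) (X : SSet.{v}) : HomotopyClasses X Y → HomotopyClasses X Z :=
  Quot.lift (fun g ↦ Quot.mk _ (g ≫ f)) (fun _ _ ⟨h⟩ ↦ Quot.sound ⟨h.postcomp
    (SSet.RelativeMorphism.botEquiv.symm f) (by simp)⟩)

lemma isWeakEquivalence_iff (f : X ⟶ Y) : IsWeakEquivalence f ↔
    ∀ (K : SSet.{v}) [SSet.KanComplex K], Function.Bijective (HomotopyClasses.precomp f K) := Iff.rfl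

lemma HomotopyClasses.precomp_comp (f : X ⟶ Y) (g : Y ⟶ Z) (K : SSet.{v}) :
    precomp (f ≫ g) K = precomp f K ∘ precomp g K := by
  ext ⟨h⟩
  exact congrArg (Quot.mk _) (assoc f g h)

lemma HomotopyClasses.precomp_id (K : SSet.{v}) : precomp (𝟙 X) K = id := by
  ext ⟨h⟩
  exact congrArg (Quot.mk _) (id_comp h)

lemma HomotopyClasses.precomp_eq_id {f : X ⟶ X} (h : SSet.Homotopy f (𝟙 X)) (K : SSet.{v}) :
    precomp f K = id := by
  ext ⟨g⟩
  exact (Quot.sound ⟨h.postcomp (SSet.RelativeMorphism.botEquiv.symm g) (by simp)⟩).trans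
    (congrArg (Quot.mk _) (id_comp g))

lemma isWeakEquivalence_comp_iff_of_left {f : X ⟶ Y} (hf : IsWeakEquivalence f) (g : Y ⟶ Z) :
    IsWeakEquivalence (f ≫ g) ↔ IsWeakEquivalence g := by
  rw [isWeakEquivalence_iff, isWeakEquivalence_iff]
  refine forall_congr' fun K ↦ forall_congr' fun _ ↦ ?_
  rw [HomotopyClasses.precomp_comp]
  exact Function.Bijective.of_comp_iff' (hf K) _

lemma isWeakEquivalence_comp_iff_of_right (f : X ⟶ Y) {g : Y ⟶ Z} (hg : IsWeakEquivalence g) :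
    IsWeakEquivalence (f ≫ g) ↔ IsWeakEquivalence f := by
  rw [isWeakEquivalence_iff, isWeakEquivalence_iff]
  refine forall_congr' fun K ↦ forall_congr' fun _ ↦ ?_
  rw [HomotopyClasses.precomp_comp]
  exact Function.Bijective.of_comp_iff _ (hg K)

lemma isWeakEquivalence_id (X : SSet.{v}) : IsWeakEquivalence (𝟙 X) := fun K _ ↦ by
  change Function.Bijective (HomotopyClasses.precomp (𝟙 X) K)
  rw [HomotopyClasses.precomp_id]
  exact Function.bijective_id

lemma isWeakEquivalence_of_homotopy {f : X ⟶ Y} {g : Y ⟶ X} (hfg : SSet.Homotopy (f ≫ g) (𝟙 X))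
    (hgf : g ≫ f = 𝟙 Y) : IsWeakEquivalence f := fun K _ ↦ by
  change Function.Bijective (HomotopyClasses.precomp f K)
  refine Function.bijective_iff_has_inverse.2 ⟨HomotopyClasses.precomp g K, fun h ↦ ?_, fun h ↦ ?_⟩
  · rw [← Function.comp_apply (f := HomotopyClasses.precomp g K), ← HomotopyClasses.precomp_comp,
      hgf, HomotopyClasses.precomp_id, id]
  · rw [← Function.comp_apply (f := HomotopyClasses.precomp f K), ← HomotopyClasses.precomp_comp,
      HomotopyClasses.precomp_eq_id hfg, id]

lemma isWeakEquivalence_of_isIso (f : X ⟶ Y) [IsIso f] : IsWeakEquivalence f :=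
  isWeakEquivalence_of_homotopy (g := inv f)
    (SSet.RelativeMorphism.Homotopy.ofEq (by rw [IsIso.hom_inv_id])) (by simp)

lemma isWeakEquivalence_iff_of_arrow_iso {X' Y' : SSet.{v}} {f : X ⟶ Y} {f' : X' ⟶ Y'}
    (e : Arrow.mk f ≅ Arrow.mk f') : IsWeakEquivalence f ↔ IsWeakEquivalence f' := by
  rw [← isWeakEquivalence_comp_iff_of_right f (isWeakEquivalence_of_isIso e.hom.right),
    ← isWeakEquivalence_comp_iff_of_left (isWeakEquivalence_of_isIso e.hom.left) f']
  exact iff_of_eq (congrArg _ (Arrow.w e.hom).symm)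

lemma stdSimplex_const_zero_ne_one (m : SimplexCategoryᵒᵖ) :
    SSet.stdSimplex.const.{v} 1 0 m ≠ SSet.stdSimplex.const 1 1 m := fun h ↦
  zero_ne_one (α := Fin 2) (DFunLike.congr_fun (congrArg SSet.stdSimplex.asOrderHom h) 0)

/-- The union of the two ends of a cylinder. -/
def cylinderEnds (X : SSet.{v}) : (X ⊗ Δ[1] : SSet.{v}).Subcomplex where
  obj m := {y | y.2 = SSet.stdSimplex.const 1 0 m ∨ y.2 = SSet.stdSimplex.const 1 1 m}
  map {m m'} f := by
    rintro ⟨x, c⟩ (rfl | rfl)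
    exacts [Or.inl rfl, Or.inr rfl]

/-- The map from the ends of a cylinder given by two maps. -/
def cylinderEndsDesc (f g : X ⟶ Y) : (cylinderEnds X : SSet.{v}) ⟶ Y where
  app m := ↾fun y ↦ by
    classical
    exact if y.1.2 = SSet.stdSimplex.const 1 0 m then f.app m y.1.1 else g.app m y.1.1
  naturality m m' φ := by
    ext ⟨⟨x, c⟩, h⟩
    obtain h | h := h
    · obtain rfl : c = SSet.stdSimplex.const 1 0 m := h
      refine (if_pos rfl).trans ((NatTrans.naturality_apply f φ x).trans ?_)
      exact congrArg (Y.map φ) (if_pos rfl).symm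
    · obtain rfl : c = SSet.stdSimplex.const 1 1 m := h
      refine (if_neg (stdSimplex_const_zero_ne_one _).symm).trans
        ((NatTrans.naturality_apply g φ x).trans ?_)
      exact congrArg (Y.map φ) (if_neg (stdSimplex_const_zero_ne_one _).symm).symm

/-- The homotopy is a lift on the cylinder, relative to its two ends, of the constant homotopy in
`Z`. -/
lemma exists_homotopy_of_comp_eq {p : Y ⟶ Z}
    (hp : (MorphismProperty.monomorphisms SSet.{v}).rlp p) {f g : X ⟶ Y} (h : f ≫ p = g ≫ p) :
    Nonempty (SSet.Homotopy f g) := by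
  have := hp _ (MorphismProperty.monomorphisms.infer_property (cylinderEnds X).ι)
  have sq : CommSq (cylinderEndsDesc f g) (cylinderEnds X).ι p
      (SemiCartesianMonoidalCategory.fst X Δ[1] ≫ f ≫ p) := ⟨by
    ext m ⟨⟨x, c⟩, hc | hc⟩
    · exact congrArg (p.app m) (if_pos hc)
    · refine (congrArg (p.app m) (if_neg fun hc' ↦ ?_)).trans
        (ConcreteCategory.congr_hom (NatTrans.congr_app h m) x).symm
      exact stdSimplex_const_zero_ne_one m (hc'.symm.trans hc)⟩
  refine ⟨homotopyMk sq.lift ?_ ?_⟩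
  · ext m x
    refine (ConcreteCategory.congr_hom (NatTrans.congr_app sq.fac_left m)
      ⟨SSet.ι₀.app m x, Or.inl rfl⟩).trans (if_pos rfl)
  · ext m x
    refine (ConcreteCategory.congr_hom (NatTrans.congr_app sq.fac_left m)
      ⟨SSet.ι₁.app m x, Or.inr rfl⟩).trans (if_neg (stdSimplex_const_zero_ne_one m).symm)

/-- Lifting from the empty simplicial set gives a section. Its composite with `p` on `X` agrees with
the identity over `Y`, so the two are homotopic. -/
lemma isWeakEquivalence_of_rlp {p : X ⟶ Y} (hp : SSet.modelCategoryQuillen.I.rlp p) :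
    IsWeakEquivalence p := by
  rw [← SSet.rlp_monomorphisms] at hp
  have := hp _ (MorphismProperty.monomorphisms.infer_property (⊥ : Y.Subcomplex).ι)
  have sq : CommSq (SSet.Subcomplex.isInitialBot.to X) (⊥ : Y.Subcomplex).ι p (𝟙 Y) :=
    ⟨SSet.Subcomplex.isInitialBot.hom_ext _ _⟩
  obtain ⟨h⟩ := exists_homotopy_of_comp_eq hp (f := p ≫ sq.lift) (g := 𝟙 X) (by simp)
  exact isWeakEquivalence_of_homotopy h sq.fac_right

end WeakEquivalences

/-! ### Mapping spaces out of constant simplicial objects -/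

section MappingSpace

open Simplicial Opposite

variable {C : Type u} [Category.{v} C]

/-- The simplices of the mapping spaces from a constant simplicial object. -/
def homObjConstEquiv (P : C) (X : SimplicialObject C) (m : SimplexCategoryᵒᵖ) :
    Functor.HomObj ((SimplicialObject.const C).obj P) X (coyoneda.obj (op m)) ≃ (P ⟶ X.obj m) where
  toFun x := x.app m (𝟙 m)
  invFun y :=
    { app c a := y ≫ X.map a
      naturality {c d} f a := by
        change 𝟙 P ≫ y ≫ X.map (a ≫ f) = (y ≫ X.map a) ≫ X.map f
        rw [id_comp, X.map_comp, assoc] }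
  left_inv x := by
    ext c a
    refine (x.naturality (show m ⟶ c from a) (𝟙 m)).symm.trans ((id_comp _).trans ?_)
    exact congrArg (x.app c) (id_comp (show m ⟶ c from a))
  right_inv y := (congrArg (y ≫ ·) (X.map_id _)).trans (comp_id y)

/-- The mapping spaces from a constant simplicial object. -/
def constHomIso (P : C) (X : SimplicialObject C) :
    ((SimplicialObject.const C).obj P ⟶[SSet.{v}] X) ≅ (homSSet P).obj X :=
  NatIso.ofComponents (fun m ↦ (homObjConstEquiv P X m).toIso) (by
    intro m m' f
    ext x
    have h := Functor.HomObj.naturality (show Functor.HomObj ((SimplicialObject.const C).obj P) X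
      (coyoneda.obj (op m)) from x) f (𝟙 m)
    refine Eq.trans ?_ ((id_comp _).symm.trans h)
    exact congrArg (Functor.HomObj.app (show Functor.HomObj ((SimplicialObject.const C).obj P) X
      (coyoneda.obj (op m)) from x) m') ((comp_id f).trans (id_comp f).symm))

lemma constHomIso_naturality (P : C) {X Y : SimplicialObject C} (f : X ⟶ Y) :
    eHomWhiskerLeft SSet.{v} ((SimplicialObject.const C).obj P) f ≫ (constHomIso P Y).hom =
      (constHomIso P X).hom ≫ (homSSet P).map f := by
  ext m x
  rfl

end MappingSpace

/-! ### Weak equivalences of simplicial objects -/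

section HomologyRelation

variable {C : Type u} [Category.{v} C] [Preadditive C] {A B : ChainComplex C ℕ}

/-- Two maps of complexes agree on the homology of the complexes of maps from `P`. -/
def HomologyEq (P : C) (a b : A ⟶ B) : Prop :=
  ∀ (n : ℕ) (y : P ⟶ A.X n), y ≫ A.d n (n - 1) = 0 →
    ∃ w : P ⟶ B.X (n + 1), w ≫ B.d (n + 1) n = y ≫ a.f n - y ≫ b.f n

lemma homologyEq_equivalence (P : C) : Equivalence (HomologyEq P (A := A) (B := B)) where
  refl a n y _ := ⟨0, by simp⟩
  symm h n y hy := by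
    obtain ⟨w, hw⟩ := h n y hy
    exact ⟨-w, by rw [Preadditive.neg_comp, hw, neg_sub]⟩
  trans h h' n y hy := by
    obtain ⟨w, hw⟩ := h n y hy
    obtain ⟨w', hw'⟩ := h' n y hy
    exact ⟨w + w', by rw [Preadditive.add_comp, hw, hw', sub_add_sub_cancel]⟩

end HomologyRelation

/-! ### Homology of maps of simplicial sets that need not be additive -/

section Faces

open Simplicial Opposite AlgebraicTopology

variable {C : Type u} [Category.{v} C] [Preadditive C] {P : C} {X Y : SimplicialObject C}

/-- All the faces of a simplex are zero. -/
def FacesVanish (n : ℕ) (z : P ⟶ X _⦋n⦌) : Prop :=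
  match n, z with
  | 0, _ => True
  | n + 1, z => ∀ i : Fin (n + 2), z ≫ X.δ i = 0

lemma comp_d_eq {n : ℕ} (x : P ⟶ X _⦋n + 1⦌) (hx : ∀ i : Fin (n + 1), x ≫ X.δ i.succ = 0) :
    x ≫ ((alternatingFaceMapComplex C).obj X).d (n + 1) n = x ≫ X.δ 0 := by
  rw [alternatingFaceMapComplex_obj_d, AlternatingFaceMapComplex.objD, Preadditive.comp_sum,
    Fin.sum_univ_succ, Finset.sum_eq_zero]
  · simp
  · intro i _
    rw [Preadditive.comp_zsmul, hx, smul_zero]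

lemma FacesVanish.comp_d {n : ℕ} {x : P ⟶ X _⦋n⦌} (hx : FacesVanish n x) :
    x ≫ ((alternatingFaceMapComplex C).obj X).d n (n - 1) = 0 := by
  cases n with
  | zero => simp
  | succ n => exact (comp_d_eq x fun i ↦ hx i.succ).trans (hx 0)

variable [HasCoproducts.{v} C]

/-- A map of simplicial sets of maps, as a map on elements. -/
def simplexMap (α : (homSSet P).obj X ⟶ (homSSet P).obj Y) (n : ℕ) (z : P ⟶ X _⦋n⦌) :
    P ⟶ Y _⦋n⦌ := α.app (op ⦋n⦌) z

lemma simplexMap_δ (α : (homSSet P).obj X ⟶ (homSSet P).obj Y) {n : ℕ} (z : P ⟶ X _⦋n + 1⦌)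
    (i : Fin (n + 2)) : simplexMap α (n + 1) z ≫ Y.δ i = simplexMap α n (z ≫ X.δ i) :=
  (NatTrans.naturality_apply α (SimplexCategory.δ i).op z).symm

/-- The simplices of a simplicial set as simplices of its copower. -/
def copowerSimplex (P : C) (K : SSet.{v}) {n : ℕ} (z : K _⦋n⦌) : P ⟶ ((copower P).obj K) _⦋n⦌ :=
  ((copowerAdj P).unit.app K).app (op ⦋n⦌) z

lemma copowerSimplex_comp {K : SSet.{v}} (a : (copower P).obj K ⟶ X) {n : ℕ} (z : K _⦋n⦌) :
    copowerSimplex P K z ≫ a.app (op ⦋n⦌) = ((copowerAdj P).homEquiv _ _ a).app (op ⦋n⦌) z := by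
  rw [Adjunction.homEquiv_unit]
  rfl

lemma copowerSimplex_δ {K : SSet.{v}} {n : ℕ} (z : K _⦋n + 1⦌) (i : Fin (n + 2)) :
    copowerSimplex P K z ≫ ((copower P).obj K).δ i = copowerSimplex P K (K.δ i z) :=
  (NatTrans.naturality_apply ((copowerAdj P).unit.app K) (SimplexCategory.δ i).op z).symm

/-- The maps of complexes adjoint to two maps of simplicial sets agree on homology. -/
def AdjHomologyEq {K : SSet.{v}} (α β : K ⟶ (homSSet P).obj Y) : Prop :=
  HomologyEq P ((alternatingFaceMapComplex C).map (((copowerAdj P).homEquiv _ _).symm α))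
    ((alternatingFaceMapComplex C).map (((copowerAdj P).homEquiv _ _).symm β))

/-- A non-additive map has no normalization, but its adjoint out of the copower is a map of
simplicial objects, and homotopies then give chain homotopies. -/
lemma adjHomologyEq_of_homotopy {K : SSet.{v}} {α β : K ⟶ (homSSet P).obj Y}
    (h : SSet.Homotopy α β) : AdjHomologyEq α β := by
  have e (γ : K ⟶ (homSSet P).obj Y) :
      (alternatingFaceMapComplex C).map (((copowerAdj P).homEquiv _ _).symm γ) =
      (copowerChains P).map γ ≫ (alternatingFaceMapComplex C).map ((copowerAdj P).counit.app Y) := by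
    rw [Adjunction.homEquiv_counit, Functor.map_comp]
    rfl
  exact fun n y hy ↦ exists_comp_d_eq_sub (((Homotopy.ofEq (e α)).trans
    ((copowerHomotopy P h).compRight _)).trans (Homotopy.ofEq (e β).symm)) y hy

/-- Equality of homotopy classes only gives a chain of homotopies; agreement on homology is an
equivalence relation, so a chain is enough. -/
lemma adjHomologyEq_of_quot_eq {K : SSet.{v}} {α β : K ⟶ (homSSet P).obj Y}
    (h : (Quot.mk _ α : HomotopyClasses K ((homSSet P).obj Y)) = Quot.mk _ β) :
    AdjHomologyEq α β := by
  have := Quot.eqvGen_exact h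
  have e : Equivalence (AdjHomologyEq (P := P) (Y := Y) (K := K)) :=
    (homologyEq_equivalence P).comap _
  clear h
  induction this with
  | rel _ _ h => exact adjHomologyEq_of_homotopy h.some
  | refl _ => exact e.refl _
  | symm _ _ _ h => exact e.symm h
  | trans _ _ _ _ _ h h' => exact e.trans h h'

/-- The tautological map `L` into the copower is not additive: the faces of `L z` are `L 0`, not
zero. Subtracting `L 0` produces the cycle to which the hypothesis applies. -/
lemma AdjHomologyEq.exists_comp_d {α β : (homSSet P).obj X ⟶ (homSSet P).obj Y}
    (h : AdjHomologyEq α β) {n : ℕ} {z : P ⟶ X _⦋n⦌} (hz : FacesVanish n z) :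
    ∃ w : P ⟶ Y _⦋n + 1⦌, w ≫ ((alternatingFaceMapComplex C).obj Y).d (n + 1) n =
      (simplexMap α n z - simplexMap α n 0) - (simplexMap β n z - simplexMap β n 0) := by
  let L (n : ℕ) (x : P ⟶ X _⦋n⦌) : P ⟶ ((copower P).obj ((homSSet P).obj X)) _⦋n⦌ :=
    copowerSimplex P ((homSSet P).obj X) (n := n) x
  have hL : FacesVanish n (L n z - L n 0) := by
    cases n with
    | zero => trivial
    | succ n =>
      intro i
      rw [Preadditive.sub_comp, sub_eq_zero]
      refine (copowerSimplex_δ _ _).trans (Eq.trans ?_ (copowerSimplex_δ _ _).symm)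
      exact congrArg (L n) ((hz i).trans zero_comp.symm)
  obtain ⟨w, hw⟩ := h n _ hL.comp_d
  refine ⟨w, hw.trans ?_⟩
  have key (α : (homSSet P).obj X ⟶ (homSSet P).obj Y) : (L n z - L n 0) ≫
      ((alternatingFaceMapComplex C).map (((copowerAdj P).homEquiv _ _).symm α)).f n =
      simplexMap α n z - simplexMap α n 0 := by
    have h' (x : P ⟶ X _⦋n⦌) : L n x ≫ ((alternatingFaceMapComplex C).map
        (((copowerAdj P).homEquiv _ _).symm α)).f n = simplexMap α n x := by
      refine (copowerSimplex_comp (K := (homSSet P).obj X)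
        (((copowerAdj P).homEquiv _ _).symm α) (n := n) x).trans ?_
      rw [Equiv.apply_symm_apply]
      rfl
    rw [Preadditive.sub_comp, h', h']
  rw [key, key]

end Faces

/-! ### Weak equivalences correspond under normalization -/

section SimplicialWeakEquivalences

open Simplicial Opposite AlgebraicTopology Idempotents

variable {C : Type u} [Category.{v} C] [Preadditive C] [IsIdempotentComplete C]
  [HasCoproducts.{v} C] [HasFiniteCoproducts C] [HasZeroObject C] {P : C} {X Y : SimplicialObject C}

lemma facesVanish_normInc {n : ℕ} {x : P ⟶ (Idempotents.DoldKan.N.obj X).X n}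
    (hx : x ≫ (Idempotents.DoldKan.N.obj X).d n (n - 1) = 0) :
    FacesVanish n (x ≫ (normInc X).f n) := by
  cases n with
  | zero => trivial
  | succ n =>
    intro i
    obtain rfl | ⟨i, rfl⟩ := Fin.eq_zero_or_eq_succ i
    · rw [assoc, ← normInc_d, ← assoc]
      exact (congrArg (· ≫ (normInc X).f n) hx).trans zero_comp
    · rw [assoc, normInc_δ, comp_zero]

lemma FacesVanish.comp_normProj_d {n : ℕ} {x : P ⟶ X _⦋n⦌} (hx : FacesVanish n x) :
    (x ≫ (normProj X).f n) ≫ (Idempotents.DoldKan.N.obj X).d n (n - 1) = 0 := by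
  rw [assoc, HomologicalComplex.Hom.comm, ← assoc, hx.comp_d, zero_comp]

lemma comp_normProj_d {n : ℕ} (w : P ⟶ X _⦋n + 1⦌) :
    (w ≫ (normProj X).f (n + 1)) ≫ (Idempotents.DoldKan.N.obj X).d (n + 1) n =
      (w ≫ ((alternatingFaceMapComplex C).obj X).d (n + 1) n) ≫ (normProj X).f n := by
  rw [assoc, HomologicalComplex.Hom.comm, assoc]

lemma comp_normInc_normProj {n : ℕ} (x : P ⟶ (Idempotents.DoldKan.N.obj X).X n) :
    (x ≫ (normInc X).f n) ≫ (normProj X).f n = x := by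
  rw [assoc, ← HomologicalComplex.comp_f, normInc_normProj, HomologicalComplex.id_f, comp_id]

lemma comp_N_map_f {n : ℕ} (f : X ⟶ Y) (x : P ⟶ (Idempotents.DoldKan.N.obj X).X n) :
    (x ≫ (Idempotents.DoldKan.N.map f).f n) ≫ (normInc Y).f n =
      (x ≫ (normInc X).f n) ≫ f.app (op ⦋n⦌) := by
  rw [assoc, ← HomologicalComplex.comp_f, ← normInc_naturality, assoc]
  rfl

lemma comp_normProj_N_map_f {n : ℕ} (f : X ⟶ Y) (x : P ⟶ X _⦋n⦌) :
    (x ≫ (normProj X).f n) ≫ (Idempotents.DoldKan.N.map f).f n =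
      (x ≫ f.app (op ⦋n⦌)) ≫ (normProj Y).f n := by
  rw [assoc, ← HomologicalComplex.comp_f, normProj_naturality, assoc]
  rfl

lemma simplexMap_sub_facesVanish (α : (homSSet P).obj X ⟶ (homSSet P).obj Y) {n : ℕ}
    {z : P ⟶ X _⦋n⦌} (hz : FacesVanish n z) :
    FacesVanish n (simplexMap α n z - simplexMap α n 0) := by
  cases n with
  | zero => trivial
  | succ n =>
    intro i
    rw [Preadditive.sub_comp, simplexMap_δ, simplexMap_δ, hz, zero_comp, sub_self]

/-- Maps inducing homotopy equivalences on mapping spaces induce isomorphisms on homology. -/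
lemma exists_of_homotopyEquiv (f : X ⟶ Y) (ψ : (homSSet P).obj Y ⟶ (homSSet P).obj X)
    (h₁ : AdjHomologyEq ((homSSet P).map f ≫ ψ) (𝟙 _))
    (h₂ : AdjHomologyEq (ψ ≫ (homSSet P).map f) (𝟙 _)) (n : ℕ) :
    (∀ y : P ⟶ (Idempotents.DoldKan.N.obj Y).X n, y ≫ (Idempotents.DoldKan.N.obj Y).d n (n - 1) = 0 →
      ∃ x : P ⟶ (Idempotents.DoldKan.N.obj X).X n, x ≫ (Idempotents.DoldKan.N.obj X).d n (n - 1) = 0 ∧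
      ∃ w : P ⟶ (Idempotents.DoldKan.N.obj Y).X (n + 1),
        w ≫ (Idempotents.DoldKan.N.obj Y).d (n + 1) n =
          y - x ≫ (Idempotents.DoldKan.N.map f).f n) ∧
    (∀ x : P ⟶ (Idempotents.DoldKan.N.obj X).X n, x ≫ (Idempotents.DoldKan.N.obj X).d n (n - 1) = 0 →
      ∀ w : P ⟶ (Idempotents.DoldKan.N.obj Y).X (n + 1),
      w ≫ (Idempotents.DoldKan.N.obj Y).d (n + 1) n = x ≫ (Idempotents.DoldKan.N.map f).f n →
      ∃ v : P ⟶ (Idempotents.DoldKan.N.obj X).X (n + 1),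
        v ≫ (Idempotents.DoldKan.N.obj X).d (n + 1) n = x) := by
  constructor
  · intro y hy
    have hy' := facesVanish_normInc hy
    set y' : P ⟶ Y _⦋n⦌ := y ≫ (normInc Y).f n with y'_def
    have hx := simplexMap_sub_facesVanish ψ hy'
    obtain ⟨w, hw⟩ := h₂.exists_comp_d hy'
    -- The preimage of `y` on homology is the class of `ψ(y') - ψ(0)`; the sign appears because `w`
    -- bounds `fψ` minus the identity.
    refine ⟨_, hx.comp_normProj_d, -w ≫ (normProj Y).f (n + 1), ?_⟩
    have hw' : w ≫ ((alternatingFaceMapComplex C).obj Y).d (n + 1) n =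
        (simplexMap ψ n y' - simplexMap ψ n 0) ≫ f.app (op ⦋n⦌) - y' := by
      rw [hw, Preadditive.sub_comp]
      change _ - (y' - 0) = _
      rw [sub_zero]
      rfl
    rw [comp_normProj_N_map_f, Preadditive.neg_comp, comp_normProj_d]
    refine (congrArg (fun a ↦ -(a ≫ (normProj Y).f n)) hw').trans ?_
    rw [← Preadditive.neg_comp, neg_sub, Preadditive.sub_comp, y'_def, comp_normInc_normProj]
  · intro x hx w hw
    have hx' := facesVanish_normInc hx
    set x' : P ⟶ X _⦋n⦌ := x ≫ (normInc X).f n with x'_def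
    obtain ⟨w₂, hw₂⟩ := h₁.exists_comp_d hx'
    set w' : P ⟶ Y _⦋n + 1⦌ := w ≫ (normInc Y).f (n + 1) with w'_def
    have hw'₀ : w' ≫ Y.δ 0 = x' ≫ f.app (op ⦋n⦌) := by
      rw [w'_def, assoc, ← normInc_d, ← assoc, hw, comp_N_map_f]
    have hw' (i : Fin (n + 1)) : w' ≫ Y.δ i.succ = 0 := by
      rw [w'_def, assoc, normInc_δ, comp_zero]
    -- The only possibly nonzero face of `v` is `ψ(f x') - ψ(0)`, while `w₂` bounds this minus `x'`;
    -- hence `v - w₂` bounds `x'`.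
    let v := simplexMap ψ (n + 1) w' - simplexMap ψ (n + 1) 0
    have hv (i : Fin (n + 1)) : v ≫ X.δ i.succ = 0 := by
      rw [Preadditive.sub_comp, simplexMap_δ, simplexMap_δ, hw', zero_comp, sub_self]
    have hv₀ : v ≫ X.δ 0 = simplexMap ψ n (x' ≫ f.app (op ⦋n⦌)) - simplexMap ψ n 0 := by
      rw [Preadditive.sub_comp, simplexMap_δ, simplexMap_δ, hw'₀, zero_comp]
    refine ⟨(v - w₂) ≫ (normProj X).f (n + 1), ?_⟩
    have key : (v - w₂) ≫ ((alternatingFaceMapComplex C).obj X).d (n + 1) n = x' := by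
      have h0 : simplexMap ((homSSet P).map f ≫ ψ) n (0 : P ⟶ X _⦋n⦌) = simplexMap ψ n 0 :=
        congrArg (simplexMap ψ n) zero_comp
      rw [Preadditive.sub_comp, comp_d_eq v hv, hv₀, hw₂, h0]
      change _ - (simplexMap ψ n (x' ≫ f.app (op ⦋n⦌)) - _ - (x' - 0)) = x'
      rw [sub_zero, sub_sub_cancel]
    rw [comp_normProj_d, key, x'_def, comp_normInc_normProj]

/-- Testing against `K` gives `ψ` with `φ ≫ ψ` homotopic to the identity. Testing against `L`, the
other composite may be compared with the identity after precomposing with `φ`. -/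
lemma exists_homotopyInverse {K L : SSet.{v}} [SSet.KanComplex K] [SSet.KanComplex L] {φ : K ⟶ L}
    (hφ : IsWeakEquivalence φ) : ∃ ψ : L ⟶ K,
      (Quot.mk _ (φ ≫ ψ) : HomotopyClasses K K) = Quot.mk _ (𝟙 K) ∧
      (Quot.mk _ (ψ ≫ φ) : HomotopyClasses L L) = Quot.mk _ (𝟙 L) := by
  obtain ⟨⟨ψ⟩, hψ⟩ := (hφ K).2 (Quot.mk _ (𝟙 K))
  refine ⟨ψ, hψ, (hφ L).1 ?_⟩
  refine Eq.trans ?_ ((congrArg (HomotopyClasses.postcomp φ K) hψ).trans ?_)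
  · exact congrArg (Quot.mk _) (assoc φ ψ φ).symm
  · exact congrArg (Quot.mk _) ((id_comp φ).trans (comp_id φ).symm)

variable [HasLimits C] [HasColimits C] [HasBinaryBiproducts C]
  {Proj : ObjectProperty C} [Proj.IsStableUnderRetracts]

variable (X) in
-- Every complex is fibrant, hence so is every simplicial object, and horn lifting passes across the
-- copower adjunction.
lemma kanComplex_homSSet (hproj : HasEnoughFunctorialProjectives Proj) (hP : Proj P) :
    SSet.KanComplex ((homSSet P).obj X) := by
  have : (homSSet P).IsRightAdjoint := (copowerAdj P).isRightAdjoint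
  have hX : chainFib Proj (Idempotents.DoldKan.N.map (terminal.from X)) := by
    refine (chainFib_iff _ _).2 fun n Q _ b ↦ ⟨0, ?_⟩
    have h : IsZero (Idempotents.DoldKan.N.obj (⊤_ (SimplicialObject C))) :=
      (isZero_zero (ChainComplex C ℕ)).of_iso ((terminalIsTerminal.isTerminalObj
        Idempotents.DoldKan.N _).uniqueUpToIso (isZero_zero (ChainComplex C ℕ)).isTerminal)
    exact ((HomologicalComplex.eval C _ (n + 1)).map_isZero h).eq_of_tgt _ _
  have hX' := (simplicialFib_iff_N hproj).2 hX
  let := SSet.modelCategoryQuillen.instCategoryWithFibrations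
  refine (isFibrant_iff_of_isTerminal ((homSSet P).map (terminal.from X))
    (terminalIsTerminal.isTerminalObj (homSSet P) _)).2
      ((SSet.modelCategoryQuillen.fibration_iff _).2 ?_)
  intro A B i hi
  simp only [SSet.modelCategoryQuillen.J, MorphismProperty.iSup_iff] at hi
  obtain ⟨n, ⟨k⟩⟩ := hi
  rw [← (copowerAdj P).hasLiftingProperty_iff]
  exact hX' _ (simplicialJ.mk n k P hP)

lemma simplicialW_iff (f : X ⟶ Y) : simplicialW Proj f ↔
    ∀ P : C, Proj P → IsWeakEquivalence ((homSSet P).map f) :=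
  forall_congr' fun P ↦ forall_congr' fun _ ↦ isWeakEquivalence_iff_of_arrow_iso
    (Arrow.isoMk (constHomIso P X) (constHomIso P Y) (constHomIso_naturality P f).symm)

lemma simplicialW_comp_iff_of_right {Z : SimplicialObject C} (f : X ⟶ Y) {g : Y ⟶ Z}
    (hg : simplicialW Proj g) : simplicialW Proj (f ≫ g) ↔ simplicialW Proj f := by
  rw [simplicialW_iff, simplicialW_iff]
  refine forall_congr' fun P ↦ forall_congr' fun hP ↦ ?_
  rw [Functor.map_comp, isWeakEquivalence_comp_iff_of_right _ ((simplicialW_iff g).1 hg P hP)]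

lemma simplicialW_iff_of_arrow_iso {X' Y' : SimplicialObject C} {f : X ⟶ Y} {f' : X' ⟶ Y'}
    (e : Arrow.mk f ≅ Arrow.mk f') : simplicialW Proj f ↔ simplicialW Proj f' := by
  rw [simplicialW_iff, simplicialW_iff]
  exact forall_congr' fun P ↦ forall_congr' fun hP ↦
    isWeakEquivalence_iff_of_arrow_iso ((homSSet P).mapArrow.mapIso e)

lemma simplicialW_id (X : SimplicialObject C) : simplicialW Proj (𝟙 X) := by
  refine (simplicialW_iff _).2 fun P _ ↦ ?_
  rw [CategoryTheory.Functor.map_id]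
  exact isWeakEquivalence_id _

lemma simplicialW_of_trivFib_N (hproj : HasEnoughFunctorialProjectives Proj) {f : X ⟶ Y}
    (hf : (chainFib Proj ⊓ chainW Proj) (Idempotents.DoldKan.N.map f)) : simplicialW Proj f := by
  refine (simplicialW_iff _).2 fun P hP ↦ isWeakEquivalence_of_rlp ?_
  intro A B i hi
  obtain ⟨n⟩ := hi
  rw [← (copowerAdj P).hasLiftingProperty_iff]
  exact rlp_simplicialI_of_N hproj hf hP _

lemma simplicialW_gamma_of_trivFib (hproj : HasEnoughFunctorialProjectives Proj)
    {A B : ChainComplex C ℕ} {f : A ⟶ B} (hf : MorphismProperty.rlp (chainI Proj) f) :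
    simplicialW Proj (Idempotents.DoldKan.Γ.map f) := by
  refine simplicialW_of_trivFib_N hproj ?_
  rw [← rlp_chainI_eq]
  let I : MorphismProperty (ChainComplex C ℕ) := chainI Proj
  exact (MorphismProperty.arrow_mk_iso_iff I.rlp (nGammaArrowIso f)).2 hf

/-- Ken Brown's argument: in `f = i ≫ p` the map `p` is a trivial fibration, and `i` is a section of
the projection `r` from the biproduct, also a trivial fibration. Trivial fibrations are handled by
lifting, and two-out-of-three does the rest. -/
lemma simplicialW_gamma (hproj : HasEnoughFunctorialProjectives Proj) {A B : ChainComplex C ℕ}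
    {f : A ⟶ B} (hf : chainW Proj f) : simplicialW Proj (Idempotents.DoldKan.Γ.map f) := by
  obtain ⟨F, ν, h⟩ := id hproj
  let d := (trivCofFibData h).factorizationData f
  have hdW : chainW Proj d.p := MorphismProperty.of_precomp (W := chainW Proj) (W' := chainW Proj)
    d.i d.p d.hi.2 (by rwa [d.fac])
  have hp : simplicialW Proj (Idempotents.DoldKan.Γ.map d.p) :=
    simplicialW_gamma_of_trivFib hproj (by rw [rlp_chainI_eq]; exact ⟨d.hp, hdW⟩)
  have hi : simplicialW Proj (Idempotents.DoldKan.Γ.map d.i) := by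
    let r : d.Z ⟶ A := biprod.fst
    have hl : d.i ≫ r = 𝟙 A := biprod.inl_fst
    have hr : MorphismProperty.rlp (chainI Proj) r := by
      rw [rlp_chainI_eq]
      refine ⟨(chainFib_iff _ _).2 fun n P _ y ↦ ⟨y ≫ d.i.f (n + 1), ?_⟩,
        MorphismProperty.of_precomp (W := chainW Proj) (W' := chainW Proj) d.i r d.hi.2 ?_⟩
      · dsimp only
        rw [assoc, ← HomologicalComplex.comp_f, hl, HomologicalComplex.id_f, comp_id]
      · rw [hl]
        exact (chainW_iff Proj _).2 fun P _ n ↦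
          ⟨fun y hy ↦ ⟨y, hy, 0, by simp⟩, fun x hx w hw ↦ ⟨w, by simpa using hw⟩⟩
    have hl' := congrArg Idempotents.DoldKan.Γ.map hl
    rw [Functor.map_comp, CategoryTheory.Functor.map_id] at hl'
    rw [← simplicialW_comp_iff_of_right _ (simplicialW_gamma_of_trivFib hproj hr), hl']
    exact simplicialW_id _
  rw [← d.fac, Functor.map_comp]
  exact (simplicialW_comp_iff_of_right _ hp).2 hi

lemma simplicialW_iff_N (hproj : HasEnoughFunctorialProjectives Proj) {f : X ⟶ Y} :
    simplicialW Proj f ↔ chainW Proj (Idempotents.DoldKan.N.map f) := by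
  constructor
  · intro hf
    refine (chainW_iff _ _).2 fun P hP n ↦ ?_
    have := kanComplex_homSSet X hproj hP
    have := kanComplex_homSSet Y hproj hP
    obtain ⟨ψ, h₁, h₂⟩ := exists_homotopyInverse ((simplicialW_iff f).1 hf P hP)
    exact exists_of_homotopyEquiv f ψ (adjHomologyEq_of_quot_eq h₁) (adjHomologyEq_of_quot_eq h₂) n
  · intro hf
    exact (simplicialW_iff_of_arrow_iso (gammaNArrowIso f)).1 (simplicialW_gamma hproj hf)

end SimplicialWeakEquivalences

/-! ### The model structure on simplicial objects -/

section

variable {C : Type u} [Category.{v} C] [Preadditive C] [IsIdempotentComplete C]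
  [HasCoproducts.{v} C] [HasFiniteCoproducts C] [HasZeroObject C] [HasLimits C] [HasColimits C]
  [HasBinaryBiproducts C] {Proj : ObjectProperty C} [Proj.IsStableUnderRetracts]

theorem isModelCategory_simplicial (hproj : HasEnoughFunctorialProjectives Proj) :
    IsModelCategory.{v} (simplicialW Proj) (simplicialCof Proj) (simplicialFib Proj) := by
  refine (isModelCategory_chain hproj).of_equivalence Idempotents.DoldKan.equivalence ?_ ?_ ?_
  · ext X Y f
    exact simplicialW_iff_N hproj
  · ext X Y f
    exact simplicialCof_iff_N hproj
  · ext X Y f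
    exact simplicialFib_iff_N hproj

lemma simplicialFib_gamma_map (hproj : HasEnoughFunctorialProjectives Proj) {A B : ChainComplex C ℕ}
    {f : A ⟶ B} (hf : chainFib Proj f) : simplicialFib Proj (Idempotents.DoldKan.Γ.map f) := by
  let J : MorphismProperty (ChainComplex C ℕ) := chainJ Proj
  exact (simplicialFib_iff_N hproj).2
    ((MorphismProperty.arrow_mk_iso_iff J.rlp (nGammaArrowIso f)).2 hf)

theorem isLeftQuillen_gamma (hproj : HasEnoughFunctorialProjectives Proj) :
    IsLeftQuillen (Idempotents.DoldKan.Γ : ChainComplex C ℕ ⥤ SimplicialObject C)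
      (chainW Proj) (chainCof Proj) (simplicialW Proj) (simplicialCof Proj) where
  isLeftAdjoint := inferInstance
  map_cof _ _ _ hf := simplicialCof_gamma_map hproj hf
  map_trivCof _ _ _ hf := ⟨simplicialCof_gamma_map hproj hf.1, simplicialW_gamma hproj hf.2⟩

theorem isRightQuillen_gamma (hproj : HasEnoughFunctorialProjectives Proj) :
    IsRightQuillen (Idempotents.DoldKan.Γ : ChainComplex C ℕ ⥤ SimplicialObject C)
      (chainW Proj) (chainFib Proj) (simplicialW Proj) (simplicialFib Proj) where
  isRightAdjoint := inferInstance
  map_fib _ _ _ hf := simplicialFib_gamma_map hproj hf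
  map_trivFib _ _ _ hf := ⟨simplicialFib_gamma_map hproj hf.1, simplicialW_gamma hproj hf.2⟩

end

end RelHomAlg

end

open RelHomAlg in
theorem mainTheorem5 {C : Type u} [Category.{v} C] [Preadditive C] [HasZeroObject C]
    [HasBinaryBiproducts C] [HasLimits C] [HasColimits C] (Proj : ObjectProperty C) [Proj.IsStableUnderRetracts]
    (hcoprod : ∀ J : Type v, Proj.IsClosedUnderColimitsOfShape (Discrete J))
    (hproj : HasEnoughFunctorialProjectives Proj) :
    (∀ ⦃A B : ChainComplex C ℕ⦄ (f : A ⟶ B),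
      chainW Proj f ↔ IsSplitExact Proj (HomologicalComplex.homotopyCofiber f)) ∧
    IsModelCategory.{v} (chainW Proj) (chainCof Proj) (chainFib Proj) ∧
    (∀ ⦃A B : ChainComplex C ℕ⦄ (f : A ⟶ B),
      chainCof Proj f ↔ ∀ n : ℕ, IsSplitMono (f.f n) ∧ Proj (cokernel (f.f n))) ∧
    (∀ A : ChainComplex C ℕ,
      chainCof Proj (initial.to A) ↔ ∀ n : ℕ, Proj (A.X n)) ∧
    (∀ ⦃A B : ChainComplex C ℕ⦄ (f : A ⟶ B),
      chainFib Proj f ↔ ∀ n : ℕ, 0 < n → projSplit Proj (f.f n)) ∧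
    (∀ A : ChainComplex C ℕ, chainFib Proj (terminal.from A)) ∧
    IsModelCategory.{v} (simplicialW Proj) (simplicialCof Proj) (simplicialFib Proj) ∧
    (AlgebraicTopology.DoldKan.Γ₀ : ChainComplex C ℕ ⥤ SimplicialObject C).IsEquivalence ∧
    IsLeftQuillen (AlgebraicTopology.DoldKan.Γ₀ : ChainComplex C ℕ ⥤ SimplicialObject C)
      (chainW Proj) (chainCof Proj) (simplicialW Proj) (simplicialCof Proj) ∧
    IsRightQuillen (AlgebraicTopology.DoldKan.Γ₀ : ChainComplex C ℕ ⥤ SimplicialObject C)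
      (chainW Proj) (chainFib Proj) (simplicialW Proj) (simplicialFib Proj) := by
  -- Kernels split idempotents, which is what Dold–Kan requires of an additive category.
  have : IsIdempotentComplete C :=
    (Idempotents.isIdempotentComplete_iff_idempotents_have_kernels C).2 fun _ _ _ ↦ inferInstance
  refine ⟨fun _ _ f ↦ chainW_iff_isSplitExact f, isModelCategory_chain hproj,
    fun _ _ f ↦ chainCof_iff hproj f, chainCof_initial_iff hproj, fun _ _ f ↦ ?_,
    chainFib_terminal Proj, isModelCategory_simplicial hproj,
    inferInstanceAs (Idempotents.DoldKan.Γ : ChainComplex C ℕ ⥤ SimplicialObject C).IsEquivalence,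
    isLeftQuillen_gamma hproj, isRightQuillen_gamma hproj⟩
  rw [chainFib_iff]
  exact ⟨fun h n hn ↦ Nat.sub_add_cancel hn ▸ h (n - 1), fun h n ↦ h _ n.succ_pos⟩
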